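/- Consider the Rybko--Stolyar (KSRS) network. There are four buffers and two servers: server 1 serves buffers 1 and 4, server 2 serves buffers 2 and 3. Jobs arrive from outside at buffers 1 and 3 and follow the routes $1\to2\to$ exit and $3\to4\to$ exit, so that the queue lengths satisfy, with $A_i$ and $D_i$ the cumulative arrival and departure processes, $$Q_i(t)=Q_i(0)+A_i(t)-D_i(t)\ (i=1,3),\qquad Q_i(t)=Q_i(0)+D_{i-1}(t)-D_i(t)\ (i=2,4).$$ The network is symmetric: both external arrival streams are Poisson with the same rate $\lambda\in(0,\infty)$, and the service times at buffers 2 and 4 are exponential with the same rate $\mu\in(0,\infty)$. The service rates at buffers 1 and 3 are infinite: whenever such a buffer is served, its whole content passes instantly to the next buffer. The policy is stationary, randomized and non-idling: right after each arrival or service completion, each server decides, independently of everything else and with a probability that depends only on the event that has just occurred and on the current queue lengths, whether to drain its infinite-rate buffer (buffer 1 for server 1, buffer 3 for server 2), and it must do so if its other buffer (4, resp. 2) is empty; at all other times a server works on its finite-rate buffer whenever that is nonempty. Let $Q(t;x)$ be the resulting Markov process of queue lengths with values in $\mathbb Z_+^4$ and initial state $x$ (an infinite-rate buffer whose server has no other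 work is drained at time $0$), let $Z_i(t;x)$ be the cumulative busy time at buffer $i$, let $P^t(x,y)=\mathbb P(Q(t;x)=y)$ and $\|x\|=\sum_i|x_i|$. All the processes, for all $x$, are driven by the same interarrival times, service times and randomization on one probability space. A probability measure $\pi$ on $\mathbb Z_+^4$ is invariant if $\pi(y)=\sum_x\pi(x)P^t(x,y)$ for all $y$ and all $t\ge0$. For $\kappa>0$ and $x\in\mathbb R_+^4$ put $q^\kappa(t;x)=\kappa^{-1}Q(\kappa t;\lfloor\kappa x\rfloor)$ and $z^\kappa(t;x)=\kappa^{-1}Z(\kappa t;\lfloor\kappa x\rfloor)$. A fluid limit from $x$ is a limit $(q,z)$ of $(q^{\kappa_n}(\cdot\,;x),z^{\kappa_n}(\cdot\,;x))$, uniform on compact time intervals, along some sequence $\kappa_n\to\infty$. **Theorem.** There exist $\lambda,\mu>0$ and a policy as above such that: 1. The interarrival and service times are mutually independent with exponential distributions. 2. The fluid limit model is stable: there is a deterministic $T_0>0$ such that, almost surely, every fluid limit $(q,z)$ (from any $x\in\mathbb R_+^4$) with $\|q(0)\|=1$ satisfies $q(t)=0$ for all $t\ge T_0$. It is also stable in the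 sense that there is a deterministic $T_0>0$ such that, almost surely, $\lim_{\kappa\to\infty}\|q^\kappa(t;x)\|=0$ for all $x\in\mathbb R_+^4$ with $\|x\|=1$ and all $t\ge T_0$. There is a unique invariant probability measure $\pi$. 3. $\mathbb E_\pi[\Psi(\|Q(0)\|)]=\sum_x\pi(x)\Psi(\|x\|)=\infty$, where $\Psi(s)=s^{\log s}$ for $s>0$ and $\Psi(0)=0$. In particular $\pi$ does not have an exponential tail, i.e. $\sum_x\pi(x)e^{\theta\|x\|}=\infty$ for every $\theta>0$, and the process is not exponentially ergodic, i.e. there is no $\theta>0$ such that $\lim_{t\to\infty}e^{\theta t}\,|P^t(x,y)-\pi(y)|=0$ for all $x,y\in\mathbb Z_+^4$. -/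

import Mathlib

open MeasureTheory ProbabilityTheory Filter Topology
open scoped ENNReal

noncomputable section

namespace KSRS

/-! ### The network

Server 1 serves buffers 1 and 4, server 2 serves buffers 2 and 3. Jobs arrive from outside at
buffers 1 and 3; routes are `1 → 2 → exit` and `3 → 4 → exit`. The service rates at buffers 1 and 3
are infinite: when such a buffer is served, all of its contents pass instantly to the next one. -/

/-- The four buffers. -/
inductive Buffer
  | b1 | b2 | b3 | b4
  deriving DecidableEq

instance : Fintype Buffer :=
  ⟨{.b1, .b2, .b3, .b4}, fun i => by cases i <;> decide⟩

/-- The two servers. -/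
inductive Server
  | s1 | s2
  deriving DecidableEq

instance : Fintype Server :=
  ⟨{.s1, .s2}, fun s => by cases s <;> decide⟩

/-- Queue length vectors, the elements of `ℤ₊⁴`. -/
abbrev State := Buffer → ℕ

/-- The `L₁` norm of a queue length vector. -/
def norm1 (x : State) : ℕ := ∑ i, x i

/-- The parameters of the symmetric network: the rate `lam` of each of the Poisson arrival streams
into buffers 1 and 3, and the service rate `mu` of each of the buffers 2 and 4. -/
structure Params where
  lam : ℝ
  mu : ℝ
  lam_pos : 0 < lam
  mu_pos : 0 < mu

/-- The rate of the exponential clock attached to a buffer: the interarrival times at the entry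
buffers 1 and 3, the service times at the exit buffers 2 and 4. -/
def Params.rate (N : Params) : Buffer → ℝ
  | .b1 => N.lam
  | .b3 => N.lam
  | .b2 => N.mu
  | .b4 => N.mu

/-- A randomized stationary policy. Right after an event (an arrival to buffer 1 or 3, or a service
completion at buffer 2 or 4, named by its buffer `e`) that has brought the queue lengths to `y`,
server `1` drains buffer `1` with probability `drainProb s1 e y` and server `2` drains
buffer `3` with probability `drainProb s2 e y`; the choices are independent of each other and of
everything else. At all other times server 1 works on buffer 4 and server 2 on buffer 2. -/
structure Policy where
  drainProb : Server → Buffer → State → ℝ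
  nonneg : ∀ s e y, 0 ≤ drainProb s e y
  le_one : ∀ s e y, drainProb s e y ≤ 1

/-- The policy is non-idling: a server all of whose jobs are in its infinite rate buffer
works on that buffer. (A nonempty buffer 4, resp. 2, that receives no service in an instant of
draining receives full service in the time that follows, since draining takes zero time.) -/
def Policy.NonIdling (φ : Policy) : Prop :=
  (∀ e (y : State), 0 < y .b1 → y .b4 = 0 → φ.drainProb .s1 e y = 1) ∧
  (∀ e (y : State), 0 < y .b3 → y .b2 = 0 → φ.drainProb .s2 e y = 1)

/-! ### Random primitives -/

/-- Sample points: `ω.1 i n` is the `n`-th interarrival time (`i` one of the buffers 1, 3) or the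
`n`-th service time (`i` one of the buffers 2, 4); `ω.2 s n` is the random number that server `s`
uses for its decision at the `n`-th event. -/
abbrev Sample := (Buffer → ℕ → ℝ) × (Server → ℕ → ℝ)

/-- All interarrival and service times are exponential with the rates of the network, the numbers
used for randomization are uniform on `[0, 1]`, and everything is independent. -/
def prob (N : Params) : Measure Sample :=
  (Measure.pi fun i : Buffer => Measure.infinitePi fun _ : ℕ => expMeasure (N.rate i)).prod
    (Measure.pi fun _ : Server => Measure.infinitePi fun _ : ℕ =>
      (volume : Measure ℝ).restrict (Set.Icc 0 1))

/-- Under `P`, the interarrival and service times are mutually independent and exponentially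
distributed with the rates of the network, and they are independent of the randomization. -/
def ExponentialPrimitives (N : Params) (P : Measure Sample) : Prop :=
  IsProbabilityMeasure P ∧
  iIndepFun (fun (p : Buffer × ℕ) (ω : Sample) => ω.1 p.1 p.2) P ∧
  (∀ i n, HasLaw (fun ω : Sample => ω.1 i n) (expMeasure (N.rate i)) P) ∧
  IndepFun (fun ω : Sample => ω.1) (fun ω : Sample => ω.2) P

/-! ### The queue length process -/

/-- Buffer 1 is emptied into buffer 2 if `d1`, buffer 3 is emptied into buffer 4 if `d3`. -/
def drain (d1 d3 : Prop) [Decidable d1] [Decidable d3] (y : State) : State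
  | .b1 => if d1 then 0 else y .b1
  | .b2 => if d1 then y .b2 + y .b1 else y .b2
  | .b3 => if d3 then 0 else y .b3
  | .b4 => if d3 then y .b4 + y .b3 else y .b4

/-- What non-idling enforces at time zero: an infinite rate buffer whose server has no other
work is drained at once. -/
def settle (x : State) : State := drain (x .b4 = 0) (x .b2 = 0) x

/-- The change of the queue lengths by the event at buffer `e`, before any draining: an
arrival at buffer 1 or 3, a departure from the network at buffer 2 or 4. -/
def jump (e : Buffer) (x : State) : State :=
  match e with
  | .b1 => Function.update x .b1 (x .b1 + 1)
  | .b3 => Function.update x .b3 (x .b3 + 1)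
  | .b2 => Function.update x .b2 (x .b2 - 1)
  | .b4 => Function.update x .b4 (x .b4 - 1)

/-- The running clocks: the arrival clocks always run, the service clock of buffer 2 or 4 runs
while that buffer is nonempty. -/
def Running (x : State) : Buffer → Prop
  | .b1 => True
  | .b3 => True
  | .b2 => 0 < x .b2
  | .b4 => 0 < x .b4

/-- The situation right after an event: the time of the event, the queue lengths, and for each
clock the sequence that consists of its residual time followed by the interarrival (service)
times not used yet. -/
structure Sim where
  time : ℝ
  queue : State
  clock : Buffer → ℕ → ℝ

/-- The clock of buffer `i` is running and is the first to expire. -/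
def Sim.Fires (S : Sim) (i : Buffer) : Prop :=
  Running S.queue i ∧ ∀ j, Running S.queue j → S.clock i 0 ≤ S.clock j 0

open Classical in
/-- The buffer at which the next event takes place (ties have probability zero). -/
def Sim.next (S : Sim) : Buffer :=
  if S.Fires .b1 then .b1 else if S.Fires .b3 then .b3 else if S.Fires .b2 then .b2 else .b4

/-- The time until the next event. -/
def Sim.hold (S : Sim) : ℝ := S.clock S.next 0

open Classical in
/-- The clocks right after the next event: the expired one starts its next interval, the other
running ones have advanced, the idle ones are unchanged. -/
def Sim.nextClock (S : Sim) (i : Buffer) : ℕ → ℝ :=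
  if i = S.next then fun n => S.clock i (n + 1)
  else if Running S.queue i then Function.update (S.clock i) 0 (S.clock i 0 - S.hold)
  else S.clock i

/-- One event, followed by the decisions of the two servers, which use the numbers `u s`. -/
def Sim.step (φ : Policy) (u : Server → ℝ) (S : Sim) : Sim where
  time := S.time + S.hold
  queue :=
    let y := jump S.next S.queue
    drain (u .s1 < φ.drainProb .s1 S.next y) (u .s2 < φ.drainProb .s2 S.next y) y
  clock := S.nextClock

/-- The situation after `n` events, when the queue lengths are `x` initially. -/
def sim (φ : Policy) (x : State) (ω : Sample) : ℕ → Sim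
  | 0 => ⟨0, settle x, ω.1⟩
  | n + 1 => (sim φ x ω n).step φ (fun s => ω.2 s n)

/-- The queue length process `Q(t; x)`, right continuous and constant between events. -/
def Q (φ : Policy) (x : State) (t : ℝ) (ω : Sample) : State :=
  (sim φ x ω (sInf {n : ℕ | t < (sim φ x ω (n + 1)).time})).queue

/-- The cumulative busy time `Z(t; x)` at each of the buffers. Service at buffers 1 and 3 takes no
time; buffers 2 and 4 are in service whenever they are nonempty. -/
def Z (φ : Policy) (x : State) (t : ℝ) (ω : Sample) : Buffer → ℝ
  | .b1 => 0
  | .b3 => 0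
  | .b2 => (volume {s ∈ Set.Icc 0 t | 0 < Q φ x s ω .b2}).toReal
  | .b4 => (volume {s ∈ Set.Icc 0 t | 0 < Q φ x s ω .b4}).toReal

/-! ### Invariant measures and ergodicity -/

/-- The transition semigroup `P^t(x, y)`. -/
def trans (N : Params) (φ : Policy) (t : ℝ) (x y : State) : ℝ≥0∞ :=
  prob N {ω | Q φ x t ω = y}

/-- The probability measure `π` on `ℤ₊⁴` is invariant. -/
def IsInvariant (N : Params) (φ : Policy) (π : PMF State) : Prop :=
  ∀ t : ℝ, 0 ≤ t → ∀ y, π y = ∑' x, π x * trans N φ t x y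

/-- `π` has an exponential tail. -/
def HasExpTail (π : PMF State) : Prop :=
  ∃ θ : ℝ, 0 < θ ∧ ∑' x, π x * ENNReal.ofReal (Real.exp (θ * norm1 x)) < ∞

/-- The process is exponentially ergodic: it has an invariant probability measure `π`, and
`e^{θt} |P_x(Q(t) = y) - π(y)| → 0` for some `θ > 0` and all `x`, `y`. -/
def ExpErgodic (N : Params) (φ : Policy) : Prop :=
  ∃ π : PMF State, IsInvariant N φ π ∧ ∃ θ : ℝ, 0 < θ ∧ ∀ x y,
    Tendsto (fun t : ℝ => Real.exp (θ * t) * |(trans N φ t x y).toReal - (π y).toReal|)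
      atTop (𝓝 0)

/-- `Ψ(s) = s^{log s}` for `s > 0`, and `Ψ(0) = 0`. -/
def Psi (s : ℝ) : ℝ := if 0 < s then s ^ Real.log s else 0

/-- `E_π[Ψ(‖Q(0)‖)]`. -/
def meanPsi (π : PMF State) : ℝ≥0∞ := ∑' x, π x * ENNReal.ofReal (Psi (norm1 x))

/-! ### The fluid limit model -/

/-- The scaled queue lengths `q^κ(t; x^κ) = κ⁻¹ Q(κt; κx^κ)`, where `κx^κ = ⌊κx⌋`. -/
def qScaled (φ : Policy) (κ : ℝ) (x : Buffer → ℝ) (ω : Sample) (t : ℝ) (i : Buffer) : ℝ :=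
  κ⁻¹ * (Q φ (fun j => ⌊κ * x j⌋₊) (κ * t) ω i : ℝ)

/-- The scaled busy times `z^κ(t; x^κ) = κ⁻¹ Z(κt; κx^κ)`, where `κx^κ = ⌊κx⌋`. -/
def zScaled (φ : Policy) (κ : ℝ) (x : Buffer → ℝ) (ω : Sample) (t : ℝ) (i : Buffer) : ℝ :=
  κ⁻¹ * Z φ (fun j => ⌊κ * x j⌋₊) (κ * t) ω i

/-- `(q, z)` belongs to the set `𝓛_x(ω)` of fluid limits: it is the limit, uniformly on compact
time intervals, of `(q^κ, z^κ)` along some sequence of scales `κ → ∞`. -/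
def IsFluidLimit (φ : Policy) (x : Buffer → ℝ) (ω : Sample) (q z : ℝ → Buffer → ℝ) : Prop :=
  ∃ κ : ℕ → ℝ, (∀ n, 0 < κ n) ∧ Tendsto κ atTop atTop ∧ ∀ T : ℝ,
    TendstoUniformlyOn (fun n t => qScaled φ (κ n) x ω t) q atTop (Set.Icc 0 T) ∧
    TendstoUniformlyOn (fun n t => zScaled φ (κ n) x ω t) z atTop (Set.Icc 0 T)

/-- The fluid limit model is stable: with probability one, every fluid limit with `‖q(0)‖ = 1`
vanishes from some deterministic time `T₀` on. -/
def FluidLimitStable (N : Params) (φ : Policy) : Prop :=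
  ∃ T₀ : ℝ, 0 < T₀ ∧ ∀ᵐ ω ∂(prob N), ∀ x : Buffer → ℝ, (∀ i, 0 ≤ x i) →
    ∀ q z, IsFluidLimit φ x ω q z → ∑ i, |q 0 i| = 1 → ∀ t, T₀ ≤ t → q t = 0

/-- With probability one, the scaled processes started on the unit sphere vanish in the limit
from some deterministic time `T₀` on (whether or not they have fluid limits). -/
def ScaledPathsVanish (N : Params) (φ : Policy) : Prop :=
  ∃ T₀ : ℝ, 0 < T₀ ∧ ∀ᵐ ω ∂(prob N), ∀ x : Buffer → ℝ, (∀ i, 0 ≤ x i) → ∑ i, x i = 1 →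
    ∀ t, T₀ ≤ t → Tendsto (fun κ : ℝ => ∑ i, qScaled φ κ x ω t i) atTop (𝓝 0)

end KSRS

end

/-!
The proof exhibits a policy under which a server occasionally refuses to pass its jobs on. Normally
each server drains its infinite rate buffer whenever it can, and then buffers 2 and 4 behave like
two independent queues with arrival rate `lam` and service rate `mu = lam + 1`. If, however,
buffer 2 is empty and buffer 4 holds `m > 0` jobs, then server 1 keeps an arriving job in buffer 1
with probability `m⁻⁸`, and from then on it keeps all arriving jobs there until buffer 4 is empty.
During such a period buffer 2 is starved, arriving jobs of the second type go to buffer 4 at once,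
and when the period ends the accumulated jobs move to buffer 2. The policy is symmetric in the two
servers.

*Reduction to a chain.* The process is constructed pathwise. By the memoryless property its
transition probabilities satisfy the integrated backward equation (`backwardEq_trans`), whose bounded
solution is unique (`BackwardEq.le`), and so does the uniformized chain with transition operator `T`
observed at Poisson epochs. Hence `trans_eq_semi`, and everything about laws becomes a statement
about `T`.

*Stability.* The eighth power of `q₁ + mu * q₄` during a period of holding, and the sum of the
eighth powers of `q₁ + q₂` and `q₃ + q₄` otherwise, is a Lyapunov function: all these linear functions
have negative drift, and the jump by a constant factor when a period of holding begins is compensated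
by its probability `m⁻⁸` (`exists_T_lyap_le`). This yields an invariant measure by Foster's criterion
(`exists_stationary`), and polynomial estimates (`exists_prob_norm_le`) which are summable over all
initial states and integer times of order `n`. By the Borel-Cantelli lemma the scaled paths vanish
from some time on, for all initial states simultaneously (`tendsto_sum_qScaled`), and with them all
fluid limits. Uniqueness of the invariant measure holds since the empty state is reached from
everywhere (`IsInvariant.unique`).

*Heavy tail.* During a period of holding `q₁ + lam * q₄` is a martingale, and
`Φ(s) = exp (log² s / 2)` is convex. If the period ends with `k` jobs in buffer 2, then a new period
begins soon with a probability of order `k⁻⁸`, in which the argument of `Φ` is at least `lam * k`,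
and `k⁻⁸ * Φ(lam * k)` exceeds `8 * Φ(k)` since `log lam ≥ 8`. This gives a function `growth` that is
subharmonic on all settled states and strictly so at the empty state. It cannot be integrable with
respect to an invariant measure, and it is at most a multiple of `Ψ` (`meanPsi_eq_top`).

*No exponential ergodicity.* By a renewal argument in the manner of Kendall, exponential convergence
of the probability of being empty would make the tail of the time to reach the empty state under the
invariant measure decay exponentially. As queue lengths decrease at most linearly in time, the
invariant measure would have an exponential tail (`hasExpTail_of_exp_convergence`).
-/

noncomputable section

namespace KSRS

/-! ### The random primitives -/

lemma Params.rate_pos (N : Params) (i : Buffer) : 0 < N.rate i := by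
  cases i <;> simp [Params.rate, N.lam_pos, N.mu_pos]

instance (N : Params) (i : Buffer) : IsProbabilityMeasure (expMeasure (N.rate i)) :=
  isProbabilityMeasure_expMeasure (N.rate_pos i)

/-- The uniform distribution on `[0, 1]`. -/
abbrev unif : Measure ℝ := (volume : Measure ℝ).restrict (Set.Icc 0 1)

instance : IsProbabilityMeasure unif := ⟨by simp⟩

/-- The law of the interarrival and service times. -/
def clockLaw (N : Params) : Measure (Buffer → ℕ → ℝ) :=
  Measure.pi fun i : Buffer => Measure.infinitePi fun _ : ℕ => expMeasure (N.rate i)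

/-- The law of the random numbers used for the decisions. -/
def decisionLaw : Measure (Server → ℕ → ℝ) :=
  Measure.pi fun _ : Server => Measure.infinitePi fun _ : ℕ => unif

instance (N : Params) : IsProbabilityMeasure (clockLaw N) := by
  unfold clockLaw; infer_instance

instance : IsProbabilityMeasure decisionLaw := by
  unfold decisionLaw; infer_instance

lemma prob_eq (N : Params) : prob N = (clockLaw N).prod decisionLaw := rfl

instance (N : Params) : IsProbabilityMeasure (prob N) := by
  rw [prob_eq]; infer_instance

lemma clockLaw_eq_infinitePi (N : Params) :
    clockLaw N =
      Measure.infinitePi fun i => Measure.infinitePi fun _ : ℕ => expMeasure (N.rate i) := by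
  rw [Measure.infinitePi_eq_pi, clockLaw]

lemma iIndepFun_clock (N : Params) :
    iIndepFun (fun (p : Buffer × ℕ) (ω : Sample) => ω.1 p.1 p.2) (prob N) := by
  have h1 : iIndepFun (fun (p : Buffer × ℕ) (c : Buffer → ℕ → ℝ) => c p.1 p.2)
      (clockLaw N) := by
    rw [clockLaw_eq_infinitePi]
    exact iIndepFun_uncurry_infinitePi' (μ := fun i (_ : ℕ) => expMeasure (N.rate i))
      (X := fun _ _ x => x) (by fun_prop)
  have h2 : (prob N).map (Prod.fst : Sample → _) = clockLaw N := by
    rw [prob_eq]; exact measurePreserving_fst.map_eq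
  rw [iIndepFun_iff_map_fun_eq_infinitePi_map (by fun_prop)] at h1 ⊢
  rw [← h2, Measure.map_map (by fun_prop) measurable_fst] at h1
  refine h1.trans ?_
  congr 1
  funext p
  rw [Measure.map_map (by fun_prop) measurable_fst]
  rfl

lemma hasLaw_clock (N : Params) (i : Buffer) (n : ℕ) :
    HasLaw (fun ω : Sample => ω.1 i n) (expMeasure (N.rate i)) (prob N) := by
  have h1 : MeasurePreserving (Prod.fst : Sample → _) (prob N) (clockLaw N) := by
    rw [prob_eq]; exact measurePreserving_fst
  have h2 : MeasurePreserving (Function.eval i) (clockLaw N)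
      (Measure.infinitePi fun _ : ℕ => expMeasure (N.rate i)) := measurePreserving_eval _ i
  have h3 := measurePreserving_eval_infinitePi (fun _ : ℕ => expMeasure (N.rate i)) n
  exact ((h3.comp h2).comp h1).hasLaw

lemma exponentialPrimitives (N : Params) : ExponentialPrimitives N (prob N) := by
  refine ⟨inferInstance, iIndepFun_clock N, hasLaw_clock N, ?_⟩
  rw [prob_eq]
  exact indepFun_prod measurable_id measurable_id

/-! ### The exponential distribution -/

lemma lintegral_expMeasure {r : ℝ} {f : ℝ → ℝ≥0∞} (hf : Measurable f) :
    ∫⁻ a, f a ∂(expMeasure r) =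
      ∫⁻ a in Set.Ioi 0, ENNReal.ofReal (r * Real.exp (-(r * a))) * f a := by
  have h1 : expMeasure r = volume.withDensity (exponentialPDF r) := rfl
  have hm : Measurable (exponentialPDF r) :=
    (measurable_exponentialPDFReal r).ennreal_ofReal
  rw [h1, lintegral_withDensity_eq_lintegral_mul _ hm hf,
    ← setLIntegral_congr Ioi_ae_eq_Ici.symm, ← lintegral_indicator measurableSet_Ici]
  refine lintegral_congr fun a => ?_
  by_cases ha : 0 ≤ a
  · simp [Set.indicator, ha, exponentialPDF_of_nonneg]
  · simp [Set.indicator, ha, exponentialPDF_of_neg (not_le.1 ha)]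

lemma expMeasure_absolutelyContinuous (r : ℝ) : expMeasure r ≪ volume :=
  withDensity_absolutelyContinuous _ _

instance (r : ℝ) : NullSingletonClass (expMeasure r) :=
  ⟨fun _ => expMeasure_absolutelyContinuous r (by simp)⟩

lemma ae_pos_expMeasure (r : ℝ) : ∀ᵐ a ∂(expMeasure r), 0 < a := by
  have h : MeasurableSet {a : ℝ | 0 < a} := measurableSet_Ioi
  rw [ae_iff]
  have h2 : MeasurableSet {a : ℝ | ¬ 0 < a} := h.compl
  rw [← lintegral_indicator_one h2, lintegral_expMeasure (measurable_one.indicator h2),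
    lintegral_eq_zero_iff' (by fun_prop (disch := assumption))]
  refine (ae_restrict_iff' measurableSet_Ioi).2 (Eventually.of_forall fun a ha => ?_)
  simp [Set.mem_Ioi.1 ha]

/-- The exponential distribution is memoryless. -/
lemma lintegral_expMeasure_memoryless {r t : ℝ} (ht : 0 ≤ t) {f : ℝ → ℝ≥0∞}
    (hf : Measurable f) :
    ∫⁻ a in Set.Ioi t, f (a - t) ∂(expMeasure r) =
      ENNReal.ofReal (Real.exp (-(r * t))) * ∫⁻ a, f a ∂(expMeasure r) := by
  have hm : Measurable fun a => (Set.Ioi t).indicator (fun a => f (a - t)) a :=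
    (hf.comp (measurable_id.sub_const t)).indicator measurableSet_Ioi
  rw [← lintegral_indicator measurableSet_Ioi, lintegral_expMeasure hm, lintegral_expMeasure hf,
    ← lintegral_const_mul _ (by fun_prop), ← lintegral_indicator measurableSet_Ioi,
    ← lintegral_indicator measurableSet_Ioi]
  refine Eq.trans (lintegral_congr fun a => ?_) (lintegral_sub_right_eq_self _ t)
  by_cases ha : t < a
  · have h0 : 0 < a := ht.trans_lt ha
    have h1 : 0 < a - t := sub_pos.2 ha
    simp only [Set.indicator, Set.mem_Ioi, ha, h0, h1, if_true]
    rw [← mul_assoc, ← ENNReal.ofReal_mul (Real.exp_pos _).le, mul_left_comm, ← Real.exp_add]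
    ring_nf
  · have h1 : ¬ 0 < a - t := by simpa using ha
    simp [Set.indicator, ha, h1]

lemma integrable_id_expMeasure {r : ℝ} (hr : 0 < r) : Integrable id (expMeasure r) := by
  have h1 : expMeasure r = volume.withDensity (exponentialPDF r) := rfl
  have hm : Measurable (exponentialPDF r) :=
    (measurable_exponentialPDFReal r).ennreal_ofReal
  rw [h1, integrable_withDensity_iff hm (by simp [exponentialPDF])]
  have h := integrableOn_rpow_mul_exp_neg_mul_rpow (p := 1) (s := 1) (b := r)
    (by norm_num) one_pos hr
  have h2 := Integrable.const_mul h r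
  rw [← IntegrableOn, ← integrable_indicator_iff measurableSet_Ioi] at h2
  refine h2.congr (Eventually.of_forall fun a => ?_)
  rcases lt_trichotomy a 0 with ha | rfl | ha
  · simp [Set.indicator, ha.not_gt, exponentialPDF_of_neg ha]
  · simp
  · simp only [Set.indicator, Set.mem_Ioi, ha, if_true, exponentialPDF_of_nonneg ha.le, id]
    rw [ENNReal.toReal_ofReal (by positivity)]
    simp; ring

lemma integral_id_expMeasure_pos {r : ℝ} (hr : 0 < r) : 0 < ∫ a, a ∂(expMeasure r) := by
  have := isProbabilityMeasure_expMeasure hr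
  have h0 := ae_pos_expMeasure r
  refine (integral_pos_iff_support_of_nonneg_ae (h0.mono fun a ha => ha.le)
    (integrable_id_expMeasure hr)).2 ?_
  have : (Function.support fun a : ℝ => a) =ᵐ[expMeasure r] Set.univ := by
    refine eventuallyEq_univ.2 (h0.mono fun a ha => ha.ne')
  rw [measure_congr this]; simp

/-! ### Regular samples -/

/-- A sample point is regular if all interarrival and service times are positive and obey the
strong law of large numbers with a positive limit, and all decision numbers are less than `1`, so
that a decision that has probability one is always made. -/
structure Regular (ω : Sample) : Prop where
  pos : ∀ i n, 0 < ω.1 i n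
  slln : ∀ i, ∃ m : ℝ, 0 < m ∧
    Tendsto (fun n : ℕ => (∑ j ∈ Finset.range n, ω.1 i j) / n) atTop (𝓝 m)
  lt_one : ∀ s n, ω.2 s n < 1

lemma ae_regular (N : Params) : ∀ᵐ ω ∂(prob N), Regular ω := by
  have h1 : ∀ᵐ ω : Sample ∂(prob N), ∀ i n, 0 < ω.1 i n := by
    refine ae_all_iff.2 fun i => ae_all_iff.2 fun n => ?_
    have h := hasLaw_clock N i n
    have h2 := ae_pos_expMeasure (N.rate i)
    rw [← h.map_eq] at h2
    exact ae_of_ae_map h.aemeasurable h2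
  have h2 : ∀ᵐ ω : Sample ∂(prob N), ∀ i, ∃ m : ℝ, 0 < m ∧
      Tendsto (fun n : ℕ => (∑ j ∈ Finset.range n, ω.1 i j) / n) atTop (𝓝 m) := by
    refine ae_all_iff.2 fun i => ?_
    have hl := hasLaw_clock N i
    have hid : ∀ n, IdentDistrib (fun ω : Sample => ω.1 i n) (fun ω : Sample => ω.1 i 0)
        (prob N) (prob N) := fun n =>
      ⟨(hl n).aemeasurable, (hl 0).aemeasurable, by rw [(hl n).map_eq, (hl 0).map_eq]⟩
    have hint : Integrable (fun ω : Sample => ω.1 i 0) (prob N) := by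
      have h := integrable_id_expMeasure (N.rate_pos i)
      rw [← (hl 0).map_eq] at h
      exact h.comp_aemeasurable (hl 0).aemeasurable
    have hpos : 0 < ∫ ω : Sample, ω.1 i 0 ∂(prob N) := by
      have h := integral_id_expMeasure_pos (N.rate_pos i)
      rwa [← (hl 0).map_eq, integral_map (hl 0).aemeasurable (by fun_prop)] at h
    have hind : Pairwise fun m n =>
        IndepFun (fun ω : Sample => ω.1 i m) (fun ω : Sample => ω.1 i n) (prob N) :=
      fun m n hmn => (iIndepFun_clock N).indepFun (i := (i, m)) (j := (i, n)) (by simp [hmn])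
    exact (strong_law_ae_real _ hint hind hid).mono fun ω h => ⟨_, hpos, h⟩
  have h3 : ∀ᵐ ω : Sample ∂(prob N), ∀ s n, ω.2 s n < 1 := by
    refine ae_all_iff.2 fun s => ae_all_iff.2 fun n => ?_
    have m1 : MeasurePreserving (Prod.snd : Sample → _) (prob N) decisionLaw := by
      rw [prob_eq]; exact measurePreserving_snd
    have m2 : MeasurePreserving (Function.eval s) decisionLaw
        (Measure.infinitePi fun _ : ℕ => unif) := measurePreserving_eval _ s
    have m3 := measurePreserving_eval_infinitePi (fun _ : ℕ => unif) n
    have m := (m3.comp m2).comp m1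
    have h : ∀ᵐ a ∂unif, a < 1 := by
      rw [unif, ← restrict_Ico_eq_restrict_Icc]
      exact (ae_restrict_iff' measurableSet_Ico).2 (Eventually.of_forall fun a ha => ha.2)
    exact m.quasiMeasurePreserving.ae h
  filter_upwards [h1, h2, h3] with ω h1 h2 h3
  exact ⟨h1, h2, h3⟩

lemma Regular.tendsto_sum {ω : Sample} (h : Regular ω) (i : Buffer) :
    Tendsto (fun n => ∑ j ∈ Finset.range n, ω.1 i j) atTop atTop := by
  obtain ⟨m, hm, ht⟩ := h.slln i
  have h1 := ht.pos_mul_atTop hm (tendsto_natCast_atTop_atTop (R := ℝ))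
  refine h1.congr' ?_
  filter_upwards [eventually_gt_atTop 0] with n hn
  have : (n : ℝ) ≠ 0 := by positivity
  field_simp

/-! ### Sample paths -/

lemma Sim.fires_next (S : Sim) : S.Fires S.next := by
  classical
  obtain ⟨i, hi, hmin⟩ := Finset.exists_min_image (Finset.univ.filter fun i => Running S.queue i)
    (fun i => S.clock i 0) ⟨.b1, Finset.mem_filter.2 ⟨Finset.mem_univ _, trivial⟩⟩
  have h : S.Fires i := ⟨by simpa using hi, fun j hj => hmin j (by simpa using hj)⟩
  unfold Sim.next
  split_ifs with h1 h3 h2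
  · exact h1
  · exact h3
  · exact h2
  · cases i <;> first | exact absurd h ‹_› | exact h

lemma Sim.hold_le (S : Sim) {j : Buffer} (hj : Running S.queue j) : S.hold ≤ S.clock j 0 :=
  S.fires_next.2 j hj

/-- The situation after `n` further events, starting from `S`. -/
def run (φ : Policy) (u : Server → ℕ → ℝ) (S : Sim) : ℕ → Sim
  | 0 => S
  | n + 1 => (run φ u S n).step φ (fun s => u s n)

lemma sim_eq_run (φ : Policy) (x : State) (ω : Sample) (n : ℕ) :
    sim φ x ω n = run φ ω.2 ⟨0, settle x, ω.1⟩ n := by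
  induction n with
  | zero => rfl
  | succ n ih => simp only [sim, run, ih]

lemma run_succ' (φ : Policy) (u : Server → ℕ → ℝ) (S : Sim) (n : ℕ) :
    run φ u S (n + 1) =
      run φ (fun s k => u s (k + 1)) (S.step φ (fun s => u s 0)) n := by
  induction n with
  | zero => rfl
  | succ n ih => rw [run, ih]; rfl

/-- The same situation, with the clock time set forward by `a`. -/
def Sim.addTime (S : Sim) (a : ℝ) : Sim := ⟨a + S.time, S.queue, S.clock⟩

lemma run_addTime (φ : Policy) (u : Server → ℕ → ℝ) (S : Sim) (a : ℝ) (n : ℕ) :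
    run φ u (S.addTime a) n = (run φ u S n).addTime a := by
  induction n with
  | zero => rfl
  | succ n ih =>
    rw [run, ih]
    simp only [run, Sim.step, Sim.addTime, Sim.mk.injEq]
    exact ⟨add_assoc _ _ _, rfl, rfl⟩

/-- A state is settled if every infinite rate buffer whose server has no other work is empty. -/
def Settled (x : State) : Prop := (x .b4 = 0 → x .b1 = 0) ∧ (x .b2 = 0 → x .b3 = 0)

lemma settle_of_settled {x : State} (h : Settled x) : settle x = x := by
  funext i
  cases i <;> simp only [settle, drain] <;> split_ifs with h1 <;> simp_all [Settled]

lemma drain_settled {d1 d3 : Prop} [Decidable d1] [Decidable d3] {y : State}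
    (h1 : 0 < y .b1 → y .b4 = 0 → d1) (h3 : 0 < y .b3 → y .b2 = 0 → d3) :
    Settled (drain d1 d3 y) := by
  constructor
  · simp only [drain]
    intro h
    by_cases hd : d1
    · simp [hd]
    · simp only [hd, if_false]
      by_contra h0
      exact hd (h1 (Nat.pos_of_ne_zero h0) (by split_ifs at h <;> omega))
  · simp only [drain]
    intro h
    by_cases hd : d3
    · simp [hd]
    · simp only [hd, if_false]
      by_contra h0
      exact hd (h3 (Nat.pos_of_ne_zero h0) (by split_ifs at h <;> omega))

lemma settled_settle (x : State) : Settled (settle x) :=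
  drain_settled (fun _ h => h) (fun _ h => h)

lemma norm1_eq (x : State) : norm1 x = x .b1 + x .b2 + x .b3 + x .b4 := by
  have : (Finset.univ : Finset Buffer) = {.b1, .b2, .b3, .b4} := rfl
  rw [norm1, this, Finset.sum_insert (by decide), Finset.sum_insert (by decide),
    Finset.sum_insert (by decide), Finset.sum_singleton]
  ring

lemma norm1_drain (d1 d3 : Prop) [Decidable d1] [Decidable d3] (y : State) :
    norm1 (drain d1 d3 y) = norm1 y := by
  simp only [norm1_eq, drain]
  split_ifs <;> omega

lemma norm1_settle (x : State) : norm1 (settle x) = norm1 x := norm1_drain _ _ _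

/-- The queue lengths after the event at buffer `e` and the decisions made with `v`. -/
def after (φ : Policy) (e : Buffer) (v : Server → ℝ) (x : State) : State :=
  drain (v .s1 < φ.drainProb .s1 e (jump e x)) (v .s2 < φ.drainProb .s2 e (jump e x)) (jump e x)

lemma step_queue (φ : Policy) (v : Server → ℝ) (S : Sim) :
    (S.step φ v).queue = after φ S.next v S.queue := rfl

lemma after_settled {φ : Policy} (hφ : φ.NonIdling) (e : Buffer) {v : Server → ℝ}
    (hv : ∀ s, v s < 1) (x : State) : Settled (after φ e v x) := by
  apply drain_settled
  · intro h1 h4; rw [hφ.1 e _ h1 h4]; exact hv _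
  · intro h1 h4; rw [hφ.2 e _ h1 h4]; exact hv _

/-- The primitives that remain after the first event, when the initial queue lengths are `s`. -/
def rest (s : State) (ω : Sample) : Sample :=
  (Sim.nextClock ⟨0, s, ω.1⟩, fun r k => ω.2 r (k + 1))

lemma sim_succ {φ : Policy} (hφ : φ.NonIdling) (x : State) {ω : Sample} (hω : Regular ω) (n : ℕ) :
    sim φ x ω (n + 1) =
      (sim φ (after φ (Sim.next ⟨0, settle x, ω.1⟩) (fun s => ω.2 s 0) (settle x))
        (rest (settle x) ω) n).addTime (Sim.hold ⟨0, settle x, ω.1⟩) := by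
  rw [sim_eq_run, run_succ', sim_eq_run,
    settle_of_settled (after_settled hφ _ (fun s => hω.lt_one s 0) _), ← run_addTime]
  simp only [Sim.step, Sim.addTime, zero_add, add_zero]
  rfl

/-! ### Counting events -/

/-- The number of events at buffer `i` among the first `n`. -/
def cnt (φ : Policy) (x : State) (ω : Sample) (i : Buffer) : ℕ → ℕ
  | 0 => 0
  | n + 1 => cnt φ x ω i n + if (sim φ x ω n).next = i then 1 else 0

lemma sum_cnt (φ : Policy) (x : State) (ω : Sample) (n : ℕ) :
    ∑ i, cnt φ x ω i n = n := by
  induction n with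
  | zero => simp [cnt]
  | succ n ih => simp [cnt, Finset.sum_add_distrib, ih]

lemma clock_succ (φ : Policy) (x : State) (ω : Sample) (i : Buffer) (n k : ℕ) :
    (sim φ x ω n).clock i (k + 1) = ω.1 i (cnt φ x ω i n + k + 1) := by
  induction n generalizing k with
  | zero => simp [sim, cnt]
  | succ n ih =>
    by_cases h : i = (sim φ x ω n).next
    · simp only [sim, Sim.step, Sim.nextClock, cnt, if_pos h, if_pos h.symm]
      rw [show k + 1 + 1 = (k + 1) + 1 from rfl, ih]
      exact congrArg (ω.1 i) (by omega)
    · have h' := Ne.symm h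
      by_cases hr : Running (sim φ x ω n).queue i
      · simp only [sim, Sim.step, Sim.nextClock, cnt, if_neg h, if_neg h', if_pos hr]
        rw [Function.update_of_ne (by omega), ih]
        congr 1
      · simp only [sim, Sim.step, Sim.nextClock, cnt, if_neg h, if_neg h', if_neg hr, ih]
        congr 1

lemma clock_zero_bounds (φ : Policy) (x : State) {ω : Sample} (hω : Regular ω) (n : ℕ) :
    (∀ i, 0 ≤ (sim φ x ω n).clock i 0 ∧ (sim φ x ω n).clock i 0 ≤ ω.1 i (cnt φ x ω i n)) ∧
      0 ≤ (sim φ x ω n).hold := by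
  have key : ∀ n, (∀ i, 0 ≤ (sim φ x ω n).clock i 0) → 0 ≤ (sim φ x ω n).hold :=
    fun n h => h _
  suffices h : ∀ i, 0 ≤ (sim φ x ω n).clock i 0 ∧
      (sim φ x ω n).clock i 0 ≤ ω.1 i (cnt φ x ω i n) from ⟨h, key n fun i => (h i).1⟩
  induction n with
  | zero => exact fun i => ⟨(hω.pos i 0).le, le_rfl⟩
  | succ n ih =>
    intro i
    have hh := key n fun i => (ih i).1
    have hc := clock_succ φ x ω i n 0
    by_cases h : i = (sim φ x ω n).next
    · simp only [sim, Sim.step, Sim.nextClock, cnt, if_pos h, if_pos h.symm]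
      simp only [zero_add, add_zero] at hc ⊢
      rw [hc]; exact ⟨(hω.pos _ _).le, le_rfl⟩
    · have h' := Ne.symm h
      by_cases hr : Running (sim φ x ω n).queue i
      · simp only [sim, Sim.step, Sim.nextClock, cnt, if_neg h, if_neg h', if_pos hr]
        rw [Function.update_self]
        refine ⟨sub_nonneg.2 (Sim.hold_le _ hr), ?_⟩
        have := (ih i).2
        simp only [add_zero]; linarith
      · simp only [sim, Sim.step, Sim.nextClock, cnt, if_neg h, if_neg h', if_neg hr]
        exact ih i

/-- The time that clock `i` has been running before the `n`-th event is at most the time of that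
event, with equality if the clock never stops. -/
lemma runtime_le (φ : Policy) (x : State) (ω : Sample) (hω : Regular ω) (i : Buffer) (n : ℕ) :
    (∑ j ∈ Finset.range (cnt φ x ω i n), ω.1 i j) + (ω.1 i (cnt φ x ω i n) -
        (sim φ x ω n).clock i 0) ≤ (sim φ x ω n).time ∧
    ((∀ y, Running y i) → (∑ j ∈ Finset.range (cnt φ x ω i n), ω.1 i j) +
        (ω.1 i (cnt φ x ω i n) - (sim φ x ω n).clock i 0) = (sim φ x ω n).time) := by
  induction n with
  | zero => simp [sim, cnt]
  | succ n ih =>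
    have hh := (clock_zero_bounds φ x hω n).2
    have hc := clock_succ φ x ω i n 0
    simp only [zero_add, add_zero] at hc
    by_cases h : i = (sim φ x ω n).next
    · have he : (sim φ x ω n).hold = (sim φ x ω n).clock i 0 := by rw [Sim.hold, ← h]
      simp only [sim, Sim.step, Sim.nextClock, cnt, if_pos h, if_pos h.symm]
      simp only [zero_add, hc, sub_self, Finset.sum_range_succ, he] at ih ⊢
      exact ⟨by linarith [ih.1], fun hr => by linarith [ih.2 hr]⟩
    · have h' := Ne.symm h
      by_cases hr : Running (sim φ x ω n).queue i
      · simp only [sim, Sim.step, Sim.nextClock, cnt, if_neg h, if_neg h', if_pos hr]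
        simp only [add_zero, Function.update_self]
        exact ⟨by linarith [ih.1], fun hr => by linarith [ih.2 hr]⟩
      · simp only [sim, Sim.step, Sim.nextClock, cnt, if_neg h, if_neg h', if_neg hr, add_zero]
        exact ⟨by linarith [ih.1], fun hr' => absurd (hr' _) hr⟩

/-- There are only finitely many events in a bounded time. -/
lemma exists_lt_time (φ : Policy) (x : State) {ω : Sample} (hω : Regular ω) (t : ℝ) :
    ∃ n, t < (sim φ x ω (n + 1)).time := by
  by_contra! hcon
  have h : ∀ i, ∃ C : ℕ, ∀ m ≥ C, t < ∑ j ∈ Finset.range m, ω.1 i j := fun i =>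
    eventually_atTop.1 ((hω.tendsto_sum i).eventually_gt_atTop t)
  choose C hC using h
  have h2 : ∀ i n, cnt φ x ω i (n + 1) < C i := by
    intro i n
    by_contra! hle
    have h3 := hC i _ hle
    have h4 := (runtime_le φ x ω hω i (n + 1)).1
    have h5 := ((clock_zero_bounds φ x hω (n + 1)).1 i).2
    linarith [hcon n]
  have h3 := sum_cnt φ x ω (∑ i, C i + 1)
  have h4 : ∑ i, cnt φ x ω i (∑ i, C i + 1) ≤ ∑ i, C i :=
    Finset.sum_le_sum fun i _ => (h2 i _).le
  omega

/-- The number of events up to time `t`. -/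
def idx (φ : Policy) (x : State) (t : ℝ) (ω : Sample) : ℕ :=
  sInf {n : ℕ | t < (sim φ x ω (n + 1)).time}

lemma Q_eq (φ : Policy) (x : State) (t : ℝ) (ω : Sample) :
    Q φ x t ω = (sim φ x ω (idx φ x t ω)).queue := rfl

lemma lt_time_idx (φ : Policy) (x : State) {ω : Sample} (hω : Regular ω) (t : ℝ) :
    t < (sim φ x ω (idx φ x t ω + 1)).time :=
  Nat.sInf_mem (s := {n : ℕ | t < (sim φ x ω (n + 1)).time}) (exists_lt_time φ x hω t)

lemma time_idx_le (φ : Policy) (x : State) (ω : Sample) {t : ℝ} (ht : 0 ≤ t) :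
    (sim φ x ω (idx φ x t ω)).time ≤ t := by
  rcases h : idx φ x t ω with _ | m
  · simpa [sim] using ht
  · have : m ∉ {n : ℕ | t < (sim φ x ω (n + 1)).time} :=
      Nat.notMem_of_lt_sInf (by rw [← idx, h]; omega)
    simpa using this

lemma idx_mono (φ : Policy) (x : State) {ω : Sample} (hω : Regular ω) :
    Monotone fun t => idx φ x t ω := fun _ _ h =>
  Nat.sInf_le (h.trans_lt (lt_time_idx φ x hω _))

lemma Q_of_lt_hold (φ : Policy) (x : State) (ω : Sample) {t : ℝ}
    (ht : t < Sim.hold ⟨0, settle x, ω.1⟩) : Q φ x t ω = settle x := by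
  have : idx φ x t ω = 0 := by
    refine Nat.sInf_eq_zero.2 (Or.inl ?_)
    simpa [sim, Sim.step] using ht
  rw [Q_eq, this]; rfl

/-- After the first event the process starts afresh, with the remaining primitives. -/
lemma Q_of_hold_le {φ : Policy} (hφ : φ.NonIdling) (x : State) {ω : Sample} (hω : Regular ω) {t : ℝ}
    (ht : Sim.hold ⟨0, settle x, ω.1⟩ ≤ t) :
    Q φ x t ω =
      Q φ (after φ (Sim.next ⟨0, settle x, ω.1⟩) (fun s => ω.2 s 0) (settle x))
        (t - Sim.hold ⟨0, settle x, ω.1⟩) (rest (settle x) ω) := by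
  have key : idx φ x t ω =
      idx φ (after φ (Sim.next ⟨0, settle x, ω.1⟩) (fun s => ω.2 s 0) (settle x))
        (t - Sim.hold ⟨0, settle x, ω.1⟩) (rest (settle x) ω) + 1 := by
    have h0 : 0 < idx φ x t ω := by
      refine Nat.pos_of_ne_zero fun h => ?_
      have := lt_time_idx φ x hω t
      rw [h] at this
      simp only [sim, Sim.step, zero_add] at this
      linarith
    conv_lhs => rw [idx]
    conv_rhs => rw [idx]
    rw [idx] at h0
    rw [← Nat.sInf_add (p := fun n => t < (sim φ x ω (n + 1)).time) h0]
    congr 2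
    ext n
    simp only [Set.mem_ofPred_eq, Nat.succ_eq_add_one, zero_add]
    rw [sim_succ hφ x hω (n + 1)]
    simp only [Sim.addTime]
    constructor <;> intro h <;> linarith
  rw [Q_eq, key, sim_succ hφ x hω]
  rfl

/-! ### Arrivals -/

/-- The number of renewals by time `t` of the clock at buffer `i`. -/
def arrivals (ω : Sample) (i : Buffer) (t : ℝ) : ℕ :=
  sInf {c : ℕ | t < ∑ j ∈ Finset.range (c + 1), ω.1 i j}

lemma Regular.sum_mono {ω : Sample} (hω : Regular ω) (i : Buffer) :
    Monotone fun n => ∑ j ∈ Finset.range n, ω.1 i j :=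
  monotone_nat_of_le_succ fun n => by
    rw [Finset.sum_range_succ]; linarith [hω.pos i n]

lemma lt_sum_arrivals {ω : Sample} (hω : Regular ω) (i : Buffer) (t : ℝ) :
    t < ∑ j ∈ Finset.range (arrivals ω i t + 1), ω.1 i j := by
  refine Nat.sInf_mem (s := {c : ℕ | t < ∑ j ∈ Finset.range (c + 1), ω.1 i j}) ?_
  obtain ⟨n, hn⟩ := ((hω.tendsto_sum i).eventually_gt_atTop t).exists
  exact ⟨n, hn.trans_le (hω.sum_mono i n.le_succ)⟩

lemma sum_arrivals_le {ω : Sample} (i : Buffer) {t : ℝ} (ht : 0 ≤ t) :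
    ∑ j ∈ Finset.range (arrivals ω i t), ω.1 i j ≤ t := by
  rcases h : arrivals ω i t with _ | m
  · simpa using ht
  · have : m ∉ {c : ℕ | t < ∑ j ∈ Finset.range (c + 1), ω.1 i j} :=
      Nat.notMem_of_lt_sInf (by rw [← arrivals, h]; omega)
    simpa using this

lemma arrivals_mono {ω : Sample} (hω : Regular ω) (i : Buffer) : Monotone (arrivals ω i) :=
  fun _ _ h => Nat.sInf_le (h.trans_lt (lt_sum_arrivals hω i _))

lemma arrivals_eq {ω : Sample} (hω : Regular ω) (i : Buffer) {t : ℝ} {c : ℕ}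
    (h1 : ∑ j ∈ Finset.range c, ω.1 i j ≤ t) (h2 : t < ∑ j ∈ Finset.range (c + 1), ω.1 i j) :
    arrivals ω i t = c := by
  refine le_antisymm (Nat.sInf_le h2) ?_
  by_contra! h
  have := hω.sum_mono i (show arrivals ω i t + 1 ≤ c by omega)
  have h3 := lt_sum_arrivals hω i t
  simp only at this
  linarith

lemma cnt_idx (φ : Policy) (x : State) {ω : Sample} (hω : Regular ω) {i : Buffer}
    (hi : ∀ y, Running y i) {t : ℝ} (ht : 0 ≤ t) :
    cnt φ x ω i (idx φ x t ω) = arrivals ω i t := by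
  have h1 := (runtime_le φ x ω hω i (idx φ x t ω)).2 hi
  have h2 := (clock_zero_bounds φ x hω (idx φ x t ω)).1 i
  have h3 := time_idx_le φ x ω ht
  have h4 := lt_time_idx φ x hω t
  have h5 := Sim.hold_le (sim φ x ω (idx φ x t ω)) (hi _)
  simp only [sim, Sim.step] at h4
  refine (arrivals_eq hω i (by linarith) ?_).symm
  rw [Finset.sum_range_succ]; linarith

lemma norm1_jump_le (e : Buffer) (x : State) :
    norm1 (jump e x) ≤ norm1 x + (if e = .b1 then 1 else 0) + (if e = .b3 then 1 else 0) := by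
  cases e <;> simp [norm1_eq, jump, Function.update] <;> omega

/-- The total queue length grows at most by the number of arrivals. -/
lemma norm1_Q_le (φ : Policy) (x : State) {ω : Sample} (hω : Regular ω) {r t : ℝ} (hr : 0 ≤ r)
    (hrt : r ≤ t) :
    norm1 (Q φ x t ω) + arrivals ω .b1 r + arrivals ω .b3 r ≤
      norm1 (Q φ x r ω) + arrivals ω .b1 t + arrivals ω .b3 t := by
  have h1 : ∀ y, Running y .b1 := fun _ => trivial
  have h3 : ∀ y, Running y .b3 := fun _ => trivial
  rw [← cnt_idx φ x hω h1 hr, ← cnt_idx φ x hω h3 hr, ← cnt_idx φ x hω h1 (hr.trans hrt),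
    ← cnt_idx φ x hω h3 (hr.trans hrt), Q_eq, Q_eq]
  have := idx_mono φ x hω hrt
  simp only at this
  generalize idx φ x t ω = k at this ⊢
  induction k, this using Nat.le_induction with
  | base => exact le_rfl
  | succ n _ ih =>
    have h := norm1_jump_le (sim φ x ω n).next (sim φ x ω n).queue
    simp only [cnt, sim, step_queue, after, norm1_drain]
    omega

/-- Only few jobs arrive within one unit of time, compared to the time that has passed. -/
lemma tendsto_arrivals_succ_sub {ω : Sample} (hω : Regular ω) (i : Buffer) :
    Tendsto (fun k : ℕ => ((arrivals ω i (k + 1) : ℝ) - arrivals ω i k) / k) atTop (𝓝 0) := by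
  obtain ⟨m, hm, hS⟩ := hω.slln i
  set S : ℕ → ℝ := fun n => ∑ j ∈ Finset.range n, ω.1 i j with hSdef
  have hA : Tendsto (fun k : ℕ => arrivals ω i k) atTop atTop := by
    refine tendsto_atTop.2 fun b => ?_
    filter_upwards [tendsto_natCast_atTop_atTop.eventually_ge_atTop (S b)] with k hk
    by_contra! h
    have h1 := lt_sum_arrivals hω i k
    have h2 := hω.sum_mono i (show arrivals ω i k + 1 ≤ b by omega)
    simp only at h2
    linarith
  have hkA : Tendsto (fun k : ℕ => (k : ℝ) / arrivals ω i k) atTop (𝓝 m) := by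
    have l1 : Tendsto (fun k : ℕ => S (arrivals ω i k) / (arrivals ω i k : ℝ)) atTop (𝓝 m) :=
      hS.comp hA
    have l2 : Tendsto (fun n : ℕ => S (n + 1) / (n : ℝ)) atTop (𝓝 m) := by
      have a1 := (tendsto_add_atTop_iff_nat 1).2 hS
      have a2 : Tendsto (fun n : ℕ => 1 + 1 / (n : ℝ)) atTop (𝓝 (1 + 0)) :=
        tendsto_const_nhds.add tendsto_one_div_atTop_nhds_zero_nat
      have a3 := a1.mul a2
      simp only [add_zero, mul_one] at a3
      refine a3.congr' ?_
      filter_upwards [eventually_gt_atTop 0] with n hn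
      have : (n : ℝ) ≠ 0 := by positivity
      push_cast
      field_simp
      rfl
    refine tendsto_of_tendsto_of_tendsto_of_le_of_le l1 (l2.comp hA) (fun k => ?_) fun k => ?_
    · exact div_le_div_of_nonneg_right (sum_arrivals_le i (Nat.cast_nonneg k)) (by positivity)
    · exact div_le_div_of_nonneg_right (lt_sum_arrivals hω i k).le (by positivity)
  have hAk : Tendsto (fun k : ℕ => (arrivals ω i k : ℝ) / k) atTop (𝓝 m⁻¹) := by
    refine (hkA.inv₀ hm.ne').congr fun k => ?_
    rw [inv_div]
  have h1 := (tendsto_add_atTop_iff_nat 1).2 hAk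
  have a2 : Tendsto (fun n : ℕ => 1 + 1 / (n : ℝ)) atTop (𝓝 (1 + 0)) :=
    tendsto_const_nhds.add tendsto_one_div_atTop_nhds_zero_nat
  have h2 := (h1.mul a2).sub hAk
  simp only [add_zero, mul_one, sub_self] at h2
  refine h2.congr' ?_
  filter_upwards [eventually_gt_atTop 0] with n hn
  have : (n : ℝ) ≠ 0 := by positivity
  push_cast
  field_simp

lemma Q_zero {φ : Policy} (x : State) {ω : Sample} (hω : Regular ω) : Q φ x 0 ω = settle x :=
  Q_of_lt_hold φ x ω (hω.pos _ _)

/-! ### Measurability -/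

instance : MeasurableSpace Buffer := ⊤

instance : DiscreteMeasurableSpace Buffer := ⟨fun _ => trivial⟩

lemma measurable_of_countable_param {Ω γ β : Type*} [MeasurableSpace Ω] [MeasurableSpace γ]
    [MeasurableSpace β] [Countable γ] [MeasurableSingletonClass γ] {g : Ω → γ} (hg : Measurable g)
    {f : γ → Ω → β} (hf : ∀ b, Measurable (f b)) : Measurable fun ω => f (g ω) ω :=
  (measurable_from_prod_countable_left (f := fun p : Ω × γ => f p.2 p.1) hf).comp
    (measurable_id.prodMk hg)

/-- A measurable family of situations. -/
structure MeasurableSim {Ω : Type*} [MeasurableSpace Ω] (S : Ω → Sim) : Prop where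
  time : Measurable fun ω => (S ω).time
  queue : Measurable fun ω => (S ω).queue
  clock : Measurable fun ω => (S ω).clock

section
variable {Ω : Type*} [MeasurableSpace Ω] {S : Ω → Sim}

lemma MeasurableSim.measurableSet_fires (hS : MeasurableSim S) (i : Buffer) :
    MeasurableSet {ω | (S ω).Fires i} := by
  have hR : ∀ j, MeasurableSet {ω | Running (S ω).queue j} := fun j =>
    hS.queue (MeasurableSet.of_discrete (s := {q : State | Running q j}))
  have hc : ∀ j, Measurable fun ω => (S ω).clock j 0 := fun j =>
    (measurable_pi_apply 0).comp ((measurable_pi_apply j).comp hS.clock)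
  have : {ω | (S ω).Fires i} = {ω | Running (S ω).queue i} ∩
      ⋂ j, ({ω | Running (S ω).queue j}ᶜ ∪ {ω | (S ω).clock i 0 ≤ (S ω).clock j 0}) := by
    ext ω
    simp only [Sim.Fires, Set.mem_ofPred_eq, Set.mem_inter_iff, Set.mem_iInter, Set.mem_union,
      Set.mem_compl_iff, imp_iff_not_or]
  rw [this]
  exact (hR i).inter (MeasurableSet.iInter fun j =>
    (hR j).compl.union (measurableSet_le (hc i) (hc j)))

lemma MeasurableSim.next (hS : MeasurableSim S) : Measurable fun ω => (S ω).next := by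
  unfold Sim.next
  exact Measurable.ite (hS.measurableSet_fires _) measurable_const <|
    Measurable.ite (hS.measurableSet_fires _) measurable_const <|
    Measurable.ite (hS.measurableSet_fires _) measurable_const measurable_const

lemma MeasurableSim.hold (hS : MeasurableSim S) : Measurable fun ω => (S ω).hold :=
  measurable_of_countable_param hS.next (f := fun e ω => (S ω).clock e 0) fun e =>
    (measurable_pi_apply 0).comp ((measurable_pi_apply e).comp hS.clock)

lemma MeasurableSim.nextClock (hS : MeasurableSim S) : Measurable fun ω => (S ω).nextClock := by
  have hc : ∀ i k, Measurable fun ω => (S ω).clock i k := fun i k =>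
    (measurable_pi_apply k).comp ((measurable_pi_apply i).comp hS.clock)
  have hh := hS.hold
  refine measurable_pi_lambda _ fun i => measurable_pi_lambda _ fun k => ?_
  classical
  refine measurable_of_countable_param (hS.next.prodMk hS.queue) (f := fun p ω =>
    (if i = p.1 then fun n => (S ω).clock i (n + 1)
      else if Running p.2 i then
        Function.update ((S ω).clock i) 0 ((S ω).clock i 0 - (S ω).hold)
      else (S ω).clock i) k) fun p => ?_
  split_ifs
  · exact hc _ _
  · rcases eq_or_ne k 0 with rfl | hk
    · simp only [Function.update_self]
      exact (hc i 0).sub hh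
    · simpa [Function.update_of_ne hk] using hc i k
  · exact hc _ _

lemma measurable_drain {d1 d3 : Ω → Prop} [∀ ω, Decidable (d1 ω)] [∀ ω, Decidable (d3 ω)]
    (h1 : MeasurableSet {ω | d1 ω}) (h3 : MeasurableSet {ω | d3 ω}) (y : State) :
    Measurable fun ω => drain (d1 ω) (d3 ω) y := by
  refine measurable_pi_lambda _ fun i => ?_
  cases i <;> simp only [drain]
  · exact Measurable.ite h1 measurable_const measurable_const
  · exact Measurable.ite h1 measurable_const measurable_const
  · exact Measurable.ite h3 measurable_const measurable_const
  · exact Measurable.ite h3 measurable_const measurable_const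

lemma measurable_after (φ : Policy) (e : Buffer) (x : State) {v : Ω → Server → ℝ}
    (hv : Measurable v) : Measurable fun ω => after φ e (v ω) x :=
  measurable_drain
    (measurableSet_lt ((measurable_pi_apply Server.s1).comp hv) measurable_const)
    (measurableSet_lt ((measurable_pi_apply Server.s2).comp hv) measurable_const) _

lemma MeasurableSim.step (hS : MeasurableSim S) (φ : Policy) {v : Ω → Server → ℝ}
    (hv : Measurable v) : MeasurableSim fun ω => (S ω).step φ (v ω) where
  time := hS.time.add hS.hold
  queue := measurable_of_countable_param (hS.next.prodMk hS.queue)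
    (f := fun p ω => after φ p.1 (v ω) p.2) fun p => measurable_after φ p.1 p.2 hv
  clock := hS.nextClock

end

lemma measurableSim_sim (φ : Policy) (x : State) (n : ℕ) :
    MeasurableSim fun ω : Sample => sim φ x ω n := by
  induction n with
  | zero => exact ⟨measurable_const, measurable_const, measurable_fst⟩
  | succ n ih =>
    exact ih.step φ (v := fun ω s => ω.2 s n) (by fun_prop)

lemma measurable_idx (φ : Policy) (x : State) :
    Measurable fun p : ℝ × Sample => idx φ x p.1 p.2 := by
  have hlt : ∀ n, MeasurableSet {p : ℝ × Sample | p.1 < (sim φ x p.2 (n + 1)).time} := fun n =>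
    measurableSet_lt measurable_fst ((measurableSim_sim φ x (n + 1)).time.comp measurable_snd)
  have hpre : ∀ n, MeasurableSet {p : ℝ × Sample |
      p.1 < (sim φ x p.2 (n + 1)).time ∧ ∀ m < n, ¬ p.1 < (sim φ x p.2 (m + 1)).time} := by
    intro n
    have : {p : ℝ × Sample | p.1 < (sim φ x p.2 (n + 1)).time ∧
        ∀ m < n, ¬ p.1 < (sim φ x p.2 (m + 1)).time} =
        {p | p.1 < (sim φ x p.2 (n + 1)).time} ∩
          ⋂ m : ℕ, ⋂ _ : m < n, {p | p.1 < (sim φ x p.2 (m + 1)).time}ᶜ := by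
      ext p; simp
    rw [this]
    exact (hlt n).inter (MeasurableSet.iInter fun m => MeasurableSet.iInter fun _ => (hlt m).compl)
  have hsInf : ∀ (s : Set ℕ) (n : ℕ), sInf s = n ↔
      (n ∈ s ∧ ∀ m < n, m ∉ s) ∨ (n = 0 ∧ ∀ m, m ∉ s) := by
    intro s n
    constructor
    · rintro rfl
      rcases s.eq_empty_or_nonempty with rfl | hs
      · right; simp
      · left; exact ⟨Nat.sInf_mem hs, fun m hm => Nat.notMem_of_lt_sInf hm⟩
    · rintro (⟨h1, h2⟩ | ⟨rfl, h2⟩)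
      · exact le_antisymm (Nat.sInf_le h1) (not_lt.1 fun h => h2 _ h (Nat.sInf_mem ⟨n, h1⟩))
      · rw [Set.eq_empty_iff_forall_notMem.2 h2]; simp
  refine measurable_to_countable' fun n => ?_
  have : (fun p : ℝ × Sample => idx φ x p.1 p.2) ⁻¹' {n} =
      {p : ℝ × Sample | p.1 < (sim φ x p.2 (n + 1)).time ∧
        ∀ m < n, ¬ p.1 < (sim φ x p.2 (m + 1)).time} ∪
      {p | n = 0 ∧ ∀ m, ¬ p.1 < (sim φ x p.2 (m + 1)).time} := by
    ext p
    simp only [Set.mem_preimage, Set.mem_singleton_iff, idx, hsInf, Set.mem_union,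
      Set.mem_ofPred_eq]
  rw [this]
  refine (hpre n).union ?_
  have : {p : ℝ × Sample | n = 0 ∧ ∀ m, ¬ p.1 < (sim φ x p.2 (m + 1)).time} =
      {_p | n = 0} ∩ ⋂ m : ℕ, {p | p.1 < (sim φ x p.2 (m + 1)).time}ᶜ := by
    ext p; simp
  rw [this]
  exact (MeasurableSet.const _).inter (MeasurableSet.iInter fun m => (hlt m).compl)

lemma measurable_Q (φ : Policy) (x : State) : Measurable fun p : ℝ × Sample => Q φ x p.1 p.2 :=
  measurable_of_countable_param (measurable_idx φ x) (f := fun n p => (sim φ x p.2 n).queue)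
    fun n => (measurableSim_sim φ x n).queue.comp measurable_snd

lemma measurableSet_Q_eq (φ : Policy) (x : State) (t : ℝ) (y : State) :
    MeasurableSet {ω | Q φ x t ω = y} :=
  ((measurable_Q φ x).comp measurable_prodMk_left) (measurableSet_singleton y)

/-! ### The law of the first event -/

/-- The sequence that starts with `a` and continues with `d`. -/
def cons (a : ℝ) (d : ℕ → ℝ) : ℕ → ℝ
  | 0 => a
  | n + 1 => d n

lemma measurable_cons : Measurable fun p : ℝ × (ℕ → ℝ) => cons p.1 p.2 := by
  refine measurable_pi_lambda _ fun n => ?_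
  cases n
  · exact measurable_fst
  · exact (measurable_pi_apply _).comp measurable_snd

/-- An i.i.d. sequence with one more independent term in front of it is an i.i.d. sequence. -/
lemma map_cons_infinitePi (m : Measure ℝ) [IsProbabilityMeasure m] :
    (m.prod (Measure.infinitePi fun _ : ℕ => m)).map (fun p => cons p.1 p.2) =
      Measure.infinitePi fun _ : ℕ => m := by
  classical
  refine Measure.eq_infinitePi _ fun s t ht => ?_
  obtain ⟨n, hn⟩ : ∃ n, s ⊆ Finset.range (n + 1) :=
    ⟨s.sup id, fun i hi => Finset.mem_range.2 (Nat.lt_succ_of_le (Finset.le_sup (f := id) hi))⟩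
  set t' : ℕ → Set ℝ := fun i => if i ∈ s then t i else Set.univ with ht'
  have hm' : ∀ i, MeasurableSet (t' i) := fun i => by
    by_cases hi : i ∈ s
    · simpa [ht', hi] using ht i
    · simp [ht', hi]
  have e1 : Set.pi (s : Set ℕ) t = Set.pi (Finset.range (n + 1) : Set ℕ) t' := by
    ext d
    simp only [Set.mem_pi, ht']
    constructor
    · intro h i _
      by_cases hi : i ∈ s
      · simpa [hi] using h i hi
      · simp [hi]
    · intro h i hi
      have := h i (hn hi)
      simpa [Finset.mem_coe.1 hi] using this
  have e2 : ∏ i ∈ s, m (t i) = ∏ i ∈ Finset.range (n + 1), m (t' i) := by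
    rw [← Finset.prod_subset hn (f := fun i => m (t' i)) fun i _ hi => by simp [ht', hi]]
    exact Finset.prod_congr rfl fun i hi => by simp [ht', hi]
  have e3 : (fun p : ℝ × (ℕ → ℝ) => cons p.1 p.2) ⁻¹' Set.pi (Finset.range (n + 1) : Set ℕ) t' =
      t' 0 ×ˢ Set.pi (Finset.range n : Set ℕ) fun i => t' (i + 1) := by
    ext p
    simp only [Set.mem_preimage, Set.mem_pi, Set.mem_prod, Finset.coe_range, Set.mem_Iio]
    constructor
    · exact fun h => ⟨h 0 (by omega), fun i hi => h (i + 1) (by omega)⟩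
    · rintro ⟨h0, h⟩ i hi
      cases i with
      | zero => exact h0
      | succ i => exact h i (by omega)
  rw [e1, e2, Measure.map_apply measurable_cons
    (MeasurableSet.pi (Finset.countable_toSet _) fun i _ => hm' i), e3, Measure.prod_prod,
    Measure.infinitePi_pi _ (fun i _ => hm' (i + 1)), Finset.prod_range_succ', mul_comm]

lemma measurable_update_cons {ι : Type*} [DecidableEq ι] (e : ι) :
    Measurable fun p : ℝ × (ι → ℕ → ℝ) => Function.update p.2 e (cons p.1 (p.2 e)) := by
  refine measurable_pi_lambda _ fun i => ?_
  rcases eq_or_ne i e with rfl | h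
  · simp only [Function.update_self]
    exact measurable_cons.comp
      (measurable_fst.prodMk ((measurable_pi_apply _).comp measurable_snd))
  · simp only [Function.update_of_ne h]
    exact (measurable_pi_apply _).comp measurable_snd

/-- In a finite family of independent i.i.d. sequences, the first term of one of the sequences
can be split off. -/
lemma map_update_cons {ι : Type*} [Fintype ι] [DecidableEq ι] (m : ι → Measure ℝ)
    [∀ i, IsProbabilityMeasure (m i)] (e : ι) :
    ((m e).prod (Measure.pi fun i => Measure.infinitePi fun _ : ℕ => m i)).map
      (fun p => Function.update p.2 e (cons p.1 (p.2 e))) =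
      Measure.pi fun i => Measure.infinitePi fun _ : ℕ => m i := by
  set ν : ι → Measure (ℕ → ℝ) := fun i => Measure.infinitePi fun _ : ℕ => m i with hν
  symm
  refine Measure.pi_eq fun s hs => ?_
  have hmeas := measurable_update_cons e
  have hS : MeasurableSet (Set.univ.pi s) := MeasurableSet.univ_pi hs
  rw [Measure.map_apply hmeas hS, Measure.prod_apply (hmeas hS)]
  have h1 : ∀ a : ℝ, Measure.pi ν (Prod.mk a ⁻¹' ((fun p : ℝ × (ι → ℕ → ℝ) =>
      Function.update p.2 e (cons p.1 (p.2 e))) ⁻¹' Set.univ.pi s)) =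
      ν e (cons a ⁻¹' s e) * ∏ i ∈ Finset.univ.erase e, ν i (s i) := by
    intro a
    have : Prod.mk a ⁻¹' ((fun p : ℝ × (ι → ℕ → ℝ) =>
        Function.update p.2 e (cons p.1 (p.2 e))) ⁻¹' Set.univ.pi s) =
        Set.univ.pi (Function.update s e (cons a ⁻¹' s e)) := by
      ext c
      simp only [Set.mem_preimage, Set.mem_pi, Set.mem_univ, true_imp_iff]
      refine forall_congr' fun i => ?_
      rcases eq_or_ne i e with rfl | h
      · simp
      · simp [Function.update_of_ne h]
    rw [this, Measure.pi_pi, ← Finset.mul_prod_erase _ _ (Finset.mem_univ e),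
      Function.update_self]
    congr 1
    exact Finset.prod_congr rfl fun i hi => by
      rw [Function.update_of_ne (Finset.ne_of_mem_erase hi)]
  simp only [h1]
  have hm : Measurable fun a => ν e (cons a ⁻¹' s e) :=
    measurable_measure_prodMk_left (measurable_cons (hs e))
  rw [lintegral_mul_const _ hm, ← Finset.mul_prod_erase _ _ (Finset.mem_univ e)]
  congr 1
  have h2 : ν e (s e) = _ := congrArg (fun μ => μ (s e)) (map_cons_infinitePi (m e)).symm
  rw [h2, Measure.map_apply measurable_cons (hs e), Measure.prod_apply (measurable_cons (hs e))]
  rfl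

/-- The first interval of clock `e` can be split off. -/
lemma map_update_cons_clockLaw (N : Params) (e : Buffer) :
    ((expMeasure (N.rate e)).prod (clockLaw N)).map
      (fun p => Function.update p.2 e (cons p.1 (p.2 e))) = clockLaw N :=
  map_update_cons (fun i => expMeasure (N.rate i)) e

/-- The residual sequence of a clock that has advanced by `t`. -/
def advance (t : ℝ) (d : ℕ → ℝ) : ℕ → ℝ := Function.update d 0 (d 0 - t)

lemma measurable_advance (t : ℝ) : Measurable (advance t) := by
  refine measurable_pi_lambda _ fun n => ?_
  rcases eq_or_ne n 0 with rfl | h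
  · simp only [advance, Function.update_self]; fun_prop
  · simp only [advance, Function.update_of_ne h]; fun_prop

/-- A clock that has not expired by time `t` is as good as new. -/
lemma map_advance (r : ℝ) (hr : 0 < r) {t : ℝ} (ht : 0 ≤ t) :
    ((Measure.infinitePi fun _ : ℕ => expMeasure r).restrict {d | t < d 0}).map (advance t) =
      ENNReal.ofReal (Real.exp (-(r * t))) • Measure.infinitePi fun _ : ℕ => expMeasure r := by
  have := isProbabilityMeasure_expMeasure hr
  set ν := Measure.infinitePi fun _ : ℕ => expMeasure r with hν
  have hset : MeasurableSet {d : ℕ → ℝ | t < d 0} :=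
    measurableSet_lt measurable_const (measurable_pi_apply 0)
  refine Measure.ext_of_lintegral _ fun g hg => ?_
  have hm1 : Measurable fun d => ({d : ℕ → ℝ | t < d 0}).indicator (fun d => g (advance t d)) d :=
    (hg.comp (measurable_advance t)).indicator hset
  have hmc : Measurable fun p : ℝ × (ℕ → ℝ) => g (cons p.1 p.2) := hg.comp measurable_cons
  rw [lintegral_map hg (measurable_advance t), ← lintegral_indicator hset, lintegral_smul_measure]
  have e1 : ∀ f : (ℕ → ℝ) → ℝ≥0∞, Measurable f →
      ∫⁻ d, f d ∂ν = ∫⁻ d, ∫⁻ a, f (cons a d) ∂(expMeasure r) ∂ν := by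
    intro f hf
    conv_lhs => rw [hν, ← map_cons_infinitePi]
    rw [lintegral_map hf measurable_cons]
    exact lintegral_prod_symm' _ (hf.comp measurable_cons)
  rw [e1 _ hm1, e1 _ hg, smul_eq_mul, ← lintegral_const_mul _ hmc.lintegral_prod_left']
  refine lintegral_congr fun d => ?_
  rw [← lintegral_expMeasure_memoryless ht (f := fun a => g (cons a d))
    (hmc.comp measurable_prodMk_right), ← lintegral_indicator measurableSet_Ioi]
  refine lintegral_congr fun a => ?_
  by_cases h : t < a
  · have h' : cons a d ∈ {d : ℕ → ℝ | t < d 0} := h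
    rw [Set.indicator_of_mem h', Set.indicator_of_mem (Set.mem_Ioi.2 h)]
    congr 1
    funext n
    cases n <;> simp [advance, cons]
  · have h' : cons a d ∉ {d : ℕ → ℝ | t < d 0} := h
    rw [Set.indicator_of_notMem h', Set.indicator_of_notMem (by simpa using h)]

lemma pi_smul {ι : Type*} [Fintype ι] {α : ι → Type*} [∀ i, MeasurableSpace (α i)]
    (μ : ∀ i, Measure (α i)) [∀ i, IsProbabilityMeasure (μ i)] (k : ι → ℝ≥0∞)
    (hk : ∀ i, k i ≠ ∞) :
    Measure.pi (fun i => k i • μ i) = (∏ i, k i) • Measure.pi μ := by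
  have : ∀ i, IsFiniteMeasure (k i • μ i) := fun i => Measure.smul_finite _ (hk i)
  refine Measure.pi_eq fun s _ => ?_
  simp [Measure.pi_pi, Finset.prod_mul_distrib]

/-- The clocks in `A` have not expired by time `t` with probability `exp (-∑ rate * t)`, and in this
case the residual clocks are as good as new. -/
lemma lintegral_advance (N : Params) (A : Finset Buffer) {t : ℝ} (ht : 0 ≤ t)
    {G : (Buffer → ℕ → ℝ) → ℝ≥0∞} (hG : Measurable G) :
    ∫⁻ c in {c | ∀ j ∈ A, t < c j 0}, G (fun i => if i ∈ A then advance t (c i) else c i)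
        ∂(clockLaw N) =
      ENNReal.ofReal (Real.exp (-((∑ j ∈ A, N.rate j) * t))) * ∫⁻ c, G c ∂(clockLaw N) := by
  classical
  set ν : Buffer → Measure (ℕ → ℝ) :=
    fun i => Measure.infinitePi fun _ : ℕ => expMeasure (N.rate i) with hν
  have hcl : clockLaw N = Measure.pi ν := rfl
  set f : Buffer → (ℕ → ℝ) → ℕ → ℝ := fun i => if i ∈ A then advance t else id with hf
  set s : Buffer → Set (ℕ → ℝ) := fun i => if i ∈ A then {d | t < d 0} else Set.univ with hs
  set k : Buffer → ℝ≥0∞ :=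
    fun i => if i ∈ A then ENNReal.ofReal (Real.exp (-(N.rate i * t))) else 1 with hk
  have hfm : ∀ i, Measurable (f i) := fun i => by
    simp only [hf]; split_ifs
    exacts [measurable_advance t, measurable_id]
  have e1 : {c : Buffer → ℕ → ℝ | ∀ j ∈ A, t < c j 0} = Set.univ.pi fun i => s i := by
    ext c
    simp only [Set.mem_ofPred_eq, Set.mem_pi, Set.mem_univ, true_imp_iff, hs]
    refine forall_congr' fun i => ?_
    split_ifs with h <;> simp [h]
  have e2 : ∀ c : Buffer → ℕ → ℝ,
      (fun i => if i ∈ A then advance t (c i) else c i) = fun i => f i (c i) := by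
    intro c; funext i; simp only [hf]; split_ifs <;> rfl
  have e3 : ∀ i, (((ν i).restrict (s i)).map (f i)) = k i • ν i := by
    intro i
    simp only [hf, hs, hk]
    split_ifs
    · exact map_advance _ (N.rate_pos i) ht
    · simp
  have e4 : ∏ i, k i = ENNReal.ofReal (Real.exp (-((∑ j ∈ A, N.rate j) * t))) := by
    rw [Finset.sum_mul, ← Finset.sum_neg_distrib, Real.exp_sum,
      ENNReal.ofReal_prod_of_nonneg fun i _ => (Real.exp_pos _).le]
    simp [hk, Finset.prod_ite_mem]
  have hfin : ∀ i, SigmaFinite (((ν i).restrict (s i)).map (f i)) := fun i => inferInstance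
  have hmf : Measurable fun c : Buffer → ℕ → ℝ => fun i => f i (c i) := by
    exact measurable_pi_lambda _ fun i => (hfm i).comp (measurable_pi_apply i)
  rw [hcl, e1, Measure.restrict_pi_pi]
  simp only [e2]
  rw [← lintegral_map hG hmf, Measure.pi_map_pi fun i => (hfm i).aemeasurable]
  simp only [e3]
  rw [pi_smul _ _ fun i => by simp only [hk]; split_ifs <;> simp, lintegral_smul_measure, e4]
  rfl

open Classical in
/-- The buffers whose clocks are running. -/
def running (s : State) : Finset Buffer := Finset.univ.filter (Running s)

lemma mem_running {s : State} {i : Buffer} : i ∈ running s ↔ Running s i := by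
  simp [running]

/-- The total rate of the running clocks. -/
def totalRate (N : Params) (s : State) : ℝ := ∑ j ∈ running s, N.rate j

lemma ae_clock_ne (N : Params) (t : ℝ) : ∀ᵐ c ∂(clockLaw N), ∀ j : Buffer, c j 0 ≠ t := by
  refine ae_all_iff.2 fun j => ?_
  have h2 : MeasurePreserving (Function.eval j) (clockLaw N)
      (Measure.infinitePi fun _ : ℕ => expMeasure (N.rate j)) := measurePreserving_eval _ j
  have h3 := measurePreserving_eval_infinitePi (fun _ : ℕ => expMeasure (N.rate j)) 0
  have h : ∀ᵐ a ∂(expMeasure (N.rate j)), a ≠ t := by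
    rw [ae_iff]; simp
  exact (h3.comp h2).quasiMeasurePreserving.ae h

/-- If no two clocks expire at the same time, the first event takes place at `e` exactly when the
clock of `e` is running and the other running clocks expire later. -/
lemma next_eq_iff {s : State} {c : Buffer → ℕ → ℝ} {e : Buffer}
    (hc : ∀ j, j ≠ e → c j 0 ≠ c e 0) :
    Sim.next ⟨0, s, c⟩ = e ↔ e ∈ running s ∧ ∀ j ∈ (running s).erase e, c e 0 < c j 0 := by
  have hf := Sim.fires_next ⟨0, s, c⟩
  constructor
  · intro h
    rw [h] at hf
    refine ⟨mem_running.2 hf.1, fun j hj => ?_⟩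
    rw [Finset.mem_erase, mem_running] at hj
    exact lt_of_le_of_ne (hf.2 j hj.2) (hc j hj.1).symm
  · rintro ⟨h1, h2⟩
    by_contra hne
    have h3 := h2 _ (Finset.mem_erase.2 ⟨hne, mem_running.2 hf.1⟩)
    exact absurd (hf.2 e (mem_running.1 h1)) (not_le.2 h3)

/-- The law of the buffer and the time of the first event; the residual clocks are as good as
new and independent of both. -/
lemma lintegral_first_event (N : Params) (s : State)
    {F : Buffer → ℝ → (Buffer → ℕ → ℝ) → ℝ≥0∞}
    (hF : ∀ e, Measurable fun p : ℝ × (Buffer → ℕ → ℝ) => F e p.1 p.2) :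
    ∫⁻ c, F (Sim.next ⟨0, s, c⟩) (Sim.hold ⟨0, s, c⟩) (Sim.nextClock ⟨0, s, c⟩) ∂(clockLaw N) =
      ∑ e ∈ running s, ∫⁻ t in Set.Ioi 0,
        ENNReal.ofReal (N.rate e * Real.exp (-(totalRate N s * t))) *
          ∫⁻ c, F e t c ∂(clockLaw N) := by
  classical
  have hS : MeasurableSim fun c : Buffer → ℕ → ℝ => (⟨0, s, c⟩ : Sim) :=
    ⟨measurable_const, measurable_const, measurable_id⟩
  have hFm : ∀ e, Measurable fun c : Buffer → ℕ → ℝ =>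
      F e (Sim.hold ⟨0, s, c⟩) (Sim.nextClock ⟨0, s, c⟩) := fun e =>
    (hF e).comp (hS.hold.prodMk hS.nextClock)
  have hset : ∀ e, MeasurableSet {c : Buffer → ℕ → ℝ | Sim.next ⟨0, s, c⟩ = e} := fun e =>
    hS.next (measurableSet_singleton e)
  set H : Buffer → (Buffer → ℕ → ℝ) → ℝ≥0∞ := fun e c =>
    {c : Buffer → ℕ → ℝ | Sim.next ⟨0, s, c⟩ = e}.indicator
      (fun c => F e (Sim.hold ⟨0, s, c⟩) (Sim.nextClock ⟨0, s, c⟩)) c with hH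
  have hHm : ∀ e, Measurable (H e) := fun e => (hFm e).indicator (hset e)
  have h1 : ∀ c : Buffer → ℕ → ℝ,
      F (Sim.next ⟨0, s, c⟩) (Sim.hold ⟨0, s, c⟩) (Sim.nextClock ⟨0, s, c⟩) = ∑ e, H e c := by
    intro c
    rw [Finset.sum_eq_single (Sim.next ⟨0, s, c⟩)]
    · simp [hH]
    · intro e _ he
      simp [hH, he.symm]
    · simp
  simp only [h1]
  rw [lintegral_finsetSum _ fun e _ => hHm e,
    ← Finset.sum_subset (Finset.subset_univ (running s))]
  · refine Finset.sum_congr rfl fun e he => ?_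
    have hI : Measurable fun t => ∫⁻ c, F e t c ∂(clockLaw N) := (hF e).lintegral_prod_right'
    have hEm : Measurable fun t : ℝ => ENNReal.ofReal
        (Real.exp (-((∑ j ∈ (running s).erase e, N.rate j) * t))) := by fun_prop
    conv_lhs => rw [← map_update_cons_clockLaw N e]
    have hHu : Measurable fun p : ℝ × (Buffer → ℕ → ℝ) =>
        H e (Function.update p.2 e (cons p.1 (p.2 e))) := (hHm e).comp (measurable_update_cons e)
    rw [lintegral_map (hHm e) (measurable_update_cons e), lintegral_prod _ hHu.aemeasurable]
    have h2 : ∀ᵐ t ∂(expMeasure (N.rate e)),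
        ∫⁻ c, H e (Function.update c e (cons t (c e))) ∂(clockLaw N) =
        ENNReal.ofReal (Real.exp (-((∑ j ∈ (running s).erase e, N.rate j) * t))) *
          ∫⁻ c, F e t c ∂(clockLaw N) := by
      filter_upwards [ae_pos_expMeasure (N.rate e)] with t ht
      rw [← lintegral_advance N _ ht.le (G := fun c => F e t c)
        ((hF e).comp measurable_prodMk_left)]
      have hA : MeasurableSet
          {c : Buffer → ℕ → ℝ | ∀ j ∈ (running s).erase e, t < c j 0} := by
        have : {c : Buffer → ℕ → ℝ | ∀ j ∈ (running s).erase e, t < c j 0} =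
            ⋂ j ∈ (running s).erase e, {c | t < c j 0} := by ext; simp
        rw [this]
        exact Finset.measurableSet_biInter _ fun j _ =>
          measurableSet_lt measurable_const (by fun_prop)
      rw [← lintegral_indicator hA]
      refine lintegral_congr_ae ?_
      filter_upwards [ae_clock_ne N t] with c hc
      have hup : ∀ j, j ≠ e → Function.update c e (cons t (c e)) j = c j := fun j hj =>
        Function.update_of_ne hj _ _
      have hue : Function.update c e (cons t (c e)) e = cons t (c e) := Function.update_self ..
      have hne := next_eq_iff (s := s) (c := Function.update c e (cons t (c e))) (e := e)
        (fun j hj => by rw [hup j hj, hue]; exact hc j)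
      have hiff : Sim.next ⟨0, s, Function.update c e (cons t (c e))⟩ = e ↔
          c ∈ {c : Buffer → ℕ → ℝ | ∀ j ∈ (running s).erase e, t < c j 0} := by
        rw [hne]
        simp only [he, true_and, Set.mem_ofPred_eq]
        refine forall₂_congr fun j hj => ?_
        rw [hup j (Finset.ne_of_mem_erase hj), hue]
        rfl
      by_cases hcA : c ∈ {c : Buffer → ℕ → ℝ | ∀ j ∈ (running s).erase e, t < c j 0}
      · have hn := hiff.2 hcA
        rw [Set.indicator_of_mem hcA]
        simp only [hH]
        rw [Set.indicator_of_mem (by exact hn)]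
        have hh : Sim.hold ⟨0, s, Function.update c e (cons t (c e))⟩ = t := by
          rw [Sim.hold, hn]
          simp only [hue]; rfl
        rw [hh]
        congr 1
        funext i
        rw [Sim.nextClock, hn, hh]
        rcases eq_or_ne i e with rfl | hi
        · rw [if_pos rfl, if_neg (by simp)]
          simp only [hue]; rfl
        · simp only [Finset.mem_erase, mem_running, ne_eq, hi, not_false_eq_true,
            true_and, hup i hi]
          rfl
      · rw [Set.indicator_of_notMem hcA]
        simp only [hH]
        rw [Set.indicator_of_notMem]
        exact fun h => hcA (hiff.1 h)
    have h3 : ∫⁻ t, ∫⁻ c, H e (Function.update c e (cons t (c e))) ∂(clockLaw N)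
        ∂(expMeasure (N.rate e)) = _ := lintegral_congr_ae h2
    refine h3.trans ?_
    have hEI : Measurable fun t : ℝ => ENNReal.ofReal
        (Real.exp (-((∑ j ∈ (running s).erase e, N.rate j) * t))) *
          ∫⁻ c, F e t c ∂(clockLaw N) := hEm.mul hI
    rw [lintegral_expMeasure hEI]
    refine setLIntegral_congr_fun measurableSet_Ioi fun t _ => ?_
    rw [← mul_assoc, ← ENNReal.ofReal_mul (mul_pos (N.rate_pos e) (Real.exp_pos _)).le, mul_assoc,
      ← Real.exp_add, totalRate, ← Finset.add_sum_erase _ _ he]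
    congr 4
    ring
  · intro e _ he
    have : ∀ c, H e c = 0 := by
      intro c
      refine Set.indicator_of_notMem (fun h => he ?_) _
      have := (Sim.fires_next ⟨0, s, c⟩).1
      rw [show Sim.next ⟨0, s, c⟩ = e from h] at this
      exact mem_running.2 this
    simp [this]

/-! ### The uniformized chain -/

/-- The probability of the decision `d` when draining has probability `p`. -/
def decWeight (p : ℝ) (d : Bool) : ℝ≥0∞ := if d then ENNReal.ofReal p else ENNReal.ofReal (1 - p)

lemma sum_decWeight {p : ℝ} (h0 : 0 ≤ p) (h1 : p ≤ 1) : ∑ d, decWeight p d = 1 := by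
  simp only [Fintype.sum_bool, decWeight, if_true, Bool.false_eq_true, if_false]
  rw [← ENNReal.ofReal_add h0 (sub_nonneg.2 h1)]; simp

/-- The expected value of `f` at the state after an event at buffer `e` in state `x`. -/
def evAvg (φ : Policy) (e : Buffer) (x : State) (f : State → ℝ≥0∞) : ℝ≥0∞ :=
  ∑ d1, ∑ d3, decWeight (φ.drainProb .s1 e (jump e x)) d1 *
    decWeight (φ.drainProb .s2 e (jump e x)) d3 * f (drain (d1 = true) (d3 = true) (jump e x))

lemma evAvg_const (φ : Policy) (e : Buffer) (x : State) (k : ℝ≥0∞) :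
    evAvg φ e x (fun _ => k) = k := by
  simp only [evAvg, ← Finset.sum_mul, ← Finset.mul_sum]
  rw [sum_decWeight (φ.nonneg _ _ _) (φ.le_one _ _ _), one_mul,
    sum_decWeight (φ.nonneg _ _ _) (φ.le_one _ _ _), one_mul]

lemma evAvg_mono (φ : Policy) (e : Buffer) (x : State) {f g : State → ℝ≥0∞} (h : ∀ z, f z ≤ g z) :
    evAvg φ e x f ≤ evAvg φ e x g :=
  Finset.sum_le_sum fun _ _ => Finset.sum_le_sum fun _ _ => mul_le_mul_right (h _) _

lemma evAvg_add (φ : Policy) (e : Buffer) (x : State) (f g : State → ℝ≥0∞) :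
    evAvg φ e x (fun z => f z + g z) = evAvg φ e x f + evAvg φ e x g := by
  simp only [evAvg, mul_add, Finset.sum_add_distrib]

lemma evAvg_const_mul (φ : Policy) (e : Buffer) (x : State) (k : ℝ≥0∞) (f : State → ℝ≥0∞) :
    evAvg φ e x (fun z => k * f z) = k * evAvg φ e x f := by
  simp only [evAvg, Finset.mul_sum]
  exact Finset.sum_congr rfl fun _ _ => Finset.sum_congr rfl fun _ _ => mul_left_comm _ _ _

lemma evAvg_tsum {ι : Type*} (φ : Policy) (e : Buffer) (x : State) (f : ι → State → ℝ≥0∞) :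
    evAvg φ e x (fun z => ∑' i, f i z) = ∑' i, evAvg φ e x (f i) := by
  simp only [evAvg]
  rw [Summable.tsum_finsetSum fun _ _ => ENNReal.summable]
  refine Finset.sum_congr rfl fun _ _ => ?_
  rw [Summable.tsum_finsetSum fun _ _ => ENNReal.summable]
  exact Finset.sum_congr rfl fun _ _ => ENNReal.tsum_mul_left.symm

lemma evAvg_lintegral {α : Type*} [MeasurableSpace α] (μ : Measure α) (φ : Policy) (e : Buffer)
    (x : State) {f : State → α → ℝ≥0∞} (hf : ∀ z, Measurable (f z)) :
    ∫⁻ a, evAvg φ e x (fun z => f z a) ∂μ = evAvg φ e x fun z => ∫⁻ a, f z a ∂μ := by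
  simp only [evAvg]
  rw [lintegral_finsetSum _ fun _ _ => Finset.measurable_sum _ fun _ _ => (hf _).const_mul _]
  refine Finset.sum_congr rfl fun _ _ => ?_
  rw [lintegral_finsetSum _ fun _ _ => (hf _).const_mul _]
  exact Finset.sum_congr rfl fun _ _ => lintegral_const_mul _ (hf _)

/-- If `f` and `g` agree on settled states, then so do their averages, since the policy is
non-idling. -/
lemma evAvg_congr_settled {φ : Policy} (hφ : φ.NonIdling) (e : Buffer) (x : State)
    {f g : State → ℝ≥0∞} (h : ∀ z, Settled z → f z = g z) : evAvg φ e x f = evAvg φ e x g := by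
  refine Finset.sum_congr rfl fun d1 _ => Finset.sum_congr rfl fun d3 _ => ?_
  by_cases h1 : 0 < jump e x .b1 → jump e x .b4 = 0 → d1 = true
  · by_cases h3 : 0 < jump e x .b3 → jump e x .b2 = 0 → d3 = true
    · rw [h _ (drain_settled h1 h3)]
    · push Not at h3
      have : decWeight (φ.drainProb .s2 e (jump e x)) d3 = 0 := by
        simp [decWeight, h3.2.2, hφ.2 e _ h3.1 h3.2.1]
      simp [this]
  · push Not at h1
    have : decWeight (φ.drainProb .s1 e (jump e x)) d1 = 0 := by
      simp [decWeight, h1.2.2, hφ.1 e _ h1.1 h1.2.1]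
    simp [this]

/-- The sum of the rates of all clocks. -/
def unifRate (N : Params) : ℝ := ∑ e, N.rate e

lemma unifRate_eq (N : Params) : unifRate N = 2 * N.lam + 2 * N.mu := by
  have : (Finset.univ : Finset Buffer) = {.b1, .b2, .b3, .b4} := rfl
  rw [unifRate, this, Finset.sum_insert (by decide), Finset.sum_insert (by decide),
    Finset.sum_insert (by decide), Finset.sum_singleton]
  simp only [Params.rate]; ring

lemma unifRate_pos (N : Params) : 0 < unifRate N := by
  rw [unifRate_eq]; linarith [N.lam_pos, N.mu_pos]

open Classical in
/-- The transition operator of the discrete time chain obtained by uniformization: at each step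
one of the four clocks rings, with probability proportional to its rate, and nothing happens if the
clock is not running. -/
def T (N : Params) (φ : Policy) (f : State → ℝ≥0∞) (x : State) : ℝ≥0∞ :=
  ∑ e, ENNReal.ofReal (N.rate e / unifRate N) *
    (if Running x e then evAvg φ e x f else f x)

lemma sum_rate_div (N : Params) : ∑ e, ENNReal.ofReal (N.rate e / unifRate N) = 1 := by
  rw [← ENNReal.ofReal_sum_of_nonneg fun e _ => (div_pos (N.rate_pos e) (unifRate_pos N)).le,
    ← Finset.sum_div, ← unifRate, div_self (unifRate_pos N).ne', ENNReal.ofReal_one]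

section
variable (N : Params) (φ : Policy)

lemma T_const (k : ℝ≥0∞) : T N φ (fun _ => k) = fun _ => k := by
  funext x
  simp only [T, evAvg_const, ite_self, ← Finset.sum_mul, sum_rate_div, one_mul]

variable {N φ} in
lemma T_mono {f g : State → ℝ≥0∞} (h : ∀ z, f z ≤ g z) (x : State) : T N φ f x ≤ T N φ g x := by
  refine Finset.sum_le_sum fun e _ => mul_le_mul_right ?_ _
  split_ifs
  exacts [evAvg_mono φ e x h, h x]

lemma T_add (f g : State → ℝ≥0∞) :
    T N φ (fun z => f z + g z) = fun x => T N φ f x + T N φ g x := by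
  funext x
  simp only [T, ← Finset.sum_add_distrib, ← mul_add]
  refine Finset.sum_congr rfl fun e _ => ?_
  split_ifs <;> simp [evAvg_add]

lemma T_const_mul (k : ℝ≥0∞) (f : State → ℝ≥0∞) :
    T N φ (fun z => k * f z) = fun x => k * T N φ f x := by
  funext x
  simp only [T, Finset.mul_sum]
  refine Finset.sum_congr rfl fun e _ => ?_
  split_ifs
  · rw [evAvg_const_mul, mul_left_comm]
  · rw [mul_left_comm]

lemma T_tsum {ι : Type*} (f : ι → State → ℝ≥0∞) :
    T N φ (fun z => ∑' i, f i z) = fun x => ∑' i, T N φ (f i) x := by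
  funext x
  simp only [T]
  rw [Summable.tsum_finsetSum fun _ _ => ENNReal.summable]
  refine Finset.sum_congr rfl fun e _ => ?_
  rw [ENNReal.tsum_mul_left]
  split_ifs <;> simp [evAvg_tsum]

lemma iterate_T_const (n : ℕ) (k : ℝ≥0∞) : (T N φ)^[n] (fun _ => k) = fun _ => k :=
  Function.iterate_fixed (T_const N φ k) n

variable {N φ} in
lemma iterate_T_mono (n : ℕ) {f g : State → ℝ≥0∞} (h : ∀ z, f z ≤ g z) (x : State) :
    (T N φ)^[n] f x ≤ (T N φ)^[n] g x := by
  induction n generalizing f g with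
  | zero => exact h x
  | succ n ih => exact ih (T_mono h)

lemma iterate_T_add (n : ℕ) (f g : State → ℝ≥0∞) :
    (T N φ)^[n] (fun z => f z + g z) = fun x => (T N φ)^[n] f x + (T N φ)^[n] g x := by
  induction n generalizing f g with
  | zero => rfl
  | succ n ih => rw [Function.iterate_succ_apply, T_add, ih]; rfl

lemma iterate_T_const_mul (n : ℕ) (k : ℝ≥0∞) (f : State → ℝ≥0∞) :
    (T N φ)^[n] (fun z => k * f z) = fun x => k * (T N φ)^[n] f x := by
  induction n generalizing f with
  | zero => rfl
  | succ n ih => rw [Function.iterate_succ_apply, T_const_mul, ih]; rfl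

lemma iterate_T_tsum {ι : Type*} (n : ℕ) (f : ι → State → ℝ≥0∞) :
    (T N φ)^[n] (fun z => ∑' i, f i z) = fun x => ∑' i, (T N φ)^[n] (f i) x := by
  induction n generalizing f with
  | zero => rfl
  | succ n ih => rw [Function.iterate_succ_apply, T_tsum, ih]; rfl

/-- The generator form of the transition operator. -/
lemma unifRate_mul_T (f : State → ℝ≥0∞) (x : State) :
    ENNReal.ofReal (unifRate N) * T N φ f x =
      ∑ e ∈ running x, ENNReal.ofReal (N.rate e) * evAvg φ e x f +
        ENNReal.ofReal (unifRate N - totalRate N x) * f x := by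
  classical
  have h0 : ∀ e, ENNReal.ofReal (unifRate N) * ENNReal.ofReal (N.rate e / unifRate N) =
      ENNReal.ofReal (N.rate e) := fun e => by
    rw [← ENNReal.ofReal_mul (unifRate_pos N).le, mul_div_cancel₀ _ (unifRate_pos N).ne']
  have h1 : unifRate N - totalRate N x = ∑ e with ¬ Running x e, N.rate e := by
    rw [unifRate, totalRate, running, ← Finset.sum_filter_add_sum_filter_not _ (Running x)]
    ring
  simp only [T, Finset.mul_sum, ← mul_assoc, h0]
  rw [h1, ENNReal.ofReal_sum_of_nonneg fun e _ => (N.rate_pos e).le, Finset.sum_mul,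
    ← Finset.sum_filter_add_sum_filter_not Finset.univ (Running x)]
  congr 1
  · exact Finset.sum_congr rfl fun e he => by rw [if_pos (Finset.mem_filter.1 he).2]
  · exact Finset.sum_congr rfl fun e he => by rw [if_neg (Finset.mem_filter.1 he).2]

lemma totalRate_le (x : State) : totalRate N x ≤ unifRate N :=
  Finset.sum_le_univ_sum_of_nonneg fun e => (N.rate_pos e).le

lemma totalRate_nonneg (x : State) : 0 ≤ totalRate N x :=
  Finset.sum_nonneg fun e _ => (N.rate_pos e).le

end

/-! ### The decisions at the first event -/

lemma lintegral_unif_decide {p : ℝ} (h0 : 0 ≤ p) (h1 : p ≤ 1) (h : Bool → ℝ≥0∞) :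
    ∫⁻ a, h (decide (a < p)) ∂unif = ∑ d, decWeight p d * h d := by
  have hs : MeasurableSet {a : ℝ | a < p} := measurableSet_Iio
  have e : (fun a : ℝ => h (decide (a < p))) = fun a =>
      ({a : ℝ | a < p}).indicator (fun _ => h true) a +
        ({a : ℝ | a < p}ᶜ).indicator (fun _ => h false) a := by
    funext a
    by_cases ha : a < p <;> simp [ha]
  have m1 : unif {a : ℝ | a < p} = ENNReal.ofReal p := by
    rw [unif, Measure.restrict_apply hs]
    have : {a : ℝ | a < p} ∩ Set.Icc 0 1 = Set.Ico 0 p := by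
      ext a; simp only [Set.mem_inter_iff, Set.mem_ofPred_eq, Set.mem_Icc, Set.mem_Ico]
      constructor
      · rintro ⟨h2, h3, _⟩; exact ⟨h3, h2⟩
      · rintro ⟨h2, h3⟩; exact ⟨h3, h2, h3.le.trans h1⟩
    rw [this]; simp
  have m2 : unif {a : ℝ | a < p}ᶜ = ENNReal.ofReal (1 - p) := by
    rw [prob_compl_eq_one_sub hs, m1, ENNReal.ofReal_sub _ h0, ENNReal.ofReal_one]
  rw [e, lintegral_add_left (measurable_const.indicator hs), lintegral_indicator_const hs,
    lintegral_indicator_const hs.compl, m1, m2]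
  simp [decWeight, mul_comm]

lemma after_eq (φ : Policy) (e : Buffer) (v : Server → ℝ) (x : State) :
    after φ e v x = drain (decide (v .s1 < φ.drainProb .s1 e (jump e x)) = true)
      (decide (v .s2 < φ.drainProb .s2 e (jump e x)) = true) (jump e x) := by
  funext i
  cases i <;> simp [after, drain]

/-- The decisions at the first event are independent of those at later events. -/
lemma lintegral_first_decision (φ : Policy) (e : Buffer) (x : State)
    {H : State → (Server → ℕ → ℝ) → ℝ≥0∞} (hH : ∀ z, Measurable (H z)) :
    ∫⁻ u, H (after φ e (fun s => u s 0) x) (fun s k => u s (k + 1)) ∂decisionLaw =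
      evAvg φ e x fun z => ∫⁻ u, H z u ∂decisionLaw := by
  have split : ∀ (s : Server) (f : (Server → ℕ → ℝ) → ℝ≥0∞), Measurable f →
      ∫⁻ u, f u ∂decisionLaw =
        ∫⁻ a, ∫⁻ u, f (Function.update u s (cons a (u s))) ∂decisionLaw ∂unif := by
    intro s f hf
    have h := map_update_cons (fun _ : Server => unif) s
    have h' : (unif.prod decisionLaw).map
      (fun p => Function.update p.2 s (cons p.1 (p.2 s))) = decisionLaw := h
    conv_lhs => rw [← h']
    rw [lintegral_map hf (measurable_update_cons s)]
    exact lintegral_prod _ (hf.comp (measurable_update_cons s)).aemeasurable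
  have hm : Measurable fun u : Server → ℕ → ℝ =>
      H (after φ e (fun s => u s 0) x) (fun s k => u s (k + 1)) := by
    refine measurable_of_countable_param
      (f := fun z (u : Server → ℕ → ℝ) => H z (fun s k => u s (k + 1)))
      (measurable_after φ e x (v := fun (u : Server → ℕ → ℝ) s => u s 0) (by fun_prop)) fun z =>
      (hH z).comp (by fun_prop)
  rw [split .s1 _ hm]
  have hm2 : ∀ a : ℝ, Measurable fun u : Server → ℕ → ℝ =>
      H (after φ e (fun s => (Function.update u Server.s1 (cons a (u .s1))) s 0) x)
        (fun s k => (Function.update u Server.s1 (cons a (u .s1))) s (k + 1)) := fun a =>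
    hm.comp ((measurable_update_cons Server.s1).comp measurable_prodMk_left)
  have e1 : ∀ (a b : ℝ) (u : Server → ℕ → ℝ),
      (fun s => (Function.update (Function.update u Server.s2 (cons b (u .s2))) Server.s1
        (cons a ((Function.update u Server.s2 (cons b (u .s2))) .s1))) s 0) =
      fun s => match s with | .s1 => a | .s2 => b := by
    intro a b u; funext s; cases s <;> rfl
  have e2 : ∀ (a b : ℝ) (u : Server → ℕ → ℝ),
      (fun s k => (Function.update (Function.update u Server.s2 (cons b (u .s2))) Server.s1
        (cons a ((Function.update u Server.s2 (cons b (u .s2))) .s1))) s (k + 1)) = u := by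
    intro a b u; funext s k; cases s <;> rfl
  have e3 : ∀ a : ℝ, ∫⁻ u : Server → ℕ → ℝ,
      H (after φ e (fun s => (Function.update u Server.s1 (cons a (u .s1))) s 0) x)
        (fun s k => (Function.update u Server.s1 (cons a (u .s1))) s (k + 1)) ∂decisionLaw =
      ∑ d3, decWeight (φ.drainProb .s2 e (jump e x)) d3 *
        ∫⁻ u, H (drain (decide (a < φ.drainProb .s1 e (jump e x)) = true) (d3 = true)
          (jump e x)) u ∂decisionLaw := by
    intro a
    rw [split .s2 _ (hm2 a), ← lintegral_unif_decide (φ.nonneg _ _ _) (φ.le_one _ _ _)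
      (fun d3 => ∫⁻ u, H (drain (decide (a < φ.drainProb .s1 e (jump e x)) = true) (d3 = true)
          (jump e x)) u ∂decisionLaw)]
    refine lintegral_congr fun b => lintegral_congr fun u => ?_
    rw [e1, e2, after_eq]
  simp only [e3]
  rw [lintegral_unif_decide (φ.nonneg _ _ _) (φ.le_one _ _ _) fun d1 =>
    ∑ d3, decWeight (φ.drainProb .s2 e (jump e x)) d3 *
        ∫⁻ u, H (drain (d1 = true) (d3 = true) (jump e x)) u ∂decisionLaw]
  simp only [evAvg, Finset.mul_sum, mul_assoc]

/-! ### The backward equation -/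

/-- The indicator function of the state `y`. -/
def ind (y z : State) : ℝ≥0∞ := if z = y then 1 else 0

/-- The backward equation of the process in integrated form, for the family `U t x` of
probabilities that the state at time `t` is `y`. -/
def BackwardEq (N : Params) (φ : Policy) (y : State) (U : ℝ → State → ℝ≥0∞) : Prop :=
  ∀ t, 0 ≤ t → ∀ s, Settled s → U t s =
    ENNReal.ofReal (Real.exp (-(totalRate N s * t))) * ind y s +
      ∫⁻ τ in Set.Ioc 0 t, ∑ e ∈ running s,
        ENNReal.ofReal (N.rate e * Real.exp (-(totalRate N s * τ))) * evAvg φ e s (U (t - τ))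

lemma totalRate_pos (N : Params) (s : State) : 0 < totalRate N s :=
  Finset.sum_pos (fun e _ => N.rate_pos e) ⟨.b1, mem_running.2 trivial⟩

lemma ofReal_totalRate_mul (N : Params) (s : State) {k : ℝ} (hk : 0 ≤ k) :
    ENNReal.ofReal (totalRate N s * k) = ∑ e ∈ running s, ENNReal.ofReal (N.rate e * k) := by
  rw [totalRate, Finset.sum_mul,
    ENNReal.ofReal_sum_of_nonneg fun e _ => mul_nonneg (N.rate_pos e).le hk]

lemma lintegral_exp_Ioi {r : ℝ} (hr : 0 < r) {t : ℝ} (ht : 0 ≤ t) :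
    ∫⁻ τ in Set.Ioi t, ENNReal.ofReal (r * Real.exp (-(r * τ))) =
      ENNReal.ofReal (Real.exp (-(r * t))) := by
  have := isProbabilityMeasure_expMeasure hr
  have h := lintegral_expMeasure_memoryless (r := r) ht (f := fun _ => 1) measurable_const
  simp only [lintegral_const, measure_univ, mul_one, one_mul] at h
  rw [← h, Measure.restrict_apply MeasurableSet.univ, Set.univ_inter,
    ← lintegral_indicator_one measurableSet_Ioi,
    lintegral_expMeasure (measurable_one.indicator measurableSet_Ioi)]
  rw [← lintegral_indicator measurableSet_Ioi, ← lintegral_indicator measurableSet_Ioi]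
  refine lintegral_congr fun a => ?_
  by_cases h1 : t < a
  · simp [Set.indicator, h1, ht.trans_lt h1]
  · simp [Set.indicator, h1]

lemma lintegral_exp_Ioc {r : ℝ} (hr : 0 < r) {t : ℝ} (ht : 0 ≤ t) :
    ∫⁻ τ in Set.Ioc 0 t, ENNReal.ofReal (r * Real.exp (-(r * τ))) =
      ENNReal.ofReal (1 - Real.exp (-(r * t))) := by
  have h0 := lintegral_exp_Ioi hr le_rfl
  rw [← Set.Ioc_union_Ioi_eq_Ioi ht, lintegral_union measurableSet_Ioi
    (Set.Ioc_disjoint_Ioi le_rfl), lintegral_exp_Ioi hr ht] at h0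
  rw [ENNReal.ofReal_sub _ (Real.exp_pos _).le]
  refine ENNReal.eq_sub_of_add_eq ENNReal.ofReal_ne_top ?_
  simpa using h0

/-- The transition probabilities satisfy the backward equation. -/
lemma backwardEq_trans (N : Params) {φ : Policy} (hφ : φ.NonIdling) (y : State) :
    BackwardEq N φ y fun t x => trans N φ t x y := by
  classical
  intro t ht s hs
  have hss := settle_of_settled hs
  have hind : Measurable (ind y) := Measurable.of_discrete
  -- the indicator of `Q t = y`, as a function of the first event and of the remaining primitives
  set J : State → ℝ → Sample → ℝ≥0∞ := fun z τ ω => ind y (Q φ z (t - τ) ω) with hJ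
  have hJm : ∀ z, Measurable fun p : ℝ × Sample => J z p.1 p.2 := fun z =>
    hind.comp ((measurable_Q φ z).comp
      ((measurable_const.sub measurable_fst).prodMk measurable_snd))
  set F : Buffer → ℝ → (Buffer → ℕ → ℝ) → ℝ≥0∞ := fun e τ c =>
    if t < τ then ind y s
    else evAvg φ e s fun z => ∫⁻ u, J z τ (c, u) ∂decisionLaw with hFdef
  have hJu : ∀ z, Measurable fun p : ℝ × (Buffer → ℕ → ℝ) =>
      ∫⁻ u, J z p.1 (p.2, u) ∂decisionLaw := fun z =>
    Measurable.lintegral_prod_right'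
      (f := fun q : (ℝ × (Buffer → ℕ → ℝ)) × (Server → ℕ → ℝ) => J z q.1.1 (q.1.2, q.2))
      ((hJm z).comp (by fun_prop :
        Measurable fun q : (ℝ × (Buffer → ℕ → ℝ)) × (Server → ℕ → ℝ) => (q.1.1, (q.1.2, q.2))))
  have hF : ∀ e, Measurable fun p : ℝ × (Buffer → ℕ → ℝ) => F e p.1 p.2 := by
    intro e
    refine Measurable.ite (measurableSet_lt measurable_const measurable_fst) measurable_const ?_
    exact Finset.measurable_sum _ fun d1 _ => Finset.measurable_sum _ fun d3 _ =>
      (hJu _).const_mul _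
  have hQm : ∀ z r, Measurable fun ω : Sample => ind y (Q φ z r ω) := fun z r =>
    hind.comp ((measurable_Q φ z).comp measurable_prodMk_left)
  have h1 : ∀ z r, trans N φ r z y = ∫⁻ c, ∫⁻ u, ind y (Q φ z r (c, u)) ∂decisionLaw
      ∂(clockLaw N) := by
    intro z r
    rw [← lintegral_prod (f := fun ω => ind y (Q φ z r ω)) (hQm z r).aemeasurable, ← prob_eq, trans,
      ← lintegral_indicator_one (measurableSet_Q_eq φ z r y)]
    exact lintegral_congr fun ω => by simp [Set.indicator, ind]
  have h2 : trans N φ t s y = ∫⁻ c, F (Sim.next ⟨0, s, c⟩) (Sim.hold ⟨0, s, c⟩)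
      (Sim.nextClock ⟨0, s, c⟩) ∂(clockLaw N) := by
    rw [h1]
    have hreg := ae_regular N
    rw [prob_eq] at hreg
    refine lintegral_congr_ae ?_
    filter_upwards [Measure.ae_ae_of_ae_prod hreg] with c hc
    simp only [hFdef]
    split_ifs with hlt
    · have : ∀ u, Q φ s t (c, u) = s := fun u => by
        rw [Q_of_lt_hold φ s (c, u) (by rw [hss]; exact hlt), hss]
      simp [this]
    · rw [← lintegral_first_decision φ _ s
        (H := fun z u => J z (Sim.hold ⟨0, s, c⟩) (Sim.nextClock ⟨0, s, c⟩, u))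
        fun z => (hQm z _).comp measurable_prodMk_left]
      refine lintegral_congr_ae ?_
      filter_upwards [hc] with u hu
      rw [Q_of_hold_le hφ s hu (by rw [hss]; exact not_lt.1 hlt), hss]
      rfl
  have h3 : ∀ e τ, ∫⁻ c, F e τ c ∂(clockLaw N) =
      if t < τ then ind y s else evAvg φ e s fun z => trans N φ (t - τ) z y := by
    intro e τ
    simp only [hFdef]
    split_ifs with hlt
    · simp
    · rw [evAvg_lintegral (f := fun z c => ∫⁻ u, J z τ (c, u) ∂decisionLaw) _ _ _ _
        fun z => (hJu z).comp measurable_prodMk_left]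
      simp only [h1, hJ]
  have hm : ∀ e, Measurable fun τ => ENNReal.ofReal (N.rate e * Real.exp (-(totalRate N s * τ))) *
      ∫⁻ c, F e τ c ∂(clockLaw N) := fun e =>
    (by fun_prop : Measurable fun τ : ℝ =>
      ENNReal.ofReal (N.rate e * Real.exp (-(totalRate N s * τ)))).mul
      (hF e).lintegral_prod_right'
  show trans N φ t s y = _
  rw [h2, lintegral_first_event N s hF, ← lintegral_finsetSum _ fun e _ => hm e,
    ← Set.Ioc_union_Ioi_eq_Ioi ht, lintegral_union measurableSet_Ioi
    (Set.Ioc_disjoint_Ioi le_rfl), add_comm]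
  congr 1
  · rw [← lintegral_exp_Ioi (totalRate_pos N s) ht, ← lintegral_mul_const _ (by fun_prop)]
    refine setLIntegral_congr_fun measurableSet_Ioi fun τ hτ => ?_
    simp only [h3, if_pos (Set.mem_Ioi.1 hτ), ← Finset.sum_mul]
    rw [← ofReal_totalRate_mul N s (Real.exp_pos _).le]
  · refine setLIntegral_congr_fun measurableSet_Ioc fun τ hτ => ?_
    simp only [h3, if_neg (not_lt.2 hτ.2)]

/-- A solution of the backward equation with values in `[0, 1]` is below every other solution: on
`[0, t]` the integral operator is a contraction with constant `1 - exp (-Λ t)`, where `Λ` is the sum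
of the rates of all clocks. Hence there is at most one solution with values in `[0, 1]`. -/
lemma BackwardEq.le {N : Params} {φ : Policy} (hφ : φ.NonIdling) {y : State}
    {U W : ℝ → State → ℝ≥0∞} (hU : BackwardEq N φ y U) (hW : BackwardEq N φ y W)
    (hU1 : ∀ t s, 0 ≤ t → U t s ≤ 1) {t : ℝ} (ht : 0 ≤ t) {s : State} (hs : Settled s) :
    U t s ≤ W t s := by
  have hΛ := unifRate_pos N
  set q : ℝ := 1 - Real.exp (-(unifRate N * t)) with hq
  have hq0 : 0 ≤ q := by
    rw [hq, sub_nonneg, Real.exp_le_one_iff]; nlinarith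
  have hq1 : q < 1 := by rw [hq]; linarith [Real.exp_pos (-(unifRate N * t))]
  have key : ∀ n : ℕ, ∀ r, 0 ≤ r → r ≤ t → ∀ z, Settled z →
      U r z ≤ W r z + ENNReal.ofReal (q ^ n) := by
    intro n
    induction n with
    | zero => intro r hr _ z _; simpa using (hU1 r z hr).trans le_add_self
    | succ n ih =>
      intro r hr hrt z hz
      rw [hU r hr z hz, hW r hr z hz, add_assoc]
      refine add_le_add_right ?_ _
      have hstep : ∀ τ ∈ Set.Ioc 0 r, ∑ e ∈ running z,
          ENNReal.ofReal (N.rate e * Real.exp (-(totalRate N z * τ))) * evAvg φ e z (U (r - τ)) ≤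
          ENNReal.ofReal (totalRate N z * Real.exp (-(totalRate N z * τ))) *
            ENNReal.ofReal (q ^ n) +
          ∑ e ∈ running z, ENNReal.ofReal (N.rate e * Real.exp (-(totalRate N z * τ))) *
            evAvg φ e z (W (r - τ)) := by
        intro τ hτ
        rw [ofReal_totalRate_mul N z (Real.exp_pos _).le, Finset.sum_mul,
          ← Finset.sum_add_distrib]
        refine Finset.sum_le_sum fun e _ => ?_
        rw [← mul_add]
        refine mul_le_mul_right ?_ _
        have h1 : evAvg φ e z (U (r - τ)) ≤
            evAvg φ e z (fun v => ENNReal.ofReal (q ^ n) + W (r - τ) v) := by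
          classical
          have h2 : evAvg φ e z (U (r - τ)) =
              evAvg φ e z fun v => if Settled v then U (r - τ) v else 0 :=
            evAvg_congr_settled hφ e z fun v hv => (if_pos hv).symm
          rw [h2]
          refine evAvg_mono φ e z fun v => ?_
          split_ifs with hv
          · rw [add_comm]
            exact ih (r - τ) (by linarith [hτ.2]) (by linarith [hτ.1]) v hv
          · exact zero_le
        rwa [evAvg_add, evAvg_const] at h1
      refine (setLIntegral_mono' measurableSet_Ioc hstep).trans ?_
      rw [lintegral_add_left (by fun_prop), lintegral_mul_const _ (by fun_prop),
        lintegral_exp_Ioc (totalRate_pos N z) hr, add_comm, ← ENNReal.ofReal_mul]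
      · refine add_le_add_right (ENNReal.ofReal_le_ofReal ?_) _
        rw [pow_succ']
        refine mul_le_mul_of_nonneg_right ?_ (pow_nonneg hq0 n)
        rw [hq]
        have : totalRate N z * r ≤ unifRate N * t :=
          mul_le_mul (totalRate_le N z) hrt hr hΛ.le
        linarith [Real.exp_le_exp.2 (neg_le_neg this)]
      · rw [sub_nonneg, Real.exp_le_one_iff]; nlinarith [totalRate_nonneg N z]
  have hlim : Tendsto (fun n : ℕ => W t s + ENNReal.ofReal (q ^ n)) atTop
      (𝓝 (W t s + ENNReal.ofReal 0)) :=
    tendsto_const_nhds.add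
      (ENNReal.tendsto_ofReal (tendsto_pow_atTop_nhds_zero_of_lt_one hq0 hq1))
  simpa using ge_of_tendsto' hlim fun n => key n t ht le_rfl s hs

/-! ### Poisson mixtures -/

/-- The Poisson probabilities. -/
def pois (a : ℝ) (n : ℕ) : ℝ≥0∞ := ENNReal.ofReal (Real.exp (-a) * (a ^ n / n.factorial))

lemma tsum_pois_mul_ofReal {a : ℝ} (ha : 0 ≤ a) {b : ℕ → ℝ} (hb : ∀ n, 0 ≤ b n)
    (hs : Summable fun n => a ^ n / n.factorial * b n) :
    ∑' n, pois a n * ENNReal.ofReal (b n) =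
      ENNReal.ofReal (Real.exp (-a) * ∑' n, a ^ n / n.factorial * b n) := by
  rw [← tsum_mul_left, ENNReal.ofReal_tsum_of_nonneg _ (hs.mul_left _)]
  · refine tsum_congr fun n => ?_
    rw [pois, ← ENNReal.ofReal_mul (by positivity), mul_assoc]
  · intro n
    have := hb n
    positivity

/-- The generating function of the Poisson distribution. -/
lemma tsum_pois_mul_pow {a : ℝ} (ha : 0 ≤ a) {r : ℝ} (hr : 0 ≤ r) :
    ∑' n, pois a n * ENNReal.ofReal (r ^ n) = ENNReal.ofReal (Real.exp (a * r - a)) := by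
  have h := NormedSpace.expSeries_div_hasSum_exp (a * r)
  rw [← Real.exp_eq_exp_ℝ] at h
  have e : ∀ n : ℕ, a ^ n / n.factorial * r ^ n = (a * r) ^ n / n.factorial := fun n => by
    rw [mul_pow]; ring
  rw [tsum_pois_mul_ofReal ha fun n => pow_nonneg hr n]
  · simp only [e]
    rw [h.tsum_eq, ← Real.exp_add]; congr 2; ring
  · simp only [e]; exact h.summable

lemma tsum_pois {a : ℝ} (ha : 0 ≤ a) : ∑' n, pois a n = 1 := by
  simpa using tsum_pois_mul_pow ha zero_le_one

lemma pois_pos {a : ℝ} (ha : 0 < a) (n : ℕ) : 0 < pois a n :=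
  ENNReal.ofReal_pos.2 (by positivity)

lemma pois_zero (n : ℕ) : pois 0 n = if n = 0 then 1 else 0 := by
  cases n <;> simp [pois]

lemma sum_antidiagonal_pois {a b : ℝ} (ha : 0 ≤ a) (hb : 0 ≤ b) (n : ℕ) :
    ∑ p ∈ Finset.HasAntidiagonal.antidiagonal n, pois a p.1 * pois b p.2 = pois (a + b) n := by
  have : ∀ p ∈ Finset.HasAntidiagonal.antidiagonal n, pois a p.1 * pois b p.2 =
      ENNReal.ofReal (Real.exp (-(a + b)) *
        (a ^ p.1 / p.1.factorial * (b ^ p.2 / p.2.factorial))) := by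
    intro p _
    rw [pois, pois, ← ENNReal.ofReal_mul (by positivity), neg_add, Real.exp_add]
    congr 1; ring
  rw [Finset.sum_congr rfl this, ← ENNReal.ofReal_sum_of_nonneg fun p _ => by positivity,
    ← Finset.mul_sum, pois]
  congr 2
  rw [(Commute.all a b).add_pow', Finset.sum_div]
  refine Finset.sum_congr rfl fun p hp => ?_
  rw [Finset.HasAntidiagonal.mem_antidiagonal] at hp
  have h := Nat.choose_eq_factorial_div_factorial (show p.1 ≤ n by omega)
  have h2 := Nat.choose_mul_factorial_mul_factorial (show p.1 ≤ n by omega)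
  rw [show n - p.1 = p.2 by omega] at h2
  have h3 : (n.factorial : ℝ) = n.choose p.1 * p.1.factorial * p.2.factorial := by
    exact_mod_cast h2.symm
  have h4 : (n.choose p.1 : ℝ) ≠ 0 := by
    exact_mod_cast (Nat.choose_pos (show p.1 ≤ n by omega)).ne'
  have h5 : (p.1.factorial : ℝ) ≠ 0 := by positivity
  have h6 : (p.2.factorial : ℝ) ≠ 0 := by positivity
  rw [h3, nsmul_eq_mul]
  field_simp

/-- The transition operators of the process obtained by letting the uniformized chain move at the
epochs of a Poisson process. -/
def semi (N : Params) (φ : Policy) (t : ℝ) (f : State → ℝ≥0∞) (x : State) : ℝ≥0∞ :=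
  ∑' n, pois (unifRate N * t) n * (T N φ)^[n] f x

lemma summable_pow_div_mul {a : ℕ → ℝ} (ha : ∀ n, |a n| ≤ 1) (t : ℝ) :
    Summable fun n : ℕ => t ^ n / n.factorial * a n := by
  refine Summable.of_norm_bounded (Real.summable_pow_div_factorial |t|) fun n => ?_
  rw [norm_mul, norm_div, norm_pow, Real.norm_eq_abs, Real.norm_eq_abs, Real.norm_eq_abs,
    Nat.abs_cast]
  exact mul_le_of_le_one_right (by positivity) (ha n)

/-- Exponential generating functions are differentiated by shifting the coefficients. -/
lemma hasDerivAt_tsum_pow_div {a : ℕ → ℝ} (ha : ∀ n, |a n| ≤ 1) (t : ℝ) :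
    HasDerivAt (fun t => ∑' n : ℕ, t ^ n / n.factorial * a n)
      (∑' n : ℕ, t ^ n / n.factorial * a (n + 1)) t := by
  set M : ℝ := |t| + 1 with hM
  have hshift : ∀ (n : ℕ) (z : ℝ), ((n + 1 : ℕ) : ℝ) * z ^ n / (n + 1).factorial =
      z ^ n / n.factorial := by
    intro n z
    have h5 : (n.factorial : ℝ) ≠ 0 := by positivity
    rw [Nat.factorial_succ]; push_cast
    field_simp
  set g' : ℕ → ℝ → ℝ := fun n z => (n * z ^ (n - 1) / n.factorial) * a n with hg'
  have hu : Summable fun n : ℕ => (n * M ^ (n - 1) / n.factorial : ℝ) := by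
    refine (summable_nat_add_iff 1).1 ?_
    simp only [Nat.add_sub_cancel, hshift]
    exact Real.summable_pow_div_factorial M
  have h := hasDerivAt_tsum_of_isPreconnected (𝕜 := ℝ) (F := ℝ)
    (g := fun (n : ℕ) (z : ℝ) => z ^ n / n.factorial * a n) (g' := g') (t := Metric.ball 0 M)
    (y₀ := t) (y := t) hu Metric.isOpen_ball (convex_ball 0 M).isPreconnected
    (fun n z _ => ((hasDerivAt_pow n z).div_const _).mul_const _)
    (fun n z hz => ?_) (by simp [hM]) (summable_pow_div_mul ha t) (by simp [hM])
  · have hs : Summable fun n => g' n t := by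
      refine (summable_nat_add_iff 1).1 ?_
      simp only [hg', Nat.add_sub_cancel, hshift]
      exact summable_pow_div_mul (fun n => ha (n + 1)) t
    refine h.congr_deriv ?_
    rw [hs.tsum_eq_zero_add]
    simp only [hg', Nat.add_sub_cancel, hshift]
    simp
  · rw [mem_ball_zero_iff, Real.norm_eq_abs] at hz
    simp only [hg']
    rw [norm_mul, norm_div, norm_mul, norm_pow, Real.norm_eq_abs, Real.norm_eq_abs,
      Real.norm_eq_abs, Real.norm_eq_abs, Nat.abs_cast, Nat.abs_cast]
    refine (mul_le_of_le_one_right (by positivity) (ha n)).trans ?_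
    gcongr

/-- The Poisson mean of a bounded sequence. -/
def poisMean (a : ℕ → ℝ) (t : ℝ) : ℝ := Real.exp (-t) * ∑' n : ℕ, t ^ n / n.factorial * a n

lemma hasDerivAt_poisMean {a : ℕ → ℝ} (ha : ∀ n, |a n| ≤ 1) (t : ℝ) :
    HasDerivAt (poisMean a) (poisMean (fun n => a (n + 1)) t - poisMean a t) t := by
  have h := ((hasDerivAt_neg t).exp).mul (hasDerivAt_tsum_pow_div ha t)
  refine h.congr_deriv ?_
  simp only [poisMean]; ring

lemma continuous_poisMean {a : ℕ → ℝ} (ha : ∀ n, |a n| ≤ 1) : Continuous (poisMean a) :=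
  continuous_iff_continuousAt.2 fun t => (hasDerivAt_poisMean ha t).continuousAt

section
variable (N : Params) (φ : Policy)

lemma iterate_T_le_one {f : State → ℝ≥0∞} (hf : ∀ z, f z ≤ 1) (n : ℕ) (x : State) :
    (T N φ)^[n] f x ≤ 1 := by
  have := iterate_T_mono (N := N) (φ := φ) n hf x
  rwa [iterate_T_const] at this

lemma semi_eq_ofReal {f : State → ℝ≥0∞} (hf : ∀ z, f z ≤ 1) {t : ℝ} (ht : 0 ≤ t) (x : State) :
    semi N φ t f x =
      ENNReal.ofReal (poisMean (fun n => ((T N φ)^[n] f x).toReal) (unifRate N * t)) := by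
  have hb : ∀ n, |((T N φ)^[n] f x).toReal| ≤ 1 := fun n => by
    rw [abs_of_nonneg ENNReal.toReal_nonneg]
    exact ENNReal.toReal_le_of_le_ofReal zero_le_one
      (by simpa using iterate_T_le_one N φ hf n x)
  rw [semi, poisMean, ← tsum_pois_mul_ofReal (mul_nonneg (unifRate_pos N).le ht)
    (fun n => ENNReal.toReal_nonneg) (summable_pow_div_mul hb _)]
  refine tsum_congr fun n => ?_
  rw [ENNReal.ofReal_toReal (ne_top_of_le_ne_top ENNReal.one_ne_top (iterate_T_le_one N φ hf n x))]

lemma T_semi (t : ℝ) (f : State → ℝ≥0∞) (x : State) :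
    T N φ (semi N φ t f) x = ∑' n, pois (unifRate N * t) n * (T N φ)^[n + 1] f x := by
  have : semi N φ t f = fun x => ∑' n, pois (unifRate N * t) n * (T N φ)^[n] f x := rfl
  rw [this, T_tsum]
  refine tsum_congr fun n => ?_
  rw [T_const_mul, Function.iterate_succ_apply']

lemma semi_comm_T (t : ℝ) (f : State → ℝ≥0∞) (x : State) :
    semi N φ t (T N φ f) x = T N φ (semi N φ t f) x := by
  rw [T_semi, semi]
  rfl

/-- The Poisson mixture satisfies a linear differential equation in time, and the variation of
constants formula for it is the backward equation. -/
lemma backwardEq_semi (y : State) : BackwardEq N φ y fun t => semi N φ t (ind y) := by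
  intro t ht s _
  have hf : ∀ z, ind y z ≤ 1 := fun z => by unfold ind; split_ifs <;> simp
  have hTf : ∀ z, T N φ (ind y) z ≤ 1 := iterate_T_le_one N φ hf 1
  have hΛ := unifRate_pos N
  set Λ := unifRate N with hΛdef
  set R := totalRate N s with hR
  set a : ℕ → ℝ := fun n => ((T N φ)^[n] (ind y) s).toReal with ha
  have hb : ∀ n, |a n| ≤ 1 := fun n => by
    rw [abs_of_nonneg ENNReal.toReal_nonneg]
    exact ENNReal.toReal_le_of_le_ofReal zero_le_one
      (by simpa using iterate_T_le_one N φ hf n s)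
  have hb1 : ∀ n, |a (n + 1)| ≤ 1 := fun n => hb _
  set w : ℝ → ℝ := fun r => poisMean a (Λ * r) with hw
  set b : ℝ → ℝ := fun r => poisMean (fun n => a (n + 1)) (Λ * r) with hbdef
  set g : ℝ → ℝ := fun r => Λ * b r - (Λ - R) * w r with hg
  have hwd : ∀ r, HasDerivAt w (Λ * (b r - w r)) r := by
    intro r
    have h := (hasDerivAt_poisMean hb (Λ * r)).comp r ((hasDerivAt_id r).const_mul Λ)
    refine h.congr_deriv ?_
    simp only [hbdef]; ring
  have hwc : Continuous w := (continuous_poisMean hb).comp (continuous_const.mul continuous_id)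
  have hbc : Continuous b := (continuous_poisMean hb1).comp (continuous_const.mul continuous_id)
  have hgc : Continuous g := (continuous_const.mul hbc).sub (continuous_const.mul hwc)
  have hwW : ∀ r, 0 ≤ r → semi N φ r (ind y) s = ENNReal.ofReal (w r) := fun r hr =>
    semi_eq_ofReal N φ hf hr s
  have hbW : ∀ r, 0 ≤ r → T N φ (semi N φ r (ind y)) s = ENNReal.ofReal (b r) := fun r hr => by
    rw [← semi_comm_T, semi_eq_ofReal N φ hTf hr]
    rfl
  have hgen : ∀ r, 0 ≤ r → ENNReal.ofReal (Λ * b r) =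
      ∑ e ∈ running s, ENNReal.ofReal (N.rate e) * evAvg φ e s (semi N φ r (ind y)) +
        ENNReal.ofReal ((Λ - R) * w r) := by
    intro r hr
    have h := unifRate_mul_T N φ (semi N φ r (ind y)) s
    rw [hbW r hr, hwW r hr] at h
    rw [ENNReal.ofReal_mul hΛ.le, ENNReal.ofReal_mul (sub_nonneg.2 (totalRate_le N s))]
    exact h
  have hw0 : ∀ r, 0 ≤ r → 0 ≤ w r := by
    intro r hr
    have : ∀ n, 0 ≤ a n := fun n => ENNReal.toReal_nonneg
    refine mul_nonneg (Real.exp_pos _).le (tsum_nonneg fun n => ?_)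
    have := this n
    positivity
  have hg0 : ∀ r, 0 ≤ r → 0 ≤ g r := by
    intro r hr
    have hb0 : 0 ≤ b r := by
      have : ∀ n, 0 ≤ a (n + 1) := fun n => ENNReal.toReal_nonneg
      refine mul_nonneg (Real.exp_pos _).le (tsum_nonneg fun n => ?_)
      have := this n
      positivity
    have h := le_add_self.trans (hgen r hr).ge
    exact sub_nonneg.2 ((ENNReal.ofReal_le_ofReal_iff (mul_nonneg hΛ.le hb0)).1 h)
  have hgS : ∀ r, 0 ≤ r → ENNReal.ofReal (g r) =
      ∑ e ∈ running s, ENNReal.ofReal (N.rate e) * evAvg φ e s (semi N φ r (ind y)) := by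
    intro r hr
    rw [hg, ENNReal.ofReal_sub _ (mul_nonneg (sub_nonneg.2 (totalRate_le N s)) (hw0 r hr)),
      hgen r hr, ENNReal.add_sub_cancel_right ENNReal.ofReal_ne_top]
  -- variation of constants
  have hftc : ∫ r in (0 : ℝ)..t, Real.exp (R * r) * g r = Real.exp (R * t) * w t - w 0 := by
    have hd : ∀ r ∈ Set.uIcc 0 t, HasDerivAt (fun r => Real.exp (R * r) * w r)
        (Real.exp (R * r) * g r) r := by
      intro r _
      have h1 := (((hasDerivAt_id r).const_mul R).exp).mul (hwd r)
      refine h1.congr_deriv ?_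
      simp only [hg, id]; ring
    have hi : IntervalIntegrable (fun r => Real.exp (R * r) * g r) volume 0 t :=
      Continuous.intervalIntegrable (by fun_prop) _ _
    rw [intervalIntegral.integral_eq_sub_of_hasDerivAt hd hi]
    simp
  have hw00 : ENNReal.ofReal (w 0) = ind y s := by
    rw [← hwW 0 le_rfl, semi, mul_zero, tsum_eq_single 0 fun n hn => by simp [pois_zero, hn]]
    simp [pois_zero]
  have hmain : w t = Real.exp (-(R * t)) * w 0 +
      ∫ τ in (0 : ℝ)..t, Real.exp (-(R * τ)) * g (t - τ) := by
    have e1 : ∫ τ in (0 : ℝ)..t, Real.exp (-(R * τ)) * g (t - τ) =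
        Real.exp (-(R * t)) * ∫ r in (0 : ℝ)..t, Real.exp (R * r) * g r := by
      rw [← intervalIntegral.integral_const_mul]
      have := intervalIntegral.integral_comp_sub_left (a := 0) (b := t)
        (fun r => Real.exp (-(R * t)) * (Real.exp (R * r) * g r)) t
      simp only [sub_self, sub_zero] at this
      rw [← this]
      refine intervalIntegral.integral_congr fun τ _ => ?_
      simp only [← mul_assoc, ← Real.exp_add]
      congr 2; ring
    rw [e1, hftc, mul_sub, ← mul_assoc, ← Real.exp_add]
    simp
  have hnn : 0 ≤ᵐ[volume.restrict (Set.Ioc 0 t)] fun τ => Real.exp (-(R * τ)) * g (t - τ) :=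
    (ae_restrict_iff' measurableSet_Ioc).2 (Eventually.of_forall fun τ hτ =>
      mul_nonneg (Real.exp_pos _).le (hg0 _ (by linarith [hτ.2])))
  have hcont : Continuous fun τ => Real.exp (-(R * τ)) * g (t - τ) := by fun_prop
  show semi N φ t (ind y) s = _
  rw [hwW t ht, hmain, intervalIntegral.integral_of_le ht,
    ENNReal.ofReal_add (mul_nonneg (Real.exp_pos _).le (hw0 0 le_rfl))
      (integral_nonneg_of_ae hnn),
    ofReal_integral_eq_lintegral_ofReal
      ((hcont.intervalIntegrable 0 t).1) hnn,
    ENNReal.ofReal_mul (Real.exp_pos _).le, hw00]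
  congr 1
  refine setLIntegral_congr_fun measurableSet_Ioc fun τ hτ => ?_
  simp only
  rw [ENNReal.ofReal_mul (Real.exp_pos _).le, hgS _ (by linarith [hτ.2]), Finset.mul_sum]
  refine Finset.sum_congr rfl fun e _ => ?_
  rw [mul_comm (N.rate e), ENNReal.ofReal_mul (Real.exp_pos _).le, mul_assoc]

variable {φ} in
/-- The transition probabilities of the queue length process are those of the uniformized
chain observed at the epochs of a Poisson process. -/
theorem trans_eq_semi (hφ : φ.NonIdling) {t : ℝ} (ht : 0 ≤ t) (x y : State) :
    trans N φ t x y = semi N φ t (ind y) (settle x) := by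
  have h0 : trans N φ t x y = trans N φ t (settle x) y := by
    have : ∀ ω, Q φ (settle x) t ω = Q φ x t ω := by
      intro ω
      have hs : ∀ n, sim φ (settle x) ω n = sim φ x ω n := fun n => by
        rw [sim_eq_run, sim_eq_run, settle_of_settled (settled_settle x)]
      simp only [Q, hs]
    simp only [trans, this]
  rw [h0]
  have hf : ∀ z, ind y z ≤ 1 := fun z => by unfold ind; split_ifs <;> simp
  have h1 : ∀ r s, 0 ≤ r → semi N φ r (ind y) s ≤ 1 := fun r s hr => by
    rw [← tsum_pois (mul_nonneg (unifRate_pos N).le hr)]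
    exact ENNReal.tsum_le_tsum fun n => mul_le_of_le_one_right' (iterate_T_le_one N φ hf n s)
  exact le_antisymm
    ((backwardEq_trans N hφ y).le hφ (backwardEq_semi N φ y) (fun _ _ _ => prob_le_one) ht
      (settled_settle x))
    ((backwardEq_semi N φ y).le hφ (backwardEq_trans N hφ y) h1 ht (settled_settle x))

end

/-! ### The transition semigroup -/

lemma eq_tsum_ind (f : State → ℝ≥0∞) (z : State) : f z = ∑' y, f y * ind y z := by
  rw [tsum_eq_single z fun y hy => by simp [ind, hy.symm]]
  simp [ind]

section
variable {N : Params} {φ : Policy}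

/-- The uniformized chain never leaves the set of settled states. -/
lemma T_mono_settled (hφ : φ.NonIdling) {f g : State → ℝ≥0∞} (h : ∀ z, Settled z → f z ≤ g z)
    {x : State} (hx : Settled x) : T N φ f x ≤ T N φ g x := by
  classical
  refine Finset.sum_le_sum fun e _ => mul_le_mul_right ?_ _
  split_ifs
  · rw [evAvg_congr_settled hφ e x (f := f) (g := fun z => if Settled z then f z else 0)
      fun z hz => (if_pos hz).symm]
    refine evAvg_mono φ e x fun z => ?_
    split_ifs with hz
    exacts [h z hz, zero_le]
  · exact h x hx

lemma iterate_T_mono_settled (hφ : φ.NonIdling) (n : ℕ) {f g : State → ℝ≥0∞}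
    (h : ∀ z, Settled z → f z ≤ g z) {x : State} (hx : Settled x) :
    (T N φ)^[n] f x ≤ (T N φ)^[n] g x := by
  induction n generalizing f g with
  | zero => exact h x hx
  | succ n ih => exact ih fun z hz => T_mono_settled hφ h hz

lemma iterate_T_ind_eq_zero (hφ : φ.NonIdling) (n : ℕ) {x y : State} (hx : Settled x)
    (hy : ¬ Settled y) : (T N φ)^[n] (ind y) x = 0 := by
  refine le_antisymm ?_ zero_le
  have := iterate_T_mono_settled (N := N) hφ n (f := ind y) (g := fun _ => 0) (fun z hz => by
    have : z ≠ y := fun h => hy (h ▸ hz)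
    simp [ind, this]) hx
  rwa [iterate_T_const] at this

variable (N φ) in
lemma semi_mono (t : ℝ) {f g : State → ℝ≥0∞} (h : ∀ z, f z ≤ g z) (x : State) :
    semi N φ t f x ≤ semi N φ t g x :=
  ENNReal.tsum_le_tsum fun n => mul_le_mul_right (iterate_T_mono n h x) _

variable (N φ)

lemma semi_const {t : ℝ} (ht : 0 ≤ t) (k : ℝ≥0∞) (x : State) :
    semi N φ t (fun _ => k) x = k := by
  simp only [semi, iterate_T_const]
  rw [ENNReal.tsum_mul_right, tsum_pois (mul_nonneg (unifRate_pos N).le ht), one_mul]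

lemma semi_add_fun (t : ℝ) (f g : State → ℝ≥0∞) (x : State) :
    semi N φ t (fun z => f z + g z) x = semi N φ t f x + semi N φ t g x := by
  simp only [semi, iterate_T_add, mul_add]
  exact ENNReal.tsum_add

lemma semi_const_mul (t : ℝ) (k : ℝ≥0∞) (f : State → ℝ≥0∞) (x : State) :
    semi N φ t (fun z => k * f z) x = k * semi N φ t f x := by
  simp only [semi, iterate_T_const_mul]
  rw [← ENNReal.tsum_mul_left]
  exact tsum_congr fun n => mul_left_comm _ _ _

lemma semi_tsum {ι : Type*} (t : ℝ) (f : ι → State → ℝ≥0∞) (x : State) :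
    semi N φ t (fun z => ∑' i, f i z) x = ∑' i, semi N φ t (f i) x := by
  simp only [semi, iterate_T_tsum]
  rw [ENNReal.tsum_comm]
  exact tsum_congr fun n => ENNReal.tsum_mul_left.symm

/-- The semigroup property. -/
lemma semi_add {s t : ℝ} (hs : 0 ≤ s) (ht : 0 ≤ t) (f : State → ℝ≥0∞) (x : State) :
    semi N φ (s + t) f x = semi N φ s (semi N φ t f) x := by
  have hΛ := (unifRate_pos N).le
  have h1 : ∀ m, (T N φ)^[m] (semi N φ t f) x =
      ∑' n, pois (unifRate N * t) n * (T N φ)^[m + n] f x := by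
    intro m
    have : semi N φ t f = fun x => ∑' n, pois (unifRate N * t) n * (T N φ)^[n] f x := rfl
    rw [this, iterate_T_tsum]
    refine tsum_congr fun n => ?_
    rw [iterate_T_const_mul, ← Function.iterate_add_apply]
  have h2 : semi N φ s (semi N φ t f) x = ∑' p : ℕ × ℕ,
      pois (unifRate N * s) p.1 * pois (unifRate N * t) p.2 * (T N φ)^[p.1 + p.2] f x := by
    rw [semi, ENNReal.tsum_prod']
    refine tsum_congr fun m => ?_
    rw [h1, ← ENNReal.tsum_mul_left]
    exact tsum_congr fun n => (mul_assoc _ _ _).symm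
  rw [h2, ← Finset.HasAntidiagonal.sigmaAntidiagonalEquivProd.tsum_eq, ENNReal.tsum_sigma', semi]
  refine tsum_congr fun n => ?_
  rw [tsum_fintype, mul_add, ← sum_antidiagonal_pois (mul_nonneg hΛ hs) (mul_nonneg hΛ ht),
    Finset.sum_mul, ← Finset.sum_coe_sort]
  refine Finset.sum_congr rfl fun p _ => ?_
  have := Finset.HasAntidiagonal.mem_antidiagonal.1 p.2
  simp only [Finset.HasAntidiagonal.sigmaAntidiagonalEquivProd_apply]
  rw [this]

lemma semi_zero (f : State → ℝ≥0∞) (x : State) : semi N φ 0 f x = f x := by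
  rw [semi, mul_zero, tsum_eq_single 0 fun n hn => by simp [pois_zero, hn]]
  simp [pois_zero]

lemma iterate_semi_one (n : ℕ) (f : State → ℝ≥0∞) :
    (semi N φ 1)^[n] f = semi N φ n f := by
  induction n with
  | zero => funext x; simp [semi_zero]
  | succ n ih =>
    funext x
    rw [Function.iterate_succ_apply', ih, Nat.cast_succ, add_comm,
      semi_add N φ zero_le_one n.cast_nonneg]

variable {φ} in
lemma tsum_trans_mul (hφ : φ.NonIdling) {t : ℝ} (ht : 0 ≤ t) (x : State) (f : State → ℝ≥0∞) :
    ∑' y, trans N φ t x y * f y = semi N φ t f (settle x) := by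
  have : f = fun z => ∑' y, f y * ind y z := funext fun z => eq_tsum_ind f z
  conv_rhs => rw [this]
  rw [semi_tsum]
  refine tsum_congr fun y => ?_
  rw [semi_const_mul, trans_eq_semi N hφ ht, mul_comm]

end

/-! ### Invariant measures -/

section
variable {N : Params} {φ : Policy}

lemma tsum_mul_T {π : PMF State} (hT : ∀ y, ∑' x, π x * T N φ (ind y) x = π y)
    (f : State → ℝ≥0∞) : ∑' x, π x * T N φ f x = ∑' x, π x * f x := by
  have : f = fun z => ∑' y, f y * ind y z := funext fun z => eq_tsum_ind f z
  conv_lhs => rw [this, T_tsum]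
  simp only [T_const_mul, ← ENNReal.tsum_mul_left]
  rw [ENNReal.tsum_comm]
  refine tsum_congr fun y => ?_
  rw [← hT y, ← ENNReal.tsum_mul_right]
  exact tsum_congr fun x => by ring

/-- A measure that is invariant under one step of the uniformized chain is invariant under all
Poisson mixtures of its steps. -/
lemma isInvariant_of_stationary (hφ : φ.NonIdling) {π : PMF State}
    (hs : ∀ x, ¬ Settled x → π x = 0) (hT : ∀ y, ∑' x, π x * T N φ (ind y) x = π y) :
    IsInvariant N φ π := by
  have hTn : ∀ (n : ℕ) (f : State → ℝ≥0∞),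
      ∑' x, π x * (T N φ)^[n] f x = ∑' x, π x * f x := by
    intro n
    induction n with
    | zero => intro f; rfl
    | succ n ih => intro f; simp only [Function.iterate_succ_apply', tsum_mul_T hT, ih]
  intro t ht y
  have h1 : ∀ x, π x * trans N φ t x y = π x * semi N φ t (ind y) x := by
    intro x
    by_cases hx : Settled x
    · rw [trans_eq_semi N hφ ht, settle_of_settled hx]
    · rw [hs x hx, zero_mul, zero_mul]
  simp only [h1, semi, ← ENNReal.tsum_mul_left]
  rw [ENNReal.tsum_comm]
  have h2 : ∀ n, ∑' x, π x * (pois (unifRate N * t) n * (T N φ)^[n] (ind y) x) =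
      pois (unifRate N * t) n * π y := by
    intro n
    have h3 : ∑' x, π x * (T N φ)^[n] (ind y) x = π y := by
      rw [hTn, tsum_eq_single y fun x hx => by simp [ind, hx]]; simp [ind]
    rw [← h3, ← ENNReal.tsum_mul_left]
    exact tsum_congr fun x => mul_left_comm _ _ _
  simp only [h2]
  rw [ENNReal.tsum_mul_right, tsum_pois (mul_nonneg (unifRate_pos N).le ht), one_mul]

lemma IsInvariant.eq_zero_of_not_settled (hφ : φ.NonIdling) {π : PMF State}
    (h : IsInvariant N φ π) {y : State} (hy : ¬ Settled y) : π y = 0 := by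
  rw [h 0 le_rfl y, ENNReal.tsum_eq_zero]
  intro x
  have : settle x ≠ y := fun h => hy (h ▸ settled_settle x)
  rw [trans_eq_semi N hφ le_rfl, semi_zero]
  simp [ind, this]

lemma IsInvariant.tsum_semi (hφ : φ.NonIdling) {π : PMF State} (h : IsInvariant N φ π) {t : ℝ}
    (ht : 0 ≤ t) (f : State → ℝ≥0∞) : ∑' x, π x * semi N φ t f x = ∑' x, π x * f x := by
  have h1 : ∀ x, π x * semi N φ t f x = ∑' y, π x * trans N φ t x y * f y := by
    intro x
    by_cases hx : Settled x
    · have := tsum_trans_mul N hφ ht x f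
      rw [settle_of_settled hx] at this
      rw [← this, ← ENNReal.tsum_mul_left]
      exact tsum_congr fun y => (mul_assoc _ _ _).symm
    · simp [h.eq_zero_of_not_settled hφ hx]
  simp only [h1]
  rw [ENNReal.tsum_comm]
  refine tsum_congr fun y => ?_
  rw [ENNReal.tsum_mul_right, ← h t ht y]

/-- An invariant probability measure is unique if the empty state can be reached from everywhere:
the common part `min π π'` is invariant too, so the remainders `π - min π π'` and `π' - min π π'`
are invariant, and if both were nonzero they would both charge the empty state. -/
lemma IsInvariant.unique (hφ : φ.NonIdling) (hreach : ∀ x, 0 < trans N φ 1 x 0) {π π' : PMF State}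
    (h : IsInvariant N φ π) (h' : IsInvariant N φ π') : π' = π := by
  set P := trans N φ 1 with hP
  have hP1 : ∀ x, ∑' y, P x y = 1 := by
    intro x
    have := tsum_trans_mul N hφ zero_le_one x fun _ => 1
    simpa [semi_const N φ zero_le_one] using this
  have hswap : ∀ μ : State → ℝ≥0∞, ∑' y, ∑' x, μ x * P x y = ∑' x, μ x := by
    intro μ
    rw [ENNReal.tsum_comm]
    exact tsum_congr fun x => by rw [ENNReal.tsum_mul_left, hP1, mul_one]
  set m : State → ℝ≥0∞ := fun x => min (π x) (π' x) with hm
  have hmfin : ∑' x, m x ≠ ∞ :=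
    ne_top_of_le_ne_top ENNReal.one_ne_top
      ((ENNReal.tsum_le_tsum fun x => min_le_left _ _).trans π.tsum_coe.le)
  have hmx : ∀ x, m x ≠ ∞ := fun x => ne_top_of_le_ne_top hmfin (ENNReal.le_tsum x)
  have hle : ∀ y, ∑' x, m x * P x y ≤ m y := by
    intro y
    refine le_min ?_ ?_
    · rw [h 1 zero_le_one y]
      exact ENNReal.tsum_le_tsum fun x => mul_le_mul_left (min_le_left _ _) _
    · rw [h' 1 zero_le_one y]
      exact ENNReal.tsum_le_tsum fun x => mul_le_mul_left (min_le_right _ _) _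
  have hinv : ∀ y, ∑' x, m x * P x y = m y := by
    intro y
    by_contra hne
    have hlt := lt_of_le_of_ne (hle y) hne
    have := ENNReal.tsum_lt_tsum (f := fun y => ∑' x, m x * P x y) (g := m)
      (by rw [hswap]; exact hmfin) hle hlt
    rw [hswap] at this
    exact lt_irrefl _ this
  have hrem : ∀ ρ : PMF State, IsInvariant N φ ρ → (∀ x, m x ≤ ρ x) →
      (∃ x, 0 < ρ x - m x) → 0 < ρ 0 - m 0 := by
    rintro ρ hρ hmρ ⟨x, hx⟩
    have h1 : ρ 0 = ∑' x, (ρ x - m x) * P x 0 + m 0 := by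
      conv_lhs => rw [hρ 1 zero_le_one 0]
      rw [← hinv 0, ← ENNReal.tsum_add]
      refine tsum_congr fun x => ?_
      rw [← add_mul, tsub_add_cancel_of_le (hmρ x)]
    rw [h1, ENNReal.add_sub_cancel_right (hmx 0)]
    exact (ENNReal.mul_pos hx.ne' (hreach x).ne').trans_le (ENNReal.le_tsum x)
  have hcases : (∀ x, π x ≤ m x) ∨ ∀ x, π' x ≤ m x := by
    by_contra! hcon
    obtain ⟨⟨x, hx⟩, ⟨x', hx'⟩⟩ := hcon
    have a1 := hrem π h (fun x => min_le_left _ _) ⟨x, tsub_pos_of_lt hx⟩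
    have a2 := hrem π' h' (fun x => min_le_right _ _) ⟨x', tsub_pos_of_lt hx'⟩
    have b1 : m 0 < π 0 := tsub_pos_iff_lt.1 a1
    have b2 : m 0 < π' 0 := tsub_pos_iff_lt.1 a2
    exact lt_irrefl _ (lt_min b1 b2)
  have hfin : ∀ ρ ρ' : PMF State, (∀ x, ρ x ≤ ρ' x) → ρ' = ρ := by
    intro ρ ρ' hρ
    refine PMF.ext fun y => ?_
    by_contra hne
    have := ENNReal.tsum_lt_tsum (f := ρ) (g := ρ') (by rw [ρ.tsum_coe]; simp) hρ
      (lt_of_le_of_ne (hρ y) (Ne.symm hne))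
    rw [ρ.tsum_coe, ρ'.tsum_coe] at this
    exact lt_irrefl _ this
  rcases hcases with hc | hc
  · exact hfin π π' fun x => (hc x).trans (min_le_right _ _)
  · exact (hfin π' π fun x => (hc x).trans (min_le_left _ _)).symm

end

/-! ### Existence of an invariant measure -/

lemma finite_norm1_le (M : ℕ) : {x : State | norm1 x ≤ M}.Finite := by
  refine (Set.Finite.pi' fun _ : Buffer => Set.finite_Iic M).subset fun x hx i => ?_
  exact (Finset.single_le_sum (f := x) (fun _ _ => Nat.zero_le _) (Finset.mem_univ i)).trans hx

lemma norm1_le_jump (e : Buffer) (x : State) : norm1 x ≤ norm1 (jump e x) + 1 := by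
  cases e <;> simp [norm1_eq, jump, Function.update] <;> omega

lemma evAvg_eq_zero (φ : Policy) (e : Buffer) (x : State) {f : State → ℝ≥0∞}
    (h : ∀ z, norm1 z = norm1 (jump e x) → f z = 0) : evAvg φ e x f = 0 := by
  refine Finset.sum_eq_zero fun d1 _ => Finset.sum_eq_zero fun d3 _ => ?_
  rw [h _ (norm1_drain _ _ _), mul_zero]

section
variable {N : Params} {φ : Policy}

lemma norm1_le_of_T_ind_ne_zero {x y : State} (h : T N φ (ind y) x ≠ 0) :
    norm1 x ≤ norm1 y + 1 := by
  by_contra! hlt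
  refine h (Finset.sum_eq_zero fun e _ => ?_)
  split_ifs
  · rw [evAvg_eq_zero φ e x, mul_zero]
    intro z hz
    have : z ≠ y := by
      rintro rfl
      have := norm1_le_jump e x
      omega
    simp [ind, this]
  · have : x ≠ y := by rintro rfl; omega
    simp [ind, this]

lemma settled_zero : Settled (0 : State) := ⟨fun _ => rfl, fun _ => rfl⟩

/-- Foster's criterion: if the drift of `V` is at most `b - c * ‖x‖` on settled states, there is an
invariant probability measure. It is a limit along an ultrafilter of the mean occupation
measures of the chain started empty, which are tight. -/
lemma exists_stationary (hφ : φ.NonIdling) {V : State → ℝ≥0∞} (hV0 : V 0 ≠ ∞) {b c : ℝ≥0∞}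
    (hb : b ≠ ∞) (hc0 : c ≠ 0) (hc : c ≠ ∞)
    (hdrift : ∀ x, Settled x → T N φ V x + c * norm1 x ≤ V x + b) :
    ∃ π : PMF State, (∀ x, ¬ Settled x → π x = 0) ∧ ∀ y, ∑' x, π x * T N φ (ind y) x = π y := by
  classical
  -- summation of the drift inequality along the chain started empty
  have hocc : ∀ n : ℕ, ∑ k ∈ Finset.range n, (T N φ)^[k] (fun x => c * (norm1 x : ℝ≥0∞)) 0 +
      (T N φ)^[n] V 0 ≤ V 0 + n * b := by
    intro n
    induction n with
    | zero => simp
    | succ n ih =>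
      have h := iterate_T_mono_settled (N := N) hφ n hdrift settled_zero
      rw [iterate_T_add, iterate_T_add, iterate_T_const, ← Function.iterate_succ_apply] at h
      rw [Finset.sum_range_succ, add_assoc, add_comm _ ((T N φ)^[n + 1] V 0)]
      calc _ ≤ _ + ((T N φ)^[n] V 0 + b) := add_le_add_right h _
        _ ≤ V 0 + n * b + b := by rw [← add_assoc]; exact add_le_add_left ih _
        _ = _ := by push_cast; ring
  set μ : ℕ → State → ℝ≥0∞ := fun n y =>
    ((n + 1 : ℕ) : ℝ≥0∞)⁻¹ * ∑ k ∈ Finset.range (n + 1), (T N φ)^[k] (ind y) 0 with hμ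
  have hn0 : ∀ n : ℕ, ((n + 1 : ℕ) : ℝ≥0∞) ≠ 0 := fun n => by
    exact_mod_cast Nat.succ_ne_zero n
  have hnt : ∀ n : ℕ, ((n + 1 : ℕ) : ℝ≥0∞) ≠ ∞ := fun n => ENNReal.natCast_ne_top _
  have hμf : ∀ n (f : State → ℝ≥0∞), ∑' y, μ n y * f y =
      ((n + 1 : ℕ) : ℝ≥0∞)⁻¹ * ∑ k ∈ Finset.range (n + 1), (T N φ)^[k] f 0 := by
    intro n f
    have hk : ∀ k, (T N φ)^[k] f 0 = ∑' y, f y * (T N φ)^[k] (ind y) 0 := by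
      intro k
      have : f = fun z => ∑' y, f y * ind y z := funext fun z => eq_tsum_ind f z
      conv_lhs => rw [this]
      rw [iterate_T_tsum]
      exact tsum_congr fun y => by rw [iterate_T_const_mul]
    simp only [hk]
    rw [← Summable.tsum_finsetSum fun _ _ => ENNReal.summable, ← ENNReal.tsum_mul_left]
    refine tsum_congr fun y => ?_
    rw [hμ, ← Finset.mul_sum]; ring
  have hμ1 : ∀ n, ∑' y, μ n y = 1 := by
    intro n
    have := hμf n fun _ => 1
    simp only [mul_one, iterate_T_const, Finset.sum_const, Finset.card_range, nsmul_eq_mul] at this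
    rw [this, ENNReal.inv_mul_cancel (hn0 n) (hnt n)]
  set K : ℝ≥0∞ := c⁻¹ * (V 0 + b) with hK
  have hKt : K ≠ ∞ := ENNReal.mul_ne_top (ENNReal.inv_ne_top.2 hc0) (ENNReal.add_ne_top.2 ⟨hV0, hb⟩)
  have hμn : ∀ n, ∑' y, μ n y * (norm1 y : ℝ≥0∞) ≤ K := by
    intro n
    have h1 : c * ∑' y, μ n y * (norm1 y : ℝ≥0∞) ≤ V 0 + b := by
      have h2 : c * ∑' y, μ n y * (norm1 y : ℝ≥0∞) = ∑' y, μ n y * (c * norm1 y) := by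
        rw [← ENNReal.tsum_mul_left]; exact tsum_congr fun y => mul_left_comm _ _ _
      rw [h2, hμf n fun y => c * norm1 y]
      calc _ ≤ ((n + 1 : ℕ) : ℝ≥0∞)⁻¹ * (V 0 + (n + 1 : ℕ) * b) :=
            mul_le_mul_right (le_self_add.trans (hocc (n + 1))) _
        _ ≤ ((n + 1 : ℕ) : ℝ≥0∞)⁻¹ * ((n + 1 : ℕ) * (V 0 + b)) := by
            refine mul_le_mul_right ?_ _
            rw [mul_add]
            refine add_le_add_left (le_mul_of_one_le_left zero_le ?_) _
            exact_mod_cast Nat.succ_le_succ (Nat.zero_le n)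
        _ = V 0 + b := by
            rw [← mul_assoc, ENNReal.inv_mul_cancel (hn0 n) (hnt n), one_mul]
    calc _ = c⁻¹ * (c * ∑' y, μ n y * (norm1 y : ℝ≥0∞)) := by
          rw [← mul_assoc, ENNReal.inv_mul_cancel hc0 hc, one_mul]
      _ ≤ K := mul_le_mul_right h1 _
  clear_value μ
  -- the limit along a free ultrafilter, in the compact space `ℝ≥0∞`
  have hlim : ∀ y, ∃ l, Tendsto (fun n => μ n y) (hyperfilter ℕ : Filter ℕ) (𝓝 l) := by
    intro y
    obtain ⟨l, _, hl⟩ := isCompact_univ.ultrafilter_le_nhds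
      (Ultrafilter.map (fun n => μ n y) (hyperfilter ℕ)) (by simp)
    exact ⟨l, hl⟩
  choose p hp using hlim
  have hsumle : ∀ B : Finset State, ∑ y ∈ B, p y ≤ 1 := fun B =>
    le_of_tendsto' (tendsto_finsetSum B fun y _ => hp y) fun n =>
      (ENNReal.sum_le_tsum B).trans (hμ1 n).le
  have hple : ∑' y, p y ≤ 1 := by
    rw [ENNReal.tsum_eq_iSup_sum]; exact iSup_le hsumle
  have htail : ∀ M : ℕ, 1 ≤ ∑' y, p y + K / (M + 1 : ℕ) := by
    intro M
    set B := (finite_norm1_le M).toFinset with hB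
    have h1 : ∀ n, 1 ≤ ∑ y ∈ B, μ n y + K / (M + 1 : ℕ) := by
      intro n
      have h2 : ∀ y, ((M + 1 : ℕ) : ℝ≥0∞) * μ n y ≤
          (M + 1 : ℕ) * (if y ∈ B then μ n y else 0) + μ n y * norm1 y := by
        intro y
        split_ifs with hy
        · exact le_self_add
        · rw [mul_zero, zero_add, mul_comm]
          refine mul_le_mul_right ?_ _
          have : ¬ norm1 y ≤ M := by simpa [hB] using hy
          exact_mod_cast not_le.1 this
      have h3 := ENNReal.tsum_le_tsum h2
      rw [ENNReal.tsum_mul_left, ENNReal.tsum_add, ENNReal.tsum_mul_left, hμ1, mul_one,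
        tsum_eq_sum (s := B) (fun y hy => if_neg hy),
        Finset.sum_congr rfl fun y hy => if_pos hy] at h3
      have h4 := h3.trans (add_le_add_right (hμn n) _)
      calc (1 : ℝ≥0∞) = (M + 1 : ℕ) / (M + 1 : ℕ) := (ENNReal.div_self (hn0 M) (hnt M)).symm
        _ ≤ ((M + 1 : ℕ) * ∑ y ∈ B, μ n y + K) / (M + 1 : ℕ) := ENNReal.div_le_div_right h4 _
        _ = _ := by
          rw [ENNReal.add_div, mul_comm, ENNReal.mul_div_cancel_right (hn0 M) (hnt M)]
    have h5 : Tendsto (fun n => ∑ y ∈ B, μ n y + K / (M + 1 : ℕ)) (hyperfilter ℕ : Filter ℕ)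
        (𝓝 (∑ y ∈ B, p y + K / (M + 1 : ℕ))) :=
      (tendsto_finsetSum B fun y _ => hp y).add tendsto_const_nhds
    exact (ge_of_tendsto' h5 h1).trans (add_le_add_left (ENNReal.sum_le_tsum B) _)
  have hp1 : ∑' y, p y = 1 := by
    refine le_antisymm hple ?_
    have h0 : Tendsto (fun M : ℕ => K / (M : ℝ≥0∞)) atTop (𝓝 0) :=
      ENNReal.Tendsto.const_div ENNReal.tendsto_nat_nhds_top (Or.inr hKt) |>.trans (by simp)
    have h1 := tendsto_const_nhds (x := ∑' y, p y) |>.add ((tendsto_add_atTop_iff_nat 1).2 h0)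
    rw [add_zero] at h1
    exact ge_of_tendsto' h1 htail
  refine ⟨⟨p, by rw [← hp1]; exact ENNReal.summable.hasSum⟩, fun x hx => ?_, fun y => ?_⟩
  · refine tendsto_nhds_unique (hp x) ?_
    have : ∀ n, μ n x = 0 := fun n => by
      simp [hμ, iterate_T_ind_eq_zero hφ _ settled_zero hx]
    simp [this]
  · show ∑' x, p x * T N φ (ind y) x = p y
    set B := (finite_norm1_le (norm1 y + 1)).toFinset with hB
    have hsupp : ∀ x ∉ B, T N φ (ind y) x = 0 := by
      intro x hx
      by_contra h
      exact hx (by simpa [hB] using norm1_le_of_T_ind_ne_zero h)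
    have hfin : ∀ x, T N φ (ind y) x ≠ ∞ := fun x =>
      ne_top_of_le_ne_top ENNReal.one_ne_top
        (iterate_T_le_one N φ (fun z => by unfold ind; split_ifs <;> simp) 1 x)
    rw [tsum_eq_sum (s := B) fun x hx => by rw [hsupp x hx, mul_zero]]
    have hone : ∀ k, (T N φ)^[k] (ind y) 0 ≤ 1 := fun k =>
      iterate_T_le_one N φ (fun z => by unfold ind; split_ifs <;> simp) k 0
    have h0 : Tendsto (fun n : ℕ => ((n + 1 : ℕ) : ℝ≥0∞)⁻¹) atTop (𝓝 0) :=
      (tendsto_add_atTop_iff_nat 1).2 ENNReal.tendsto_inv_nat_nhds_zero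
    have hhyp : (hyperfilter ℕ : Filter ℕ) ≤ atTop := by
      rw [← Nat.cofinite_eq_atTop]; exact hyperfilter_le_cofinite
    have hsmall : ∀ m : ℕ → ℕ, Tendsto (fun n : ℕ => ((n + 1 : ℕ) : ℝ≥0∞)⁻¹ *
        (T N φ)^[m n] (ind y) 0) (hyperfilter ℕ : Filter ℕ) (𝓝 0) := fun m =>
      tendsto_of_tendsto_of_tendsto_of_le_of_le tendsto_const_nhds (h0.mono_left hhyp)
        (fun _ => zero_le) fun n => mul_le_of_le_one_right' (hone _)
    have heq : ∀ n, ∑ x ∈ B, μ n x * T N φ (ind y) x +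
        ((n + 1 : ℕ) : ℝ≥0∞)⁻¹ * (T N φ)^[0] (ind y) 0 =
        μ n y + ((n + 1 : ℕ) : ℝ≥0∞)⁻¹ * (T N φ)^[n + 1] (ind y) 0 := by
      intro n
      have h1 : ∑ x ∈ B, μ n x * T N φ (ind y) x = ∑' x, μ n x * T N φ (ind y) x :=
        (tsum_eq_sum (s := B) fun x hx => by rw [hsupp x hx, mul_zero]).symm
      rw [h1, hμf n, hμ, ← mul_add, ← mul_add]
      congr 1
      simp only [← Function.iterate_succ_apply]
      rw [← Finset.sum_range_succ, Finset.sum_range_succ' (fun k => (T N φ)^[k] (ind y) 0)]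
    have t1 : Tendsto (fun n => ∑ x ∈ B, μ n x * T N φ (ind y) x +
        ((n + 1 : ℕ) : ℝ≥0∞)⁻¹ * (T N φ)^[0] (ind y) 0) (hyperfilter ℕ : Filter ℕ)
        (𝓝 (∑ x ∈ B, p x * T N φ (ind y) x + 0)) :=
      (tendsto_finsetSum B fun x _ => ENNReal.Tendsto.mul_const (hp x) (Or.inr (hfin x))).add
        (hsmall fun _ => 0)
    have t2 : Tendsto (fun n => μ n y + ((n + 1 : ℕ) : ℝ≥0∞)⁻¹ * (T N φ)^[n + 1] (ind y) 0)
        (hyperfilter ℕ : Filter ℕ) (𝓝 (p y + 0)) := (hp y).add (hsmall fun n => n + 1)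
    simp only [heq] at t1
    simpa using tendsto_nhds_unique t1 t2

end

/-! ### Exponential ergodicity forces an exponential tail -/

/-- The renewal argument behind Kendall's theorem. The numbers `G n` are the tails of the sequence
`p * H n`, and `W n` is the convolution of `H` with a geometric sequence; if it dominates `G`, then
`p * W n + G (n + 1)` decreases by a constant factor at each step. -/
lemma geometric_decay_of_renewal {G H W : ℕ → ℝ} {p ρ C : ℝ} (hp : 0 < p) (hρ0 : 0 ≤ ρ)
    (hρ1 : ρ < 1) (hC : 0 < C) (hH : ∀ n, 0 ≤ H n) (hG : ∀ n, 0 ≤ G n) (hGH : ∀ n, G n = G (n + 1) + p * H n)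
    (hW0 : W 0 = H 0) (hW : ∀ n, W (n + 1) = H (n + 1) + ρ * W n) (hGW : ∀ n, G n ≤ C * W n) :
    ∃ r K : ℝ, 0 < r ∧ r < 1 ∧ 0 < K ∧ ∀ n, G n ≤ K * r ^ n := by
  have hW' : ∀ n, 0 ≤ W n := by
    intro n
    induction n with
    | zero => rw [hW0]; exact hH 0
    | succ n ih => rw [hW]; exact add_nonneg (hH _) (mul_nonneg hρ0 ih)
  set r : ℝ := 1 - (1 - ρ) * p / (p + C) with hr
  have hpC : 0 < p + C := by positivity
  have hx0 : 0 < (1 - ρ) * p / (p + C) := div_pos (mul_pos (by linarith) hp) hpC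
  have hx1 : (1 - ρ) * p / (p + C) < 1 := by
    rw [div_lt_one hpC]; nlinarith
  have hr0 : 0 < r := by linarith
  have hr1 : r < 1 := by linarith
  set L : ℕ → ℝ := fun n => p * W n + G (n + 1) with hL
  have hL0 : ∀ n, 0 ≤ L n := fun n => add_nonneg (mul_nonneg hp.le (hW' n)) (hG _)
  have hstep : ∀ n, L (n + 1) ≤ r * L n := by
    intro n
    have h1 : L (n + 1) = L n - (1 - ρ) * p * W n := by
      simp only [hL]
      rw [hW, hGH (n + 1)]; ring
    have h2 : L n ≤ (p + C) * W n := by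
      have : G (n + 1) ≤ G n := by
        rw [hGH n]; exact le_add_of_nonneg_right (mul_nonneg hp.le (hH n))
      simp only [hL]
      linarith [hGW n]
    have h3 : (1 - ρ) * p / (p + C) * L n ≤ (1 - ρ) * p * W n := by
      calc _ ≤ (1 - ρ) * p / (p + C) * ((p + C) * W n) := by gcongr
        _ = _ := by field_simp
    rw [h1, hr]; linarith
  have hLn : ∀ n, L n ≤ L 0 * r ^ n := by
    intro n
    induction n with
    | zero => simp
    | succ n ih =>
      refine (hstep n).trans ?_
      rw [pow_succ]
      nlinarith
  refine ⟨r, (L 0 + G 0 + 1) / r, hr0, hr1, by have := hL0 0; have := hG 0; positivity, fun n => ?_⟩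
  have hG00 := hG 0
  have hL00 := hL0 0
  cases n with
  | zero =>
    rw [pow_zero, mul_one, le_div_iff₀ hr0]; nlinarith
  | succ n =>
    have h1 : G (n + 1) ≤ L n := le_add_of_nonneg_left (mul_nonneg hp.le (hW' n))
    have h2 := pow_pos hr0 n
    calc G (n + 1) ≤ L 0 * r ^ n := h1.trans (hLn n)
      _ ≤ (L 0 + G 0 + 1) * r ^ n := by nlinarith
      _ = _ := by rw [pow_succ]; field_simp

section
variable (N : Params) (φ : Policy)

/-- The probability that the process, started at `x`, is not empty at any of the times
`1, …, n`. -/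
def avoid : ℕ → State → ℝ≥0∞
  | 0 => fun _ => 1
  | n + 1 => semi N φ 1 fun z => if z = 0 then 0 else avoid n z

lemma avoid_le_one (n : ℕ) (x : State) : avoid N φ n x ≤ 1 := by
  induction n generalizing x with
  | zero => exact le_rfl
  | succ n ih =>
    have h : ∀ z : State, (if z = 0 then 0 else avoid N φ n z) ≤ 1 := fun z => by
      split_ifs
      exacts [zero_le, ih z]
    refine (semi_mono N φ 1 h x).trans ?_
    rw [semi_const N φ zero_le_one]

/-- The decomposition at the last visit to the empty state. -/
lemma last_visit (n : ℕ) (x : State) :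
    avoid N φ n x + ∑ k ∈ Finset.range n,
      (semi N φ 1)^[k + 1] (ind 0) x * avoid N φ (n - 1 - k) 0 = 1 := by
  induction n generalizing x with
  | zero => simp [avoid]
  | succ n ih =>
    have h0 : (1 : ℝ≥0∞) = semi N φ 1 (fun z => avoid N φ n z + ∑ k ∈ Finset.range n,
        (semi N φ 1)^[k + 1] (ind 0) z * avoid N φ (n - 1 - k) 0) x := by
      simp only [ih]
      rw [semi_const N φ zero_le_one]
    have h1 : ∀ z, avoid N φ n z =
        (if z = 0 then 0 else avoid N φ n z) + avoid N φ n 0 * ind 0 z := by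
      intro z
      by_cases hz : z = 0
      · subst hz; simp [ind]
      · simp [ind, hz]
    have h2 : semi N φ 1 (fun z => avoid N φ n z) x =
        avoid N φ (n + 1) x + avoid N φ n 0 * semi N φ 1 (ind 0) x := by
      conv_lhs => rw [funext h1]
      rw [semi_add_fun, semi_const_mul]
      rfl
    have h3 : semi N φ 1 (fun z => ∑ k ∈ Finset.range n,
        (semi N φ 1)^[k + 1] (ind 0) z * avoid N φ (n - 1 - k) 0) x =
        ∑ k ∈ Finset.range n, (semi N φ 1)^[k + 2] (ind 0) x * avoid N φ (n - 1 - k) 0 := by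
      simp only [Finset.sum_range, mul_comm _ (avoid N φ _ _)]
      simp only [← tsum_fintype (L := .unconditional _)]
      rw [semi_tsum]
      refine tsum_congr fun k => ?_
      rw [semi_const_mul, ← Function.iterate_succ_apply' (semi N φ 1)]
    rw [h0, semi_add_fun, h2, h3, add_assoc, Finset.sum_range_succ']
    congr 1
    rw [add_comm]
    congr 1
    · rw [mul_comm]; rfl
    · refine Finset.sum_congr rfl fun k hk => ?_
      rw [show n + 1 - 1 - (k + 1) = n - 1 - k by omega]

variable {N φ}

/-- The total queue length decreases at most by one at each step of the uniformized chain, so that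
`(1 / 2) ^ ‖x‖` grows at most by the factor `2`. -/
lemma iterate_semi_ind_zero_le (k : ℕ) (x : State) :
    (semi N φ 1)^[k] (ind 0) x ≤
      ENNReal.ofReal (Real.exp (unifRate N * k)) * ENNReal.ofReal ((1 / 2) ^ norm1 x) := by
  have hT : ∀ x, T N φ (fun z => ENNReal.ofReal ((1 / 2) ^ norm1 z)) x ≤
      2 * ENNReal.ofReal ((1 / 2) ^ norm1 x) := by
    intro x
    have hkey : ∀ z, norm1 x ≤ norm1 z + 1 → ENNReal.ofReal ((1 / 2) ^ norm1 z) ≤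
        2 * ENNReal.ofReal ((1 / 2) ^ norm1 x) := by
      intro z hz
      rw [← ENNReal.ofReal_ofNat, ← ENNReal.ofReal_mul (by norm_num)]
      refine ENNReal.ofReal_le_ofReal ?_
      have : ((1 : ℝ) / 2) ^ (norm1 z + 1) ≤ (1 / 2) ^ norm1 x :=
        pow_le_pow_of_le_one (by norm_num) (by norm_num) hz
      rw [pow_succ] at this
      linarith
    rw [← one_mul (2 * _), ← sum_rate_div N, Finset.sum_mul]
    refine Finset.sum_le_sum fun e _ => mul_le_mul_right ?_ _
    split_ifs
    · rw [← evAvg_const φ e x (2 * _)]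
      refine Finset.sum_le_sum fun d1 _ => Finset.sum_le_sum fun d3 _ => mul_le_mul_right ?_ _
      exact hkey _ (by rw [norm1_drain]; exact norm1_le_jump e x)
    · exact hkey x (Nat.le_succ _)
  have hTn : ∀ n x, (T N φ)^[n] (fun z => ENNReal.ofReal ((1 / 2) ^ norm1 z)) x ≤
      ENNReal.ofReal (2 ^ n) * ENNReal.ofReal ((1 / 2) ^ norm1 x) := by
    intro n
    induction n with
    | zero => intro x; simp
    | succ n ih =>
      intro x
      rw [Function.iterate_succ_apply']
      refine (T_mono ih x).trans ?_
      rw [T_const_mul, pow_succ, ENNReal.ofReal_mul (by positivity), mul_assoc]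
      refine mul_le_mul_right ?_ _
      simpa using hT x
  have h0 : ∀ z, ind 0 z ≤ ENNReal.ofReal ((1 / 2) ^ norm1 z) := by
    intro z
    unfold ind
    split_ifs with h
    · subst h; simp [norm1_eq]
    · exact zero_le
  rw [iterate_semi_one]
  refine (semi_mono N φ _ h0 x).trans ?_
  have h1 : semi N φ k (fun z => ENNReal.ofReal ((1 / 2) ^ norm1 z)) x ≤
      ∑' n, pois (unifRate N * k) n * ENNReal.ofReal (2 ^ n) *
        ENNReal.ofReal ((1 / 2) ^ norm1 x) :=
    ENNReal.tsum_le_tsum fun n => by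
      rw [mul_assoc]; exact mul_le_mul_right (hTn n x) _
  refine h1.trans ?_
  rw [ENNReal.tsum_mul_right, tsum_pois_mul_pow
    (mul_nonneg (unifRate_pos N).le k.cast_nonneg) (by norm_num)]
  refine mul_le_mul_left (ENNReal.ofReal_le_ofReal ?_) _
  rw [Real.exp_le_exp]; linarith

/-- A long queue does not disappear in a short time. -/
lemma exists_half_le_avoid (N : Params) (φ : Policy) : ∃ M : ℕ, 0 < M ∧ ∀ (n : ℕ) (x : State),
    M * n + 1 ≤ norm1 x → 1 / 2 ≤ avoid N φ n x := by
  obtain ⟨M, hM⟩ := pow_unbounded_of_one_lt (Real.exp (unifRate N + 1)) (one_lt_two (α := ℝ))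
  refine ⟨M + 1, by omega, fun n x hx => ?_⟩
  have hsum : ∑ k ∈ Finset.range n, (semi N φ 1)^[k + 1] (ind 0) x * avoid N φ (n - 1 - k) 0 ≤
      1 / 2 := by
    have hterm : ∀ k ∈ Finset.range n,
        (semi N φ 1)^[k + 1] (ind 0) x * avoid N φ (n - 1 - k) 0 ≤
        ENNReal.ofReal (Real.exp (unifRate N * n) * (1 / 2) ^ norm1 x) := by
      intro k hk
      refine (mul_le_of_le_one_right' (avoid_le_one N φ _ _)).trans ?_
      refine (iterate_semi_ind_zero_le _ _).trans ?_
      rw [← ENNReal.ofReal_mul (Real.exp_pos _).le]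
      refine ENNReal.ofReal_le_ofReal (mul_le_mul_of_nonneg_right ?_ (by positivity))
      rw [Real.exp_le_exp]
      have : k + 1 ≤ n := Finset.mem_range.1 hk
      have hc : ((k + 1 : ℕ) : ℝ) ≤ n := by exact_mod_cast this
      exact mul_le_mul_of_nonneg_left hc (unifRate_pos N).le
    refine (Finset.sum_le_sum hterm).trans ?_
    rw [Finset.sum_const, Finset.card_range, nsmul_eq_mul, ← ENNReal.ofReal_natCast,
      ← ENNReal.ofReal_mul n.cast_nonneg,
      show (1 / 2 : ℝ≥0∞) = ENNReal.ofReal (1 / 2) by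
        rw [ENNReal.ofReal_div_of_pos two_pos]; simp]
    refine ENNReal.ofReal_le_ofReal ?_
    have h1 : (n : ℝ) ≤ Real.exp n := (by linarith [Real.add_one_le_exp (n : ℝ)])
    have h2 : (n : ℝ) * Real.exp (unifRate N * n) ≤ 2 ^ (M * n) := by
      calc (n : ℝ) * Real.exp (unifRate N * n) ≤ Real.exp n * Real.exp (unifRate N * n) := by
            gcongr
        _ = Real.exp (unifRate N + 1) ^ n := by
            rw [← Real.exp_add, ← Real.exp_nat_mul]; ring_nf
        _ ≤ (2 ^ M) ^ n := by gcongr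
        _ = _ := (pow_mul _ _ _).symm
    have h3 : ((1 : ℝ) / 2) ^ norm1 x ≤ (1 / 2) ^ (M * n + 1) :=
      pow_le_pow_of_le_one (by norm_num) (by norm_num)
        (le_trans (by nlinarith) hx)
    calc (n : ℝ) * (Real.exp (unifRate N * n) * (1 / 2) ^ norm1 x)
        = (n * Real.exp (unifRate N * n)) * (1 / 2) ^ norm1 x := by ring
      _ ≤ 2 ^ (M * n) * (1 / 2) ^ (M * n + 1) := by gcongr
      _ = 1 / 2 := by rw [pow_succ, ← mul_assoc, ← mul_pow]; norm_num
  have h := last_visit N φ n x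
  by_contra! hlt
  have : avoid N φ n x + ∑ k ∈ Finset.range n,
      (semi N φ 1)^[k + 1] (ind 0) x * avoid N φ (n - 1 - k) 0 < 1 / 2 + 1 / 2 :=
    ENNReal.add_lt_add_of_lt_of_le (ne_top_of_le_ne_top (by simp) hsum) hlt hsum
  rw [h, ENNReal.add_halves] at this
  exact lt_irrefl _ this

/-- If the probabilities of being empty converge exponentially fast to the invariant probability,
then the invariant measure has an exponential tail. -/
lemma hasExpTail_of_exp_convergence (hφ : φ.NonIdling) (hreach : ∀ x, 0 < trans N φ 1 x 0)
    {π : PMF State} (hπ : IsInvariant N φ π) {θ : ℝ} (hθ : 0 < θ)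
    (hconv : Tendsto (fun t : ℝ => Real.exp (θ * t) *
      |(trans N φ t 0 0).toReal - (π 0).toReal|) atTop (𝓝 0)) : HasExpTail π := by
  classical
  have hπ0 : 0 < π 0 := by
    obtain ⟨x, hx⟩ := π.support_nonempty
    rw [hπ 1 zero_le_one 0]
    exact (ENNReal.mul_pos ((PMF.mem_support_iff _ _).1 hx) (hreach x).ne').trans_le
      (ENNReal.le_tsum x)
  have hπt : ∀ x, π x ≠ ∞ := fun x => π.apply_ne_top x
  set p : ℝ := (π 0).toReal with hp
  have hp0 : 0 < p := ENNReal.toReal_pos hπ0.ne' (hπt 0)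
  set u : ℕ → ℝ := fun k => ((semi N φ 1)^[k] (ind 0) 0).toReal with hu
  have hsz : settle (0 : State) = 0 := settle_of_settled settled_zero
  have hut : ∀ k : ℕ, u k = (trans N φ k 0 0).toReal := fun k => by
    change ((semi N φ 1)^[k] (ind 0) 0).toReal = _
    rw [iterate_semi_one, trans_eq_semi N hφ k.cast_nonneg, hsz]
  have hav : ∀ n x, avoid N φ n x ≠ ∞ := fun n x =>
    ne_top_of_le_ne_top ENNReal.one_ne_top (avoid_le_one N φ n x)
  have hit : ∀ k x, (semi N φ 1)^[k] (ind 0) x ≠ ∞ := fun k x =>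
    ne_top_of_le_ne_top (by finiteness) (iterate_semi_ind_zero_le (N := N) (φ := φ) k x)
  set H : ℕ → ℝ := fun n => (avoid N φ n 0).toReal with hH
  set GE : ℕ → ℝ≥0∞ := fun n => ∑' x, π x * avoid N φ n x with hGE
  have hGE1 : ∀ n, GE n ≤ 1 := fun n => by
    rw [← π.tsum_coe]
    exact ENNReal.tsum_le_tsum fun x => mul_le_of_le_one_right' (avoid_le_one N φ n x)
  have hGEt : ∀ n, GE n ≠ ∞ := fun n => ne_top_of_le_ne_top ENNReal.one_ne_top (hGE1 n)
  set G : ℕ → ℝ := fun n => (GE n).toReal with hG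
  -- the last visit before time `n`, from the empty state and under the invariant measure
  have hren0 : ∀ n, H n + ∑ k ∈ Finset.range n, u (k + 1) * H (n - 1 - k) = 1 := by
    intro n
    have h := congrArg ENNReal.toReal (last_visit N φ n 0)
    rw [ENNReal.toReal_add (hav _ _) (ENNReal.sum_ne_top.2 fun k _ =>
      ENNReal.mul_ne_top (hit _ _) (hav _ _)), ENNReal.toReal_sum fun k _ =>
      ENNReal.mul_ne_top (hit _ _) (hav _ _)] at h
    simp only [ENNReal.toReal_mul, ENNReal.toReal_one] at h
    exact h
  have hrenπ : ∀ n, G n + ∑ k ∈ Finset.range n, p * H (n - 1 - k) = 1 := by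
    intro n
    have h1 : ∀ k, ∑' x, π x * (semi N φ 1)^[k] (ind 0) x = π 0 := by
      intro k
      rw [iterate_semi_one, hπ.tsum_semi hφ k.cast_nonneg, tsum_eq_single 0 fun x hx => by
        simp [ind, hx]]
      simp [ind]
    have h2 : GE n + ∑ k ∈ Finset.range n, π 0 * avoid N φ (n - 1 - k) 0 = 1 := by
      rw [← π.tsum_coe]
      have h3 : ∀ k, π 0 * avoid N φ (n - 1 - k) 0 =
          ∑' x, π x * ((semi N φ 1)^[k + 1] (ind 0) x * avoid N φ (n - 1 - k) 0) := by
        intro k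
        rw [← h1 (k + 1), ← ENNReal.tsum_mul_right]
        exact tsum_congr fun x => mul_assoc _ _ _
      simp only [h3, hGE]
      rw [← Summable.tsum_finsetSum fun _ _ => ENNReal.summable, ← ENNReal.tsum_add]
      refine tsum_congr fun x => ?_
      rw [← Finset.mul_sum, ← mul_add, last_visit, mul_one]
    have h := congrArg ENNReal.toReal h2
    rw [ENNReal.toReal_add (hGEt n) (ENNReal.sum_ne_top.2 fun k _ =>
      ENNReal.mul_ne_top (hπt _) (hav _ _)), ENNReal.toReal_sum fun k _ =>
      ENNReal.mul_ne_top (hπt _) (hav _ _)] at h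
    simpa [ENNReal.toReal_mul] using h
  have hH0 : ∀ n, 0 ≤ H n := fun n => ENNReal.toReal_nonneg
  have hG0 : ∀ n, 0 ≤ G n := fun n => ENNReal.toReal_nonneg
  have hGH : ∀ n, G n = G (n + 1) + p * H n := by
    intro n
    have h1 := hrenπ n
    have h2 := hrenπ (n + 1)
    rw [Finset.sum_range_succ'] at h2
    have h3 : ∑ k ∈ Finset.range n, p * H (n + 1 - 1 - (k + 1)) =
        ∑ k ∈ Finset.range n, p * H (n - 1 - k) :=
      Finset.sum_congr rfl fun k _ => by rw [show n + 1 - 1 - (k + 1) = n - 1 - k by omega]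
    rw [h3] at h2
    simp only [Nat.add_sub_cancel, Nat.sub_zero] at h2
    linarith
  -- exponential convergence
  set ρ : ℝ := Real.exp (-θ) with hρ
  have hρ0 : 0 < ρ := Real.exp_pos _
  have hρ1 : ρ < 1 := by rw [hρ, Real.exp_lt_one_iff]; linarith
  obtain ⟨C, hC1, hC⟩ : ∃ C : ℝ, 1 ≤ C ∧ ∀ k : ℕ, |u k - p| ≤ C * ρ ^ k := by
    have hc := hconv.comp tendsto_natCast_atTop_atTop
    obtain ⟨C, hC⟩ := hc.bddAbove_range
    refine ⟨max C 1, le_max_right _ _, fun k => ?_⟩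
    have h1 : Real.exp (θ * k) * |(trans N φ k 0 0).toReal - (π 0).toReal| ≤ C :=
      hC ⟨k, rfl⟩
    rw [hut, hp, hρ, ← Real.exp_nat_mul, mul_neg, Real.exp_neg, ← div_eq_mul_inv,
      le_div_iff₀ (Real.exp_pos _), mul_comm, mul_comm (k : ℝ)]
    exact h1.trans (le_max_left _ _)
  set W : ℕ → ℝ := fun n => ∑ k ∈ Finset.range (n + 1), ρ ^ k * H (n - k) with hW
  have hWs : ∀ n, W (n + 1) = H (n + 1) + ρ * W n := by
    intro n
    simp only [hW]
    rw [Finset.sum_range_succ', Finset.mul_sum, add_comm]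
    congr 1
    · simp
    · refine Finset.sum_congr rfl fun k _ => ?_
      rw [show n + 1 - (k + 1) = n - k by omega, pow_succ]; ring
  have hGW : ∀ n, G n ≤ C * W n := by
    intro n
    have h1 : G n = H n + ∑ k ∈ Finset.range n, (u (k + 1) - p) * H (n - 1 - k) := by
      simp only [sub_mul, Finset.sum_sub_distrib]
      linarith [hren0 n, hrenπ n]
    rw [h1]
    simp only [hW]
    rw [Finset.sum_range_succ', mul_add, add_comm]
    refine add_le_add ?_ ?_
    · rw [Finset.mul_sum]
      refine Finset.sum_le_sum fun k _ => ?_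
      rw [show n - (k + 1) = n - 1 - k by omega, ← mul_assoc]
      exact mul_le_mul_of_nonneg_right ((le_abs_self _).trans (hC (k + 1))) (hH0 _)
    · simpa using le_mul_of_one_le_left (hH0 n) hC1
  obtain ⟨r, K, hr0, hr1, hK, hGr⟩ := geometric_decay_of_renewal hp0 hρ0.le hρ1 (by linarith) hH0
    hG0 hGH (by simp [hW]) hWs hGW
  -- the tail of the invariant measure
  obtain ⟨M, hM0, hM⟩ := exists_half_le_avoid N φ
  obtain ⟨s, hs1, hsr⟩ : ∃ s : ℝ, 1 < s ∧ s * r < 1 := by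
    refine ⟨(1 + 1 / r) / 2, ?_, ?_⟩
    · have : 1 < 1 / r := by rw [lt_div_iff₀ hr0]; linarith
      linarith
    · field_simp; linarith
  have hs0 : 0 < s := by linarith
  have hfin : ∑' n : ℕ, ENNReal.ofReal (s ^ n) * GE n < ∞ := by
    have h1 : ∀ n : ℕ, ENNReal.ofReal (s ^ n) * GE n ≤ ENNReal.ofReal (K * (s * r) ^ n) := by
      intro n
      rw [← ENNReal.ofReal_toReal (hGEt n), ← ENNReal.ofReal_mul (by positivity)]
      refine ENNReal.ofReal_le_ofReal ?_
      calc s ^ n * (GE n).toReal ≤ s ^ n * (K * r ^ n) :=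
            mul_le_mul_of_nonneg_left (hGr n) (by positivity)
        _ = _ := by rw [mul_pow]; ring
    refine (ENNReal.tsum_le_tsum h1).trans_lt ?_
    have hsum : Summable fun n : ℕ => K * (s * r) ^ n :=
      (summable_geometric_of_lt_one (by positivity) hsr).mul_left K
    rw [← ENNReal.ofReal_tsum_of_nonneg (fun n => by positivity) hsum]
    exact ENNReal.ofReal_lt_top
  have hMpos : (0 : ℝ) < M := by exact_mod_cast hM0
  refine ⟨Real.log s / M, div_pos (Real.log_pos hs1) hMpos, ?_⟩
  have hx : ∀ x : State, ENNReal.ofReal (Real.exp (Real.log s / M * norm1 x)) ≤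
      ENNReal.ofReal (s ^ 2) * 2 *
        (ENNReal.ofReal (s ^ ((norm1 x - 1) / M)) * avoid N φ ((norm1 x - 1) / M) x) := by
    intro x
    set n := (norm1 x - 1) / M with hn
    have h1 : 1 / 2 ≤ avoid N φ n x := by
      by_cases h0 : n = 0
      · rw [h0]; simp [avoid]
      · refine hM n x ?_
        have h2 : M * n ≤ norm1 x - 1 := by rw [mul_comm]; exact Nat.div_mul_le_self _ _
        have h3 : 0 < M * n := Nat.mul_pos hM0 (Nat.pos_of_ne_zero h0)
        omega
    have h2 : norm1 x ≤ M * (n + 2) := by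
      have := Nat.lt_mul_div_succ (norm1 x - 1) hM0
      rw [← hn] at this
      have h4 : M * (n + 2) = M * (n + 1) + M := by ring
      omega
    have h3 : Real.exp (Real.log s / M * norm1 x) ≤ s ^ (n + 2) := by
      rw [← Real.exp_log (pow_pos hs0 _), Real.log_pow, Real.exp_le_exp]
      have h4 : (norm1 x : ℝ) ≤ M * ((n + 2 : ℕ) : ℝ) := by exact_mod_cast h2
      calc Real.log s / M * norm1 x ≤ Real.log s / M * (M * ((n + 2 : ℕ) : ℝ)) :=
            mul_le_mul_of_nonneg_left h4 (div_nonneg (Real.log_pos hs1).le hMpos.le)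
        _ = _ := by field_simp
    calc _ ≤ ENNReal.ofReal (s ^ (n + 2)) := ENNReal.ofReal_le_ofReal h3
      _ = ENNReal.ofReal (s ^ 2) * ENNReal.ofReal (s ^ n) * (2 * (1 / 2)) := by
          rw [← ENNReal.ofReal_mul (by positivity), ← pow_add, add_comm 2 n, one_div,
            ENNReal.mul_inv_cancel two_ne_zero ENNReal.ofNat_ne_top, mul_one]
      _ ≤ ENNReal.ofReal (s ^ 2) * ENNReal.ofReal (s ^ n) * (2 * avoid N φ n x) := by gcongr
      _ = _ := by ring
  calc ∑' x, π x * ENNReal.ofReal (Real.exp (Real.log s / M * norm1 x))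
      ≤ ∑' x, ENNReal.ofReal (s ^ 2) * 2 *
          ∑' n, ENNReal.ofReal (s ^ n) * (π x * avoid N φ n x) := by
        refine ENNReal.tsum_le_tsum fun x => ?_
        calc _ ≤ π x * (ENNReal.ofReal (s ^ 2) * 2 * (ENNReal.ofReal (s ^ ((norm1 x - 1) / M)) *
              avoid N φ ((norm1 x - 1) / M) x)) := mul_le_mul_right (hx x) _
          _ = ENNReal.ofReal (s ^ 2) * 2 * (ENNReal.ofReal (s ^ ((norm1 x - 1) / M)) *
              (π x * avoid N φ ((norm1 x - 1) / M) x)) := by ring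
          _ ≤ _ := mul_le_mul_right (ENNReal.le_tsum ((norm1 x - 1) / M)) _
    _ = ENNReal.ofReal (s ^ 2) * 2 * ∑' n, ENNReal.ofReal (s ^ n) * GE n := by
        rw [ENNReal.tsum_mul_left, ENNReal.tsum_comm]
        simp only [hGE, ENNReal.tsum_mul_left]
    _ < ∞ := ENNReal.mul_lt_top (by finiteness) hfin

end

/-! ### The policy -/

/-- The rates satisfy `mu = lam + 1`. As a consequence, while server 1 holds back the jobs of
buffer 1, the process `q₁ + lam * q₄` has drift zero and `q₁ + mu * q₄` has drift `-1`. Moreover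
`log lam ≥ 8`, where `8` is the exponent in the policy. -/
def params : Params where
  lam := 6561
  mu := 6562
  lam_pos := by norm_num
  mu_pos := by norm_num

/-- The probability that server 1 drains buffer 1 (by symmetry: that server 2 drains buffer 3) if
`own` is the fact that the event was an arrival to this buffer, `block` that it was a service
completion at the buffer downstream, and `n, n', m` are the contents of this buffer, of the buffer
downstream, and of the other buffer of the server. The server drains its buffer unless the buffer
downstream is empty and it has other work. In that case it begins to hold jobs back with the small
probability `m⁻⁸`, and goes on doing so until its other work is finished. -/
def holdProb (own block : Prop) [Decidable own] [Decidable block] (n n' m : ℕ) : ℝ :=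
  if ¬ block ∧ n' = 0 ∧ 0 < m then (if own ∧ n = 1 then 1 - ((m : ℝ) ^ 8)⁻¹ else 0) else 1

lemma inv_pow_le_one (m : ℕ) : ((m : ℝ) ^ 8)⁻¹ ≤ 1 := by
  rcases m.eq_zero_or_pos with rfl | h
  · simp
  · exact inv_le_one_of_one_le₀ (one_le_pow₀ (by exact_mod_cast h))

lemma holdProb_mem (own block : Prop) [Decidable own] [Decidable block] (n n' m : ℕ) :
    0 ≤ holdProb own block n n' m ∧ holdProb own block n n' m ≤ 1 := by
  have h1 := inv_pow_le_one m
  have h2 : 0 ≤ ((m : ℝ) ^ 8)⁻¹ := by positivity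
  unfold holdProb
  split_ifs <;> constructor <;> linarith

/-- The policy for which the invariant measure has a heavy tail although the fluid limit model is
stable. -/
def policy : Policy where
  drainProb
    | .s1, e, y => holdProb (e = .b1) (e = .b2) (y .b1) (y .b2) (y .b4)
    | .s2, e, y => holdProb (e = .b3) (e = .b4) (y .b3) (y .b4) (y .b2)
  nonneg s e y := by cases s <;> exact (holdProb_mem _ _ _ _ _).1
  le_one s e y := by cases s <;> exact (holdProb_mem _ _ _ _ _).2

lemma policy_nonIdling : policy.NonIdling := by
  constructor <;> intro e y _ h <;> simp [policy, holdProb, h]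

/-- The state with queue lengths `a, b, c, d`. -/
def st (a b c d : ℕ) : State
  | .b1 => a
  | .b2 => b
  | .b3 => c
  | .b4 => d

lemma eq_st (x : State) : x = st (x .b1) (x .b2) (x .b3) (x .b4) := by
  funext i; cases i <;> rfl

lemma st_zero : st 0 0 0 0 = 0 := by
  funext i; cases i <;> rfl

lemma norm1_st (a b c d : ℕ) : norm1 (st a b c d) = a + b + c + d := norm1_eq _

lemma jump_b1 (a b c d : ℕ) : jump .b1 (st a b c d) = st (a + 1) b c d := by
  funext i; cases i <;> rfl
lemma jump_b2 (a b c d : ℕ) : jump .b2 (st a b c d) = st a (b - 1) c d := by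
  funext i; cases i <;> rfl
lemma jump_b3 (a b c d : ℕ) : jump .b3 (st a b c d) = st a b (c + 1) d := by
  funext i; cases i <;> rfl
lemma jump_b4 (a b c d : ℕ) : jump .b4 (st a b c d) = st a b c (d - 1) := by
  funext i; cases i <;> rfl

lemma drain_st (d1 d3 : Prop) [Decidable d1] [Decidable d3] (a b c d : ℕ) :
    drain d1 d3 (st a b c d) = st (if d1 then 0 else a) (if d1 then b + a else b)
      (if d3 then 0 else c) (if d3 then d + c else d) := by
  funext i; cases i <;> rfl

/-- The state of the network with the roles of the two servers exchanged. -/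
def mirror (x : State) : State := st (x .b3) (x .b4) (x .b1) (x .b2)

lemma mirror_st (a b c d : ℕ) : mirror (st a b c d) = st c d a b := rfl

/-- The probability that a given arrival clock rings first. -/
def wA : ℝ≥0∞ := ENNReal.ofReal (6561 / 26246)

/-- The probability that a given service clock rings first. -/
def wB : ℝ≥0∞ := ENNReal.ofReal (6562 / 26246)

lemma unifRate_params : unifRate params = 26246 := by
  rw [unifRate_eq]; norm_num [params]

lemma T_eq (φ : Policy) (f : State → ℝ≥0∞) (a b c d : ℕ) :
    T params φ f (st a b c d) = wA * evAvg φ .b1 (st a b c d) f + wA * evAvg φ .b3 (st a b c d) f +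
      wB * (if 0 < b then evAvg φ .b2 (st a b c d) f else f (st a b c d)) +
      wB * (if 0 < d then evAvg φ .b4 (st a b c d) f else f (st a b c d)) := by
  classical
  have : (Finset.univ : Finset Buffer) = {.b1, .b2, .b3, .b4} := rfl
  rw [T, this, Finset.sum_insert (by decide), Finset.sum_insert (by decide),
    Finset.sum_insert (by decide), Finset.sum_singleton, unifRate_params]
  rw [if_pos (show Running (st a b c d) .b1 from trivial),
    if_pos (show Running (st a b c d) .b3 from trivial)]
  have h2 : ∀ u v : ℝ≥0∞, (if Running (st a b c d) .b2 then u else v) = if 0 < b then u else v :=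
    fun u v => if_congr Iff.rfl rfl rfl
  have h4 : ∀ u v : ℝ≥0∞, (if Running (st a b c d) .b4 then u else v) = if 0 < d then u else v :=
    fun u v => if_congr Iff.rfl rfl rfl
  rw [h2, h4]
  simp only [params, Params.rate, wA, wB]
  ring

/-- Server 1 is holding back `k > 0` jobs. -/
lemma T_hold (f : State → ℝ≥0∞) (k m : ℕ) :
    T params policy f (st (k + 1) 0 0 (m + 1)) = wA * f (st (k + 2) 0 0 (m + 1)) +
      wA * f (st (k + 1) 0 0 (m + 2)) + wB * f (st (k + 1) 0 0 (m + 1)) +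
      wB * f (if m = 0 then st 0 (k + 1) 0 0 else st (k + 1) 0 0 m) := by
  rw [T_eq]
  simp only [evAvg, jump_b1, jump_b3, jump_b4, drain_st, Fintype.sum_bool, decWeight, policy, st,
    holdProb]
  rcases m.eq_zero_or_pos with rfl | h
  · simp
  · simp [h, h.ne']

lemma T_single (f : State → ℝ≥0∞) (m : ℕ) :
    T params policy f (st 0 0 0 (m + 1)) =
      wA * (ENNReal.ofReal (1 - (((m + 1 : ℕ) : ℝ) ^ 8)⁻¹) * f (st 0 1 0 (m + 1)) +
        ENNReal.ofReal ((((m + 1 : ℕ) : ℝ) ^ 8)⁻¹) * f (st 1 0 0 (m + 1))) +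
      wA * f (st 0 0 0 (m + 2)) + wB * f (st 0 0 0 (m + 1)) + wB * f (st 0 0 0 m) := by
  rw [T_eq]
  simp only [evAvg, jump_b1, jump_b3, jump_b4, drain_st, Fintype.sum_bool, decWeight, policy, st,
    holdProb]
  rcases m.eq_zero_or_pos with rfl | h
  · simp
  · simp [h, h.ne']

lemma T_zero (f : State → ℝ≥0∞) : T params policy f 0 =
    wA * f (st 0 1 0 0) + wA * f (st 0 0 0 1) + wB * f 0 + wB * f 0 := by
  rw [← st_zero, T_eq]
  simp [evAvg, jump_b1, jump_b3, drain_st, decWeight, policy, st, holdProb]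

lemma T_both (f : State → ℝ≥0∞) (a b c d : ℕ) :
    T params policy f (st a (b + 1) c (d + 1)) =
      wA * f (st 0 (a + b + 2) 0 (c + d + 1)) + wA * f (st 0 (a + b + 1) 0 (c + d + 2)) +
      wB * f (st 0 (a + b) 0 (c + d + 1)) + wB * f (st 0 (a + b + 1) 0 (c + d)) := by
  rw [T_eq]
  simp only [evAvg, jump_b1, jump_b2, jump_b3, jump_b4, drain_st, Fintype.sum_bool, decWeight,
    policy, st, holdProb]
  have e1 : b + 1 + (a + 1) = a + b + 2 := by ring
  have e2 : d + 1 + (c + 1) = c + d + 2 := by ring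
  have e3 : d + 1 + c = c + d + 1 := by ring
  have e4 : b + 1 + a = a + b + 1 := by ring
  simp [e1, e2, e3, e4, add_comm b a, add_comm d c]

/-- The buffer with the same role at the other server. -/
def mirrorBuffer : Buffer → Buffer
  | .b1 => .b3
  | .b2 => .b4
  | .b3 => .b1
  | .b4 => .b2

lemma jump_mirror (e : Buffer) (x : State) :
    jump (mirrorBuffer e) (mirror x) = mirror (jump e x) := by
  rw [eq_st x]
  cases e <;> simp only [mirrorBuffer, mirror_st, jump_b1, jump_b2, jump_b3, jump_b4]

lemma drain_mirror (d1 d3 : Prop) [Decidable d1] [Decidable d3] (x : State) :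
    drain d1 d3 (mirror x) = mirror (drain d3 d1 x) := by
  rw [eq_st x, mirror_st, drain_st, drain_st, mirror_st]

lemma evAvg_mirror (f : State → ℝ≥0∞) (e : Buffer) (x : State) :
    evAvg policy (mirrorBuffer e) (mirror x) f = evAvg policy e x fun z => f (mirror z) := by
  have h1 : policy.drainProb .s1 (mirrorBuffer e) (mirror (jump e x)) =
      policy.drainProb .s2 e (jump e x) := by
    cases e <;> simp [policy, mirrorBuffer, mirror, st]
  have h2 : policy.drainProb .s2 (mirrorBuffer e) (mirror (jump e x)) =
      policy.drainProb .s1 e (jump e x) := by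
    cases e <;> simp [policy, mirrorBuffer, mirror, st]
  simp only [evAvg, jump_mirror, h1, h2, drain_mirror]
  rw [Finset.sum_comm]
  exact Finset.sum_congr rfl fun _ _ => Finset.sum_congr rfl fun _ _ => by
    rw [mul_comm (decWeight _ _) (decWeight _ _)]

lemma T_mirror (f : State → ℝ≥0∞) (x : State) :
    T params policy f (mirror x) = T params policy (fun z => f (mirror z)) x := by
  have h1 := evAvg_mirror f .b1 x
  have h2 := evAvg_mirror f .b2 x
  have h3 := evAvg_mirror f .b3 x
  have h4 := evAvg_mirror f .b4 x
  rw [eq_st x] at h1 h2 h3 h4 ⊢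
  rw [T_eq, mirror_st, T_eq, ← h1, ← h2, ← h3, ← h4]
  simp only [mirrorBuffer, mirror_st]
  ring

lemma mirror_mirror (x : State) : mirror (mirror x) = x := (eq_st x).symm

/-- Up to the symmetry of the network, a settled state is empty, or has jobs in buffer 4 only, or
jobs held back in buffer 1 while buffers 2 and 3 are empty, or jobs in both buffers 2 and 4. -/
lemma settled_cases {P : State → Prop} (hmirror : ∀ x, P (mirror x) → P x) (hzero : P 0)
    (hsingle : ∀ m, P (st 0 0 0 (m + 1))) (hhold : ∀ k m, P (st (k + 1) 0 0 (m + 1)))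
    (hboth : ∀ a b c d, P (st a (b + 1) c (d + 1))) {x : State} (hx : Settled x) : P x := by
  obtain ⟨h1, h2⟩ := hx
  have key : ∀ a m, P (st a 0 0 (m + 1)) := fun a m => by
    cases a
    exacts [hsingle m, hhold _ m]
  rw [eq_st x]
  rcases hb : x .b2 with _ | b <;> rcases hd : x .b4 with _ | d
  · rw [h1 hd, h2 hb]; rwa [st_zero]
  · rw [h2 hb]; exact key _ _
  · rw [h1 hd]; exact hmirror _ (by rw [mirror_st]; exact key _ _)
  · exact hboth _ _ _ _

/-! ### A polynomial Lyapunov function -/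

/-- The eighth power of the positive part. -/
def pospow (z : ℝ) : ℝ := max z 0 ^ 8

lemma pospow_nonneg (z : ℝ) : 0 ≤ pospow z := by unfold pospow; positivity

lemma pospow_mono : Monotone pospow := fun _ _ h =>
  pow_le_pow_left₀ (le_max_right _ _) (max_le_max_right 0 h) 8

lemma pospow_of_nonpos {z : ℝ} (h : z ≤ 0) : pospow z = 0 := by
  rw [pospow, max_eq_right h]; norm_num

lemma pospow_of_nonneg {z : ℝ} (h : 0 ≤ z) : pospow z = z ^ 8 := by rw [pospow, max_eq_left h]

/-- Lower powers are dominated by a small multiple of a higher one. -/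
lemma exists_pow_six_le {K ε : ℝ} (hK : 0 ≤ K) (hε : 0 < ε) :
    ∃ b : ℝ, 0 ≤ b ∧ ∀ z : ℝ, 0 ≤ z → K * (1 + z) ^ 6 ≤ ε * z ^ 7 + b := by
  refine ⟨K * (2 + 64 * K / ε) ^ 6, by positivity, fun z hz => ?_⟩
  rcases le_total z (1 + 64 * K / ε) with h | h
  · have : K * (1 + z) ^ 6 ≤ K * (2 + 64 * K / ε) ^ 6 := by
      refine mul_le_mul_of_nonneg_left (pow_le_pow_left₀ (by positivity) (by linarith) 6) hK
    have h2 : 0 ≤ ε * z ^ 7 := by positivity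
    linarith
  · have h0 : 0 ≤ 64 * K / ε := by positivity
    have h1 : (1 + z) ^ 6 ≤ 64 * z ^ 6 := by
      calc (1 + z) ^ 6 ≤ (2 * z) ^ 6 := pow_le_pow_left₀ (by positivity) (by linarith) 6
        _ = _ := by ring
    have h2 : 64 * K ≤ ε * z := by
      have : 64 * K / ε ≤ z := by linarith
      rw [div_le_iff₀ hε] at this
      linarith
    have h3 : 0 ≤ K * (2 + 64 * K / ε) ^ 6 := by positivity
    calc K * (1 + z) ^ 6 ≤ K * (64 * z ^ 6) := mul_le_mul_of_nonneg_left h1 hK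
      _ = 64 * K * z ^ 6 := by ring
      _ ≤ ε * z * z ^ 6 := mul_le_mul_of_nonneg_right h2 (by positivity)
      _ = ε * z ^ 7 := by ring
      _ ≤ ε * z ^ 7 + K * (2 + 64 * K / ε) ^ 6 := le_add_of_nonneg_right h3

lemma add_pow_eight_le {M z X : ℝ} (hM : 1 ≤ M) (hz : 0 ≤ z) (hX : |X| ≤ M) :
    (z + X) ^ 8 ≤ z ^ 8 + 8 * z ^ 7 * X + 256 * M ^ 8 * (1 + z) ^ 6 := by
  have hp : ∀ i j : ℕ, i ≤ 6 → j ≤ 8 → z ^ i * X ^ j ≤ M ^ 8 * (1 + z) ^ 6 := by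
    intro i j hi hj
    have h1 : X ^ j ≤ M ^ 8 := (le_abs_self _).trans (by
      rw [abs_pow]
      exact (pow_le_pow_left₀ (abs_nonneg X) hX j).trans (pow_le_pow_right₀ hM hj))
    have h2 : z ^ i ≤ (1 + z) ^ 6 :=
      (pow_le_pow_left₀ hz (by linarith) i).trans (pow_le_pow_right₀ (by linarith) hi)
    calc z ^ i * X ^ j ≤ z ^ i * M ^ 8 := mul_le_mul_of_nonneg_left h1 (by positivity)
      _ ≤ (1 + z) ^ 6 * M ^ 8 := mul_le_mul_of_nonneg_right h2 (by positivity)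
      _ = _ := mul_comm _ _
  have h2 := hp 6 2 (by norm_num) (by norm_num)
  have h3 := hp 5 3 (by norm_num) (by norm_num)
  have h4 := hp 4 4 (by norm_num) (by norm_num)
  have h5 := hp 3 5 (by norm_num) (by norm_num)
  have h6 := hp 2 6 (by norm_num) (by norm_num)
  have h7 := hp 1 7 (by norm_num) (by norm_num)
  have h8 := hp 0 8 (by norm_num) (by norm_num)
  have h0 : 0 ≤ M ^ 8 * (1 + z) ^ 6 := by positivity
  have e : (z + X) ^ 8 = z ^ 8 + 8 * z ^ 7 * X + (28 * (z ^ 6 * X ^ 2) + 56 * (z ^ 5 * X ^ 3) +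
    70 * (z ^ 4 * X ^ 4) + 56 * (z ^ 3 * X ^ 5) + 28 * (z ^ 2 * X ^ 6) + 8 * (z ^ 1 * X ^ 7) +
    z ^ 0 * X ^ 8) := by ring
  rw [e]
  linarith

/-- The lower order terms of the increment of the eighth power are absorbed by a shift. -/
lemma exists_pospow_add_le {M δ : ℝ} (hM : 1 ≤ M) (hδ : 0 < δ) : ∃ b : ℝ, 0 ≤ b ∧ ∀ z X : ℝ,
    |X| ≤ M → pospow (z + X) ≤ pospow (z - δ) + 8 * max z 0 ^ 7 * (X + 2 * δ) + b := by
  obtain ⟨b, hb, h⟩ := exists_pow_six_le (K := 256 * M ^ 8) (ε := 8 * δ) (by positivity)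
    (by positivity)
  refine ⟨b + M ^ 8, by positivity, fun z X hX => ?_⟩
  have hM8 : 0 ≤ M ^ 8 := by positivity
  rcases le_total z 0 with hz | hz
  · have h1 : pospow (z + X) ≤ M ^ 8 :=
      pow_le_pow_left₀ (le_max_right _ _) (max_le (by linarith [le_abs_self X]) (by linarith)) 8
    rw [max_eq_right hz]
    have h2 := pospow_nonneg (z - δ)
    norm_num
    linarith
  · rw [max_eq_left hz]
    have h1 : pospow (z + X) ≤ (z + X) ^ 8 := by
      unfold pospow
      rcases le_total (z + X) 0 with h3 | h3
      · rw [max_eq_right h3, zero_pow (by norm_num)]; positivity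
      · rw [max_eq_left h3]
    have h2 : z ^ 8 - 8 * δ * z ^ 7 ≤ pospow (z - δ) := by
      rcases le_total (z - δ) 0 with h3 | h3
      · rw [pospow_of_nonpos h3]
        have : z ^ 8 ≤ δ * z ^ 7 := by
          rw [show z ^ 8 = z * z ^ 7 by ring]
          exact mul_le_mul_of_nonneg_right (by linarith) (by positivity)
        nlinarith [show 0 ≤ δ * z ^ 7 by positivity]
      · rw [pospow_of_nonneg h3]
        rcases hz.eq_or_lt with rfl | hz'
        · linarith
        have h4 := one_add_mul_le_pow (a := -(δ / z)) (by
          have : δ / z ≤ 1 := (div_le_one hz').2 (by linarith)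
          linarith) 8
        have h5 : (z - δ) ^ 8 = z ^ 8 * (1 + -(δ / z)) ^ 8 := by
          rw [← mul_pow]; congr 1; field_simp; ring
        rw [h5]
        refine le_trans (le_of_eq ?_) (mul_le_mul_of_nonneg_left h4 (by positivity))
        field_simp; push_cast; ring
    have h3 := add_pow_eight_le hM hz hX
    have h4 := h z hz
    linarith

/-- The Lyapunov function with offset `a`, the eighth power of a linear function in each regime:
while jobs are held back in buffer 1, `6562 * q₄ + q₁` has negative drift, otherwise both `q₁ + q₂`
and `q₃ + q₄` have. -/
def lyap (a : ℝ) (x : State) : ℝ :=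
  if x .b2 = 0 ∧ x .b3 = 0 ∧ 0 < x .b4 ∧ 0 < x .b1 then pospow (6562 * x .b4 + x .b1 - a)
  else if x .b4 = 0 ∧ x .b1 = 0 ∧ 0 < x .b2 ∧ 0 < x .b3 then pospow (6562 * x .b2 + x .b3 - a)
  else pospow (x .b1 + x .b2 - a) + pospow (x .b3 + x .b4 - a)

lemma lyap_nonneg (a : ℝ) (x : State) : 0 ≤ lyap a x := by
  unfold lyap
  split_ifs
  exacts [pospow_nonneg _, pospow_nonneg _, add_nonneg (pospow_nonneg _) (pospow_nonneg _)]

lemma lyap_st (a : ℝ) (p q r s : ℕ) : lyap a (st p q r s) =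
    if q = 0 ∧ r = 0 ∧ 0 < s ∧ 0 < p then pospow (6562 * s + p - a)
    else if s = 0 ∧ p = 0 ∧ 0 < q ∧ 0 < r then pospow (6562 * q + r - a)
    else pospow (p + q - a) + pospow (r + s - a) := rfl

lemma lyap_mirror (a : ℝ) (x : State) : lyap a (mirror x) = lyap a x := by
  rw [eq_st x, mirror_st, lyap_st, lyap_st]
  split_ifs
  all_goals first | rfl | exact add_comm _ _ | (exfalso; omega)

lemma lyap_hold (a : ℝ) (k m : ℕ) :
    lyap a (st (k + 1) 0 0 (m + 1)) =
      pospow (6562 * (m + 1 : ℕ) + (k + 1 : ℕ) - a) := by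
  simp [lyap, st]

lemma lyap_drained (a : ℝ) (b d : ℕ) : lyap a (st 0 b 0 d) = pospow (b - a) + pospow (d - a) := by
  simp [lyap, st]

lemma lyap_both (a : ℝ) (p q r s : ℕ) : lyap a (st p (q + 1) r (s + 1)) =
    pospow (p + (q + 1 : ℕ) - a) + pospow (r + (s + 1 : ℕ) - a) := by
  simp [lyap, st]

/-- The average over the four clocks. -/
lemma ofReal_avg {u₁ u₂ u₃ u₄ : ℝ} (h₁ : 0 ≤ u₁) (h₂ : 0 ≤ u₂) (h₃ : 0 ≤ u₃) (h₄ : 0 ≤ u₄) :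
    wA * ENNReal.ofReal u₁ + wA * ENNReal.ofReal u₂ + wB * ENNReal.ofReal u₃ +
      wB * ENNReal.ofReal u₄ = ENNReal.ofReal (6561 / 26246 * u₁ + 6561 / 26246 * u₂ +
        6562 / 26246 * u₃ + 6562 / 26246 * u₄) := by
  rw [ENNReal.ofReal_add (by positivity) (by positivity),
    ENNReal.ofReal_add (by positivity) (by positivity),
    ENNReal.ofReal_add (by positivity) (by positivity), ENNReal.ofReal_mul (by norm_num),
    ENNReal.ofReal_mul (by norm_num), ENNReal.ofReal_mul (by norm_num),
    ENNReal.ofReal_mul (by norm_num)]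
  rfl

lemma walk_drift {b z : ℝ} (h : ∀ X : ℝ, |X| ≤ 6562 → pospow (z + X) ≤ pospow (z - 1 / 52492) +
      8 * max z 0 ^ 7 * (X + 2 * (1 / 52492)) + b) :
    6561 / 26246 * pospow (z + 1) + 6561 / 26246 * pospow z + 6562 / 26246 * pospow z +
      6562 / 26246 * pospow (z - 1) ≤ pospow (z - 1 / 52492) + b := by
  have h1 := h 1 (by norm_num)
  have h2 := h 0 (by norm_num)
  have h3 := h (-1) (by norm_num)
  rw [add_zero] at h2
  rw [← sub_eq_add_neg] at h3
  linarith

lemma hold_drift {b z : ℝ} (h : ∀ X : ℝ, |X| ≤ 6562 → pospow (z + X) ≤ pospow (z - 1 / 52492) +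
      8 * max z 0 ^ 7 * (X + 2 * (1 / 52492)) + b) :
    6561 / 26246 * pospow (z + 1) + 6561 / 26246 * pospow (z + 6562) + 6562 / 26246 * pospow z +
      6562 / 26246 * pospow (z - 6562) ≤ pospow (z - 1 / 52492) + b := by
  have h1 := h 1 (by norm_num)
  have h2 := h 0 (by norm_num)
  have h3 := h (-6562) (by norm_num)
  have h4 := h 6562 (by norm_num)
  rw [add_zero] at h2
  rw [← sub_eq_add_neg] at h3
  linarith

/-- In one step of the chain the Lyapunov function is shifted by a constant, in the mean and up to
a bounded error. When server 1 begins to hold jobs back the function jumps from the order `q₄ ^ 8`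
to at most `(6563 * q₄) ^ 8`, but this has only probability `q₄ ^ (-8)`. -/
lemma exists_T_lyap_le : ∃ b : ℝ, 0 ≤ b ∧ ∀ a : ℝ, 0 ≤ a → ∀ x, Settled x →
    T params policy (fun z => ENNReal.ofReal (lyap a z)) x ≤
      ENNReal.ofReal (lyap (a + 1 / 52492) x) + ENNReal.ofReal b := by
  obtain ⟨b, hb, h⟩ := exists_pospow_add_le (M := 6562) (δ := 1 / 52492) (by norm_num)
    (by norm_num)
  refine ⟨2 * b + 6563 ^ 8 + 2, by positivity, fun a ha x hx => ?_⟩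
  set C : ℝ := 6563 ^ 8 with hC
  have hC0 : 0 ≤ C := by positivity
  have hzero : pospow (0 - a) = 0 := pospow_of_nonpos (by linarith)
  have hzero' : pospow (0 - (a + 1 / 52492)) = 0 := pospow_of_nonpos (by linarith)
  have hone : pospow (1 - a) ≤ 1 := by
    refine (pospow_mono (by linarith : 1 - a ≤ 1)).trans ?_
    rw [pospow_of_nonneg zero_le_one]; norm_num
  have P0 := pospow_nonneg
  have fold : ∀ u y, u ≤ lyap (a + 1 / 52492) y + (2 * b + C + 2) →
      ENNReal.ofReal u ≤ ENNReal.ofReal (lyap (a + 1 / 52492) y) +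
        ENNReal.ofReal (2 * b + C + 2) := fun u y hu => by
    rw [← ENNReal.ofReal_add (lyap_nonneg _ _) (by positivity)]
    exact ENNReal.ofReal_le_ofReal hu
  refine settled_cases (P := fun x => T params policy (fun z => ENNReal.ofReal (lyap a z)) x ≤
    ENNReal.ofReal (lyap (a + 1 / 52492) x) + ENNReal.ofReal (2 * b + C + 2))
    (fun x hx => ?_) ?_ (fun m => ?_) (fun k m => ?_) (fun p q r s => ?_) hx
  · rw [T_mirror] at hx
    simpa only [lyap_mirror] using hx
  · rw [T_zero, ofReal_avg (lyap_nonneg _ _) (lyap_nonneg _ _) (lyap_nonneg _ _)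
      (lyap_nonneg _ _)]
    refine fold _ _ ?_
    rw [← st_zero, lyap_drained, lyap_drained, lyap_drained, lyap_drained]
    push_cast
    rw [hzero, hzero']
    linarith
  · have h1 : ENNReal.ofReal (1 - (((m + 1 : ℕ) : ℝ) ^ 8)⁻¹) *
          ENNReal.ofReal (lyap a (st 0 1 0 (m + 1))) +
        ENNReal.ofReal ((((m + 1 : ℕ) : ℝ) ^ 8)⁻¹) * ENNReal.ofReal (lyap a (st 1 0 0 (m + 1))) ≤
        ENNReal.ofReal (1 + pospow ((m + 1 : ℕ) - a) + C) := by
      have hm : (1 : ℝ) ≤ (m + 1 : ℕ) := by exact_mod_cast Nat.le_add_left 1 m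
      have h2 : (((m + 1 : ℕ) : ℝ) ^ 8)⁻¹ * lyap a (st 1 0 0 (m + 1)) ≤ C := by
        rw [inv_mul_le_iff₀ (by positivity), lyap_hold a 0 m]
        calc _ ≤ pospow (6563 * ((m + 1 : ℕ) : ℝ)) := pospow_mono (by push_cast at hm ⊢; linarith)
          _ = _ := by rw [pospow_of_nonneg (by positivity), mul_pow, mul_comm]
      have h3 : ENNReal.ofReal (1 - (((m + 1 : ℕ) : ℝ) ^ 8)⁻¹) ≤ 1 := by
        rw [← ENNReal.ofReal_one]
        exact ENNReal.ofReal_le_ofReal (by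
          have : 0 ≤ (((m + 1 : ℕ) : ℝ) ^ 8)⁻¹ := by positivity
          linarith)
      rw [← ENNReal.ofReal_mul (p := (((m + 1 : ℕ) : ℝ) ^ 8)⁻¹) (by positivity),
        ENNReal.ofReal_add (by linarith [P0 ((m + 1 : ℕ) - a)]) hC0]
      refine add_le_add ((mul_le_of_le_one_left' h3).trans (ENNReal.ofReal_le_ofReal ?_))
        (ENNReal.ofReal_le_ofReal h2)
      rw [lyap_drained]
      push_cast
      linarith
    rw [T_single]
    refine (add_le_add_left (add_le_add_left (add_le_add_left (mul_le_mul_right h1 wA) _) _)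
      _).trans ?_
    rw [ofReal_avg (by linarith [P0 ((m + 1 : ℕ) - a)]) (lyap_nonneg _ _) (lyap_nonneg _ _)
      (lyap_nonneg _ _)]
    refine fold _ _ ?_
    have h2 := walk_drift (h ((m + 1 : ℕ) - a))
    have e1 : ((m + 1 : ℕ) : ℝ) - a + 1 = (m + 2 : ℕ) - a := by push_cast; ring
    have e2 : ((m + 1 : ℕ) : ℝ) - a - 1 = m - a := by push_cast; ring
    have e3 : ((m + 1 : ℕ) : ℝ) - a - 1 / 52492 = (m + 1 : ℕ) - (a + 1 / 52492) := by ring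
    rw [e1, e2, e3] at h2
    rw [lyap_drained, lyap_drained, lyap_drained, lyap_drained, Nat.cast_zero, hzero, hzero']
    linarith
  · have e : lyap a (if m = 0 then st 0 (k + 1) 0 0 else st (k + 1) 0 0 m) =
        pospow (6562 * (m + 1 : ℕ) + (k + 1 : ℕ) - a - 6562) := by
      rcases m with _ | m
      · rw [if_pos rfl, lyap_drained, Nat.cast_zero, hzero, add_zero]; congr 1; push_cast; ring
      · rw [if_neg (by omega), lyap_hold]; congr 1; push_cast; ring
    rw [T_hold, ofReal_avg (lyap_nonneg _ _) (lyap_nonneg _ _) (lyap_nonneg _ _) (lyap_nonneg _ _)]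
    refine fold _ _ ?_
    have h2 := hold_drift (h (6562 * (m + 1 : ℕ) + (k + 1 : ℕ) - a))
    rw [e, lyap_hold a (k + 1) m, lyap_hold a k (m + 1), lyap_hold, lyap_hold]
    have e1 : 6562 * ((m + 1 : ℕ) : ℝ) + (k + 1 + 1 : ℕ) - a =
      6562 * (m + 1 : ℕ) + (k + 1 : ℕ) - a + 1 := by push_cast; ring
    have e2 : 6562 * ((m + 1 + 1 : ℕ) : ℝ) + (k + 1 : ℕ) - a =
      6562 * (m + 1 : ℕ) + (k + 1 : ℕ) - a + 6562 := by push_cast; ring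
    have e3 : 6562 * ((m + 1 : ℕ) : ℝ) + (k + 1 : ℕ) - (a + 1 / 52492) =
      6562 * (m + 1 : ℕ) + (k + 1 : ℕ) - a - 1 / 52492 := by ring
    rw [e1, e2, e3]
    linarith
  · rw [T_both, ofReal_avg (lyap_nonneg _ _) (lyap_nonneg _ _) (lyap_nonneg _ _) (lyap_nonneg _ _)]
    refine fold _ _ ?_
    have h2 := walk_drift (h (p + (q + 1 : ℕ) - a))
    have h3 := walk_drift (h (r + (s + 1 : ℕ) - a))
    simp only [lyap_drained, lyap_both]
    have e : ∀ p q : ℕ, ((0 : ℕ) : ℝ) + ((p + q + 1 + 1 : ℕ) : ℝ) - a = p + (q + 1 : ℕ) - a + 1 ∧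
        ((0 : ℕ) : ℝ) + ((p + q + 1 : ℕ) : ℝ) - a = p + (q + 1 : ℕ) - a ∧
        ((p + q + 1 : ℕ) : ℝ) - a = p + (q + 1 : ℕ) - a ∧
        ((p + q : ℕ) : ℝ) - a = p + (q + 1 : ℕ) - a - 1 ∧
        (p : ℝ) + (q + 1 : ℕ) - (a + 1 / 52492) = p + (q + 1 : ℕ) - a - 1 / 52492 := by
      intro p q
      refine ⟨?_, ?_, ?_, ?_, ?_⟩ <;> push_cast <;> ring
    obtain ⟨p1, p2, p3, p4, p5⟩ := e p q
    obtain ⟨r1, r2, r3, r4, r5⟩ := e r s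
    rw [p1, p2, p3, p4, p5, r1, r2, r3, r4, r5]
    linarith

/-! ### Consequences of the drift -/

lemma pospow_sub_le (n : ℕ) : pospow (n - 1 / 52492) + 1 / 52492 * n ≤ pospow n := by
  rcases n.eq_zero_or_pos with rfl | h
  · rw [Nat.cast_zero, pospow_of_nonpos (by norm_num)]; simp [pospow]
  · have h1 : (1 : ℝ) ≤ n := by exact_mod_cast h
    rw [pospow_of_nonneg (by linarith), pospow_of_nonneg (by linarith)]
    have h2 : ((n : ℝ) - 1 / 52492) ^ 7 ≤ (n : ℝ) ^ 7 :=
      pow_le_pow_left₀ (by linarith) (by linarith) 7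
    have h3 : (1 : ℝ) ≤ (n : ℝ) ^ 6 := one_le_pow₀ h1
    calc _ ≤ (n : ℝ) ^ 7 * (n - 1 / 52492) + 1 / 52492 * (n * (n : ℝ) ^ 6) := by
          refine add_le_add ?_ (by nlinarith)
          rw [show ((n : ℝ) - 1 / 52492) ^ 8 = ((n : ℝ) - 1 / 52492) ^ 7 * (n - 1 / 52492) by ring]
          exact mul_le_mul_of_nonneg_right h2 (by linarith)
      _ = _ := by ring

lemma lyap_shift_add_le (x : State) :
    lyap (1 / 52492) x + 1 / 52492 * norm1 x ≤ lyap 0 x := by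
  have key : ∀ p q : ℕ, pospow (6562 * q + p - 1 / 52492) + 1 / 52492 * (p + q : ℕ) ≤
      pospow (6562 * q + p) := fun p q => by
    have := pospow_sub_le (6562 * q + p)
    push_cast at this ⊢
    linarith [(Nat.cast_nonneg q : (0 : ℝ) ≤ q)]
  rw [eq_st x, norm1_st, lyap_st, lyap_st]
  simp only [sub_zero]
  split_ifs with h1 h2
  · have := key (x .b1) (x .b4)
    rw [h1.1, h1.2.1]
    simpa using this
  · have := key (x .b3) (x .b2)
    rw [h2.1, h2.2.1]
    simpa [add_comm] using this
  · have h3 := pospow_sub_le (x .b1 + x .b2)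
    have h4 := pospow_sub_le (x .b3 + x .b4)
    push_cast at h3 h4 ⊢
    linarith

/-- There is a stationary distribution. -/
lemma exists_invariant : ∃ π : PMF State, (∀ x, ¬ Settled x → π x = 0) ∧
    ∀ y, ∑' x, π x * T params policy (ind y) x = π y := by
  obtain ⟨b, -, h⟩ := exists_T_lyap_le
  refine exists_stationary policy_nonIdling (V := fun z => ENNReal.ofReal (lyap 0 z))
    (b := ENNReal.ofReal b) (c := ENNReal.ofReal (1 / 52492)) ENNReal.ofReal_ne_top
    ENNReal.ofReal_ne_top (by norm_num) ENNReal.ofReal_ne_top fun x hx => ?_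
  refine (add_le_add_left (h 0 le_rfl x hx) _).trans ?_
  rw [zero_add, add_right_comm]
  refine add_le_add_left ?_ _
  rw [← ENNReal.ofReal_natCast, ← ENNReal.ofReal_mul (by norm_num),
    ← ENNReal.ofReal_add (lyap_nonneg _ _) (by positivity)]
  exact ENNReal.ofReal_le_ofReal (lyap_shift_add_le x)

lemma pospow_le_exp (z : ℝ) : pospow z ≤ 40320 * Real.exp z := by
  rcases le_total z 0 with h | h
  · rw [pospow_of_nonpos h]; positivity
  · rw [pospow_of_nonneg h]
    have := Real.pow_div_factorial_le_exp z h 8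
    rw [div_le_iff₀ (by positivity)] at this
    norm_num [Nat.factorial] at this
    linarith

lemma lyap_le_exp (a : ℝ) (x : State) :
    lyap a x ≤ 80640 * Real.exp (6562 * norm1 x - a) := by
  have key : ∀ z, z ≤ 6562 * (norm1 x : ℝ) → pospow (z - a) ≤
      40320 * Real.exp (6562 * norm1 x - a) := fun z hz =>
    (pospow_le_exp _).trans (mul_le_mul_of_nonneg_left (Real.exp_le_exp.2 (by linarith))
      (by norm_num))
  have h0 := Real.exp_pos (6562 * norm1 x - a)
  have hn : (norm1 x : ℝ) = x .b1 + x .b2 + x .b3 + x .b4 := by exact_mod_cast norm1_eq x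
  have p1 : (0 : ℝ) ≤ x .b1 := Nat.cast_nonneg _
  have p2 : (0 : ℝ) ≤ x .b2 := Nat.cast_nonneg _
  have p3 : (0 : ℝ) ≤ x .b3 := Nat.cast_nonneg _
  have p4 : (0 : ℝ) ≤ x .b4 := Nat.cast_nonneg _
  unfold lyap
  split_ifs
  · linarith [key (6562 * x .b4 + x .b1) (by linarith)]
  · linarith [key (6562 * x .b2 + x .b3) (by linarith)]
  · linarith [key (x .b1 + x .b2) (by linarith), key (x .b3 + x .b4) (by linarith)]

lemma half_norm_pow_le_lyap (x : State) : ((norm1 x : ℝ) / 2) ^ 8 ≤ lyap 0 x := by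
  have key : ∀ z, (norm1 x : ℝ) / 2 ≤ z → ((norm1 x : ℝ) / 2) ^ 8 ≤ pospow z := fun z hz => by
    rw [← pospow_of_nonneg (by positivity : 0 ≤ (norm1 x : ℝ) / 2)]
    exact pospow_mono hz
  have hn : (norm1 x : ℝ) = x .b1 + x .b2 + x .b3 + x .b4 := by exact_mod_cast norm1_eq x
  have p1 : (0 : ℝ) ≤ x .b1 := Nat.cast_nonneg _
  have p2 : (0 : ℝ) ≤ x .b2 := Nat.cast_nonneg _
  have p3 : (0 : ℝ) ≤ x .b3 := Nat.cast_nonneg _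
  have p4 : (0 : ℝ) ≤ x .b4 := Nat.cast_nonneg _
  unfold lyap
  simp only [sub_zero]
  split_ifs with h1 h2
  · refine key _ ?_
    rw [hn, h1.1, h1.2.1]
    push_cast
    linarith
  · refine key _ ?_
    rw [hn, h2.1, h2.2.1]
    push_cast
    linarith
  · rcases le_total ((norm1 x : ℝ) / 2) (x .b1 + x .b2) with h3 | h3
    · exact (key _ h3).trans (le_add_of_nonneg_right (pospow_nonneg _))
    · exact (key _ (by linarith)).trans (le_add_of_nonneg_left (pospow_nonneg _))

lemma iterate_T_lyap_le {b : ℝ} (h : ∀ a : ℝ, 0 ≤ a → ∀ x, Settled x →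
    T params policy (fun z => ENNReal.ofReal (lyap a z)) x ≤
      ENNReal.ofReal (lyap (a + 1 / 52492) x) + ENNReal.ofReal b) (n : ℕ) {a : ℝ} (ha : 0 ≤ a)
    {x : State} (hx : Settled x) :
    (T params policy)^[n] (fun z => ENNReal.ofReal (lyap a z)) x ≤
      ENNReal.ofReal (lyap (a + n * (1 / 52492)) x) + n * ENNReal.ofReal b := by
  induction n generalizing a with
  | zero => simp
  | succ n ih =>
    rw [Function.iterate_succ_apply]
    refine (iterate_T_mono_settled policy_nonIdling n (h a ha) hx).trans ?_
    rw [iterate_T_add, iterate_T_const]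
    refine (add_le_add_left (ih (a := a + 1 / 52492) (by positivity)) _).trans (le_of_eq ?_)
    push_cast
    ring_nf

lemma tsum_pois_mul_cast {a : ℝ} (ha : 0 ≤ a) :
    ∑' n, pois a n * (n : ℝ≥0∞) = ENNReal.ofReal a := by
  rw [tsum_eq_zero_add' ENNReal.summable]
  have : ∀ n : ℕ, pois a (n + 1) * ((n + 1 : ℕ) : ℝ≥0∞) = ENNReal.ofReal a * pois a n := fun n => by
    rw [pois, pois, ← ENNReal.ofReal_natCast, ← ENNReal.ofReal_mul (by positivity),
      ← ENNReal.ofReal_mul ha, Nat.factorial_succ]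
    congr 1
    push_cast
    field_simp
    ring
  simp only [this]
  rw [ENNReal.tsum_mul_left, tsum_pois ha]
  simp

/-- The process started in a state of norm `q` is small, in a polynomial sense, from a multiple of
`q` on. -/
lemma exists_prob_norm_le : ∃ B c : ℝ, 0 ≤ B ∧ 0 < c ∧ ∀ (x : State) (t r : ℝ), 0 ≤ t → 0 < r →
    prob params {ω | r ≤ norm1 (Q policy x t ω)} ≤
      ENNReal.ofReal (B * (t + Real.exp (6562 * norm1 x - c * t)) / r ^ 8) := by
  obtain ⟨b, hb, h⟩ := exists_T_lyap_le
  set s := Real.exp (-(1 / 52492)) with hs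
  have hs1 : s < 1 := by rw [hs, ← Real.exp_zero, Real.exp_lt_exp]; norm_num
  have hs0 : 0 < s := Real.exp_pos _
  refine ⟨256 * (26246 * b + 80640), 26246 * (1 - s), by positivity,
    mul_pos (by norm_num) (by linarith), fun x t r ht hr => ?_⟩
  set q : ℝ := (norm1 x : ℝ) with hq
  -- the mean of the Lyapunov function
  have h1 : ∀ n : ℕ, (T params policy)^[n] (fun z => ENNReal.ofReal (lyap 0 z)) (settle x) ≤
      ENNReal.ofReal (80640 * Real.exp (6562 * q)) * ENNReal.ofReal (s ^ n) +
        ENNReal.ofReal b * n := fun n => by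
    refine (iterate_T_lyap_le h n le_rfl (settled_settle x)).trans ?_
    rw [mul_comm (n : ℝ≥0∞)]
    refine add_le_add_left ?_ _
    rw [← ENNReal.ofReal_mul (by positivity)]
    refine ENNReal.ofReal_le_ofReal ((lyap_le_exp _ _).trans (le_of_eq ?_))
    rw [norm1_settle, hs, ← Real.exp_nat_mul, mul_assoc, ← Real.exp_add]
    congr 2
    ring
  have hat : 0 ≤ 26246 * t := by positivity
  have h2 : semi params policy t (fun z => ENNReal.ofReal (lyap 0 z)) (settle x) ≤
      ENNReal.ofReal (80640 * Real.exp (6562 * q - 26246 * (1 - s) * t) + b * (26246 * t)) := by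
    rw [semi, unifRate_params]
    calc _ ≤ ∑' n : ℕ, (ENNReal.ofReal (80640 * Real.exp (6562 * q)) *
          (pois (26246 * t) n * ENNReal.ofReal (s ^ n)) +
            ENNReal.ofReal b * (pois (26246 * t) n * n)) :=
          ENNReal.tsum_le_tsum fun n => (mul_le_mul_right (h1 n) _).trans (le_of_eq (by ring))
      _ = ENNReal.ofReal (80640 * Real.exp (6562 * q)) *
            ENNReal.ofReal (Real.exp (26246 * t * s - 26246 * t)) +
            ENNReal.ofReal b * ENNReal.ofReal (26246 * t) := by
          rw [ENNReal.tsum_add, ENNReal.tsum_mul_left, ENNReal.tsum_mul_left,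
            tsum_pois_mul_pow hat hs0.le, tsum_pois_mul_cast hat]
      _ = _ := by
          rw [← ENNReal.ofReal_mul (by positivity), ← ENNReal.ofReal_mul hb,
            ← ENNReal.ofReal_add (by positivity) (by positivity), mul_assoc, ← Real.exp_add]
          congr 4
          ring
  -- Markov's inequality
  have h3 : ENNReal.ofReal ((r / 2) ^ 8) * prob params {ω | r ≤ norm1 (Q policy x t ω)} ≤
      semi params policy t (fun z => ENNReal.ofReal (lyap 0 z)) (settle x) := by
    rw [← tsum_trans_mul params policy_nonIdling ht]
    have h4 : prob params {ω | r ≤ norm1 (Q policy x t ω)} ≤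
        ∑' y : State, if r ≤ norm1 y then trans params policy t x y else 0 := by
      refine (measure_mono fun ω (hω : r ≤ norm1 (Q policy x t ω)) => ?_).trans
        ((measure_iUnion_le (μ := prob params)
          fun y : State => {ω | r ≤ norm1 y ∧ Q policy x t ω = y}).trans
          (ENNReal.tsum_le_tsum fun y => ?_))
      · exact Set.mem_iUnion.2 ⟨_, hω, rfl⟩
      · split_ifs with hy
        · exact measure_mono fun ω hω => hω.2
        · simp [hy]
    refine (mul_le_mul_right h4 _).trans ?_
    rw [← ENNReal.tsum_mul_left]
    refine ENNReal.tsum_le_tsum fun y => ?_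
    split_ifs with hy
    · rw [mul_comm]
      refine mul_le_mul_right (ENNReal.ofReal_le_ofReal ?_) _
      exact (pow_le_pow_left₀ (by positivity) (by linarith) 8).trans (half_norm_pow_le_lyap y)
    · simp
  have h4 := h3.trans h2
  rw [mul_comm, ← ENNReal.le_div_iff_mul_le
    (Or.inl (ENNReal.ofReal_pos.2 (by positivity)).ne') (Or.inl ENNReal.ofReal_ne_top),
    ← ENNReal.ofReal_div_of_pos (by positivity)] at h4
  refine h4.trans (ENNReal.ofReal_le_ofReal ?_)
  rw [div_pow, div_div_eq_mul_div]
  refine div_le_div_of_nonneg_right ?_ (by positivity)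
  have := Real.exp_pos (6562 * q - 26246 * (1 - s) * t)
  nlinarith [mul_nonneg hb this.le]

/-! ### Reachability of the empty state -/

lemma exists_smaller {x : State} (hx : Settled x) : x = 0 ∨ ∃ y, Settled y ∧ norm1 y < norm1 x ∧
    ∀ f, wB * f y ≤ T params policy f x := by
  refine settled_cases (P := fun x => x = 0 ∨ ∃ y, Settled y ∧ norm1 y < norm1 x ∧
    ∀ f, wB * f y ≤ T params policy f x) ?_ (Or.inl rfl) (fun m => Or.inr ⟨st 0 0 0 m, ?_⟩)
    (fun k m => Or.inr ⟨if m = 0 then st 0 (k + 1) 0 0 else st (k + 1) 0 0 m, ?_⟩)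
    (fun a b c d => Or.inr ⟨st 0 (a + b + 1) 0 (c + d), ?_⟩) hx
  · rintro x (h | ⟨y, h1, h2, h3⟩)
    · left
      rw [← mirror_mirror x, h]
      exact st_zero
    · refine Or.inr ⟨mirror y, ⟨h1.2, h1.1⟩, ?_, fun f => ?_⟩
      · have e : ∀ z, norm1 (mirror z) = norm1 z := fun z => by
          rw [mirror, norm1_st, norm1_eq]; ring
        rwa [e, ← e x]
      · rw [← mirror_mirror x, T_mirror]
        exact h3 _
  · refine ⟨⟨fun _ => rfl, fun _ => rfl⟩, by simp [norm1_st], fun f => ?_⟩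
    rw [T_single]
    exact le_add_self
  · refine ⟨?_, ?_, fun f => ?_⟩
    · split_ifs with h
      · exact ⟨fun _ => rfl, fun _ => rfl⟩
      · exact ⟨fun h' => absurd h' h, fun _ => rfl⟩
    · split_ifs <;> simp only [norm1_st] <;> omega
    · rw [T_hold]
      exact le_add_self
  · refine ⟨⟨fun _ => rfl, fun _ => rfl⟩, by simp only [norm1_st]; omega, fun f => ?_⟩
    rw [T_both]
    exact le_add_self

lemma exists_iterate_T_pos {x : State} (hx : Settled x) :
    ∃ n, 0 < (T params policy)^[n] (ind 0) x := by
  induction hn : norm1 x using Nat.strong_induction_on generalizing x with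
  | _ n ih =>
    rcases exists_smaller hx with rfl | ⟨y, h1, h2, h3⟩
    · exact ⟨0, by simp [ind]⟩
    · obtain ⟨k, hk⟩ := ih _ (hn ▸ h2) h1 rfl
      refine ⟨k + 1, ?_⟩
      rw [Function.iterate_succ_apply']
      exact (ENNReal.mul_pos (by simp [wB]) hk.ne').trans_le (h3 _)

/-- The empty state is reached from everywhere. -/
lemma trans_zero_pos (x : State) : 0 < trans params policy 1 x 0 := by
  rw [trans_eq_semi _ policy_nonIdling zero_le_one]
  obtain ⟨n, hn⟩ := exists_iterate_T_pos (settled_settle x)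
  exact (ENNReal.mul_pos (pois_pos (by rw [mul_one]; exact unifRate_pos _) n).ne' hn.ne').trans_le
    (ENNReal.le_tsum n)

/-! ### The lower bound for the invariant measure -/

/-- The square root of the growth function `Ψ` of the statement. -/
def rootPsi (s : ℝ) : ℝ := Real.exp (Real.log s ^ 2 / 2)

lemma rootPsi_pos (s : ℝ) : 0 < rootPsi s := Real.exp_pos _

lemma convexOn_rootPsi : ConvexOn ℝ (Set.Ioi 0) rootPsi := by
  have h1 : ∀ s : ℝ, 0 < s → HasDerivAt rootPsi (rootPsi s * (Real.log s / s)) s := fun s hs => by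
    have h := (((Real.hasDerivAt_log hs.ne').fun_pow 2).div_const 2).exp
    refine h.congr_deriv ?_
    simp only [rootPsi]
    push_cast
    field_simp
  have h2 : ∀ s : ℝ, 0 < s → HasDerivAt (fun s => rootPsi s * (Real.log s / s))
      (rootPsi s * ((Real.log s ^ 2 - Real.log s + 1) / s ^ 2)) s := fun s hs => by
    have h := (h1 s hs).fun_mul ((Real.hasDerivAt_log hs.ne').fun_div (hasDerivAt_id' s) hs.ne')
    refine h.congr_deriv ?_
    field_simp
    ring
  refine convexOn_of_hasDerivWithinAt2_nonneg (convex_Ioi 0)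
    (f' := fun s => rootPsi s * (Real.log s / s))
    (f'' := fun s => rootPsi s * ((Real.log s ^ 2 - Real.log s + 1) / s ^ 2))
    (fun s hs => (h1 s hs).continuousAt.continuousWithinAt) ?_ ?_ ?_
  · rw [interior_Ioi]; exact fun s hs => (h1 s hs).hasDerivWithinAt
  · rw [interior_Ioi]; exact fun s hs => (h2 s hs).hasDerivWithinAt
  · rw [interior_Ioi]
    intro s hs
    have : 0 ≤ Real.log s ^ 2 - Real.log s + 1 := by nlinarith [sq_nonneg (Real.log s - 1 / 2)]
    exact mul_nonneg (rootPsi_pos s).le (div_nonneg this (sq_nonneg s))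

/-- Jensen's inequality for the increments of `q₁ + 6561 * q₄` while jobs are held back in
buffer 1. They have mean zero. -/
lemma rootPsi_le_avg {s : ℝ} (hs : 6561 < s) : rootPsi s ≤ 6561 / 26246 * rootPsi (s + 1) +
    6561 / 26246 * rootPsi (s + 6561) + 6562 / 26246 * rootPsi s +
      6562 / 26246 * rootPsi (s - 6561) := by
  have h := convexOn_rootPsi.map_sum_le (t := Finset.univ)
    (w := ![6561 / 26246, 6561 / 26246, 6562 / 26246, 6562 / 26246])
    (p := ![s + 1, s + 6561, s, s - 6561]) (fun i _ => by fin_cases i <;> norm_num)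
    (by simp only [Fin.sum_univ_four, Matrix.cons_val]; norm_num) (fun i _ => by
      fin_cases i <;> simp <;> linarith)
  simp only [Fin.sum_univ_four, smul_eq_mul, Matrix.cons_val] at h
  refine (le_of_eq ?_).trans h
  congr 1
  ring

lemma eight_le_log : 8 ≤ Real.log 6561 := by
  have h : 1 ≤ Real.log 3 := by
    rw [Real.le_log_iff_exp_le (by norm_num)]
    linarith [Real.exp_one_lt_d9]
  rw [show (6561 : ℝ) = 3 ^ 8 by norm_num, Real.log_pow]
  push_cast
  linarith

/-- The loss of the factor `m⁻⁸` is made up for by the factor `6561` in the argument. -/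
lemma rootPsi_le_scaled {m : ℝ} (hm : 1 ≤ m) :
    rootPsi m ≤ 1 / 8 * ((m ^ 8)⁻¹ * rootPsi (6561 * m)) := by
  have hm0 : 0 < m := by linarith
  have hl : 0 ≤ Real.log m := Real.log_nonneg hm
  have hg := eight_le_log
  have h1 : Real.exp 8 * m ^ 8 * rootPsi m ≤ rootPsi (6561 * m) := by
    have : m ^ 8 = Real.exp (8 * Real.log m) := by
      rw [← Real.exp_log hm0, ← Real.exp_nat_mul, Real.log_exp]; norm_num
    rw [this, rootPsi, rootPsi, ← Real.exp_add, ← Real.exp_add, Real.exp_le_exp,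
      Real.log_mul (by norm_num) hm0.ne']
    nlinarith
  have h2 : (8 : ℝ) ≤ Real.exp 8 := by linarith [Real.add_one_le_exp (8 : ℝ)]
  have h3 : 8 * m ^ 8 * rootPsi m ≤ rootPsi (6561 * m) := by
    refine le_trans ?_ h1
    exact mul_le_mul_of_nonneg_right (mul_le_mul_of_nonneg_right h2 (by positivity))
      (rootPsi_pos m).le
  rw [inv_mul_eq_div, one_div, inv_mul_eq_div, le_div_iff₀ (by norm_num),
    le_div_iff₀ (by positivity)]
  linarith

/-- A function that is subharmonic for the chain: while jobs are held back in buffer 1 it is a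
convex function of the martingale `q₁ + 6561 * q₄`; when there are `m` jobs in buffer 4 only, the
probability `m⁻⁸` to begin to hold back jobs is taken into account. -/
def growth (x : State) : ℝ :=
  if x .b2 = 0 ∧ x .b3 = 0 ∧ 0 < x .b4 then
    if 0 < x .b1 then rootPsi (x .b1 + 6561 * x .b4)
    else 1 / 8 * (((x .b4 : ℝ) ^ 8)⁻¹ * rootPsi (6561 * x .b4))
  else if x .b4 = 0 ∧ x .b1 = 0 ∧ 0 < x .b2 then
    if 0 < x .b3 then rootPsi (x .b3 + 6561 * x .b2)
    else 1 / 8 * (((x .b2 : ℝ) ^ 8)⁻¹ * rootPsi (6561 * x .b2))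
  else 0

lemma growth_st (p q r s : ℕ) : growth (st p q r s) =
    if q = 0 ∧ r = 0 ∧ 0 < s then
      if 0 < p then rootPsi (p + 6561 * s) else 1 / 8 * (((s : ℝ) ^ 8)⁻¹ * rootPsi (6561 * s))
    else if s = 0 ∧ p = 0 ∧ 0 < q then
      if 0 < r then rootPsi (r + 6561 * q) else 1 / 8 * (((q : ℝ) ^ 8)⁻¹ * rootPsi (6561 * q))
    else 0 := rfl

lemma growth_nonneg (x : State) : 0 ≤ growth x := by
  have := fun s => (rootPsi_pos s).le
  unfold growth
  split_ifs <;> first | exact this _ | exact le_rfl | skip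
  all_goals have h4 := this (6561 * x .b4); have h2 := this (6561 * x .b2); positivity

lemma growth_mirror (x : State) : growth (mirror x) = growth x := by
  rw [eq_st x, mirror_st, growth_st, growth_st]
  split_ifs
  all_goals first | rfl | (exfalso; omega)

lemma growth_hold (k m : ℕ) :
    growth (st (k + 1) 0 0 (m + 1)) = rootPsi ((k + 1 : ℕ) + 6561 * (m + 1 : ℕ)) := by
  simp [growth_st]

lemma growth_single (m : ℕ) : growth (st 0 0 0 (m + 1)) =
    1 / 8 * ((((m + 1 : ℕ) : ℝ) ^ 8)⁻¹ * rootPsi (6561 * (m + 1 : ℕ))) := by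
  simp [growth_st]

lemma growth_single_mirror (m : ℕ) : growth (st 0 (m + 1) 0 0) =
    1 / 8 * ((((m + 1 : ℕ) : ℝ) ^ 8)⁻¹ * rootPsi (6561 * (m + 1 : ℕ))) := by
  simp [growth_st]

lemma growth_le_T {x : State} (hx : Settled x) :
    ENNReal.ofReal (growth x) ≤ T params policy (fun z => ENNReal.ofReal (growth z)) x := by
  refine settled_cases (P := fun x => ENNReal.ofReal (growth x) ≤
    T params policy (fun z => ENNReal.ofReal (growth z)) x) (fun x hx => ?_) ?_ (fun m => ?_)
    (fun k m => ?_) (fun p q r s => ?_) hx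
  · rw [T_mirror] at hx
    simpa only [growth_mirror] using hx
  · rw [← st_zero, growth_st]; simp
  · rw [T_single, growth_single]
    have h1 : ENNReal.ofReal (1 / 8 * ((((m + 1 : ℕ) : ℝ) ^ 8)⁻¹ * rootPsi (6561 * (m + 1 : ℕ)))) ≤
        wA * (ENNReal.ofReal ((((m + 1 : ℕ) : ℝ) ^ 8)⁻¹) *
          ENNReal.ofReal (growth (st 1 0 0 (m + 1)))) := by
      have h2 : rootPsi (6561 * (m + 1 : ℕ)) ≤ growth (st 1 0 0 (m + 1)) := by
        rw [growth_hold 0 m, rootPsi, rootPsi, Real.exp_le_exp]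
        have h3 : (1 : ℝ) ≤ 6561 * (m + 1 : ℕ) := by
          push_cast; linarith [(m.cast_nonneg : (0 : ℝ) ≤ m)]
        have h4 := Real.log_nonneg h3
        have h5 : Real.log (6561 * (m + 1 : ℕ)) ≤ Real.log ((0 + 1 : ℕ) + 6561 * (m + 1 : ℕ)) :=
          Real.log_le_log (by linarith) (by push_cast; linarith)
        exact div_le_div_of_nonneg_right (pow_le_pow_left₀ h4 h5 2) zero_le_two
      rw [wA, ← ENNReal.ofReal_mul (by positivity), ← ENNReal.ofReal_mul (by norm_num)]
      refine ENNReal.ofReal_le_ofReal ?_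
      have h6 : 0 ≤ (((m + 1 : ℕ) : ℝ) ^ 8)⁻¹ := by positivity
      have h7 := mul_le_mul_of_nonneg_left h2 h6
      have h8 := mul_nonneg h6 (rootPsi_pos (6561 * (m + 1 : ℕ))).le
      nlinarith
    refine h1.trans ?_
    rw [mul_add, add_assoc, add_assoc]
    exact le_add_self.trans le_self_add
  · rw [T_hold, ofReal_avg (growth_nonneg _) (growth_nonneg _) (growth_nonneg _) (growth_nonneg _)]
    refine ENNReal.ofReal_le_ofReal ?_
    have h := rootPsi_le_avg (s := (k + 1 : ℕ) + 6561 * (m + 1 : ℕ)) (by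
      push_cast; linarith [(m.cast_nonneg : (0 : ℝ) ≤ m), (k.cast_nonneg : (0 : ℝ) ≤ k)])
    have e : rootPsi ((k + 1 : ℕ) + 6561 * (m + 1 : ℕ) - 6561) ≤
        growth (if m = 0 then st 0 (k + 1) 0 0 else st (k + 1) 0 0 m) := by
      rcases m with _ | m
      · rw [if_pos rfl, growth_single_mirror]
        refine le_trans (le_of_eq ?_) (rootPsi_le_scaled (m := (k + 1 : ℕ)) (by
          push_cast; linarith [(k.cast_nonneg : (0 : ℝ) ≤ k)]))
        congr 1; push_cast; ring
      · rw [if_neg (by omega), growth_hold]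
        refine le_of_eq ?_
        congr 1; push_cast; ring
    rw [growth_hold k m, growth_hold (k + 1) m, growth_hold k (m + 1)]
    have e1 : ((k + 1 + 1 : ℕ) : ℝ) + 6561 * (m + 1 : ℕ) =
      (k + 1 : ℕ) + 6561 * (m + 1 : ℕ) + 1 := by push_cast; ring
    have e2 : ((k + 1 : ℕ) : ℝ) + 6561 * (m + 1 + 1 : ℕ) =
      (k + 1 : ℕ) + 6561 * (m + 1 : ℕ) + 6561 := by push_cast; ring
    rw [e1, e2]
    linarith
  · rw [growth_st]; simp

/-- In the empty state the subharmonic function is zero, but not its mean after one step. -/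
lemma T_growth_zero_pos : 0 < T params policy (fun z => ENNReal.ofReal (growth z)) 0 := by
  rw [T_zero]
  have h : 0 < wA * ENNReal.ofReal (growth (st 0 0 0 1)) := by
    refine ENNReal.mul_pos (by simp [wA]) (ENNReal.ofReal_pos.2 ?_).ne'
    rw [growth_single 0]
    have := rootPsi_pos (6561 * (0 + 1 : ℕ))
    positivity
  refine h.trans_le ?_
  rw [add_assoc, add_assoc]
  exact le_self_add.trans le_add_self

lemma growth_le_Psi (x : State) :
    growth x ≤ Real.exp (Real.log 6561 ^ 2) * Psi (norm1 x) := by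
  have key : ∀ s : ℝ, 1 ≤ s → s ≤ 6561 * norm1 x →
      rootPsi s ≤ Real.exp (Real.log 6561 ^ 2) * Psi (norm1 x) := fun s h1 h2 => by
    have hn : (0 : ℝ) < norm1 x := by linarith
    rw [Psi, if_pos hn, Real.rpow_def_of_pos hn, ← Real.exp_add, rootPsi, Real.exp_le_exp]
    have h3 := Real.log_nonneg h1
    have h4 := Real.log_le_log (by linarith) h2
    rw [Real.log_mul (by norm_num) hn.ne'] at h4
    nlinarith [sq_nonneg (Real.log 6561 - Real.log (norm1 x))]
  have key' : ∀ m : ℕ, 0 < m → (m : ℝ) ≤ norm1 x →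
      1 / 8 * (((m : ℝ) ^ 8)⁻¹ * rootPsi (6561 * m)) ≤
      Real.exp (Real.log 6561 ^ 2) * Psi (norm1 x) := fun m h1 h2 => by
    have h3 : (1 : ℝ) ≤ m := by exact_mod_cast h1
    refine le_trans ?_ (key (6561 * m) (by linarith) (by linarith))
    have h4 := inv_pow_le_one m
    have h5 := mul_le_mul_of_nonneg_right h4 (rootPsi_pos (6561 * m)).le
    linarith [rootPsi_pos (6561 * m)]
  have hn : (norm1 x : ℝ) = x .b1 + x .b2 + x .b3 + x .b4 := by exact_mod_cast norm1_eq x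
  have p1 : (0 : ℝ) ≤ x .b1 := Nat.cast_nonneg _
  have p2 : (0 : ℝ) ≤ x .b2 := Nat.cast_nonneg _
  have p3 : (0 : ℝ) ≤ x .b3 := Nat.cast_nonneg _
  have p4 : (0 : ℝ) ≤ x .b4 := Nat.cast_nonneg _
  unfold growth
  split_ifs with h1 h2 h3 h4
  · have : (1 : ℝ) ≤ x .b4 := by exact_mod_cast h1.2.2
    exact key _ (by linarith) (by linarith)
  · exact key' _ h1.2.2 (by linarith)
  · have : (1 : ℝ) ≤ x .b2 := by exact_mod_cast h3.2.2
    exact key _ (by linarith) (by linarith)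
  · exact key' _ h3.2.2 (by linarith)
  · have : 0 ≤ Psi (norm1 x) := by unfold Psi; split_ifs <;> positivity
    positivity

/-- If the subharmonic function had finite mean, then this mean would increase in one step. -/
lemma meanPsi_eq_top {π : PMF State} (hs : ∀ x, ¬ Settled x → π x = 0)
    (hT : ∀ y, ∑' x, π x * T params policy (ind y) x = π y) (h0 : 0 < π 0) : meanPsi π = ∞ := by
  set f : State → ℝ≥0∞ := fun z => ENNReal.ofReal (growth z) with hf
  have h1 : ∑' x, π x * T params policy f x = ∑' x, π x * f x := tsum_mul_T hT f
  have h2 : ∑' x, π x * f x = ∞ := by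
    by_contra hfin
    have h3 : ∑' x, π x * f x < ∑' x, π x * T params policy f x := by
      refine ENNReal.tsum_lt_tsum (i := 0) hfin (fun x => ?_) ?_
      · by_cases hx : Settled x
        · exact mul_le_mul_right (growth_le_T hx) _
        · rw [hs x hx, zero_mul, zero_mul]
      · have : f 0 = 0 := by simp [hf, ← st_zero, growth_st]
        rw [this, mul_zero]
        exact ENNReal.mul_pos h0.ne' T_growth_zero_pos.ne'
    rw [h1] at h3
    exact lt_irrefl _ h3
  have h4 : ∑' x, π x * f x ≤ ENNReal.ofReal (Real.exp (Real.log 6561 ^ 2)) * meanPsi π := by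
    rw [meanPsi, ← ENNReal.tsum_mul_left]
    refine ENNReal.tsum_le_tsum fun x => ?_
    rw [mul_left_comm, ← ENNReal.ofReal_mul (Real.exp_pos _).le]
    exact mul_le_mul_right (ENNReal.ofReal_le_ofReal (growth_le_Psi x)) _
  rw [h2, top_le_iff] at h4
  by_contra h5
  exact ENNReal.mul_ne_top ENNReal.ofReal_ne_top h5 h4

lemma Psi_le_exp {θ : ℝ} (hθ : 0 < θ) : ∃ C : ℝ, 0 < C ∧ ∀ n : ℕ, Psi n ≤ C * Real.exp (θ * n) := by
  refine ⟨Real.exp (36 / θ ^ 2), Real.exp_pos _, fun n => ?_⟩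
  unfold Psi
  split_ifs with hn
  · have hL : 0 ≤ Real.log n := Real.log_natCast_nonneg n
    have h1 := Real.pow_div_factorial_le_exp (Real.log n) hL 3
    rw [Real.exp_log hn] at h1
    norm_num [Nat.factorial] at h1
    rw [Real.rpow_def_of_pos hn, ← Real.exp_add, Real.exp_le_exp]
    set L := Real.log n
    have h2 : θ * (L ^ 3 / 6) ≤ θ * n := mul_le_mul_of_nonneg_left h1 hθ.le
    rcases le_total L (6 / θ) with h | h
    · have h3 : L ^ 2 ≤ 36 / θ ^ 2 := by
        calc L ^ 2 ≤ (6 / θ) ^ 2 := pow_le_pow_left₀ hL h 2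
          _ = _ := by rw [div_pow]; norm_num
      have h4 : 0 ≤ θ * n := by positivity
      nlinarith
    · rw [div_le_iff₀ hθ] at h
      have h3 : 0 ≤ 36 / θ ^ 2 := by positivity
      nlinarith [mul_le_mul_of_nonneg_right h (sq_nonneg L)]
  · positivity

/-- A measure for which `Ψ(‖x‖)` has infinite mean has no exponential tail. -/
lemma not_hasExpTail_of_meanPsi {π : PMF State} (h : meanPsi π = ∞) : ¬ HasExpTail π := by
  rintro ⟨θ, hθ, hfin⟩
  obtain ⟨C, hC, hle⟩ := Psi_le_exp hθ
  have h1 : meanPsi π ≤ ENNReal.ofReal C *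
      ∑' x, π x * ENNReal.ofReal (Real.exp (θ * norm1 x)) := by
    rw [meanPsi, ← ENNReal.tsum_mul_left]
    refine ENNReal.tsum_le_tsum fun x => ?_
    rw [mul_left_comm, ← ENNReal.ofReal_mul hC.le]
    exact mul_le_mul_right (ENNReal.ofReal_le_ofReal (hle _)) _
  rw [h, top_le_iff] at h1
  exact ENNReal.mul_ne_top ENNReal.ofReal_ne_top hfin.ne h1

/-! ### Fluid limits -/

/-- The event that, started in some state with at most `n` jobs in each buffer, the process has at
least `n / M` jobs at some integer time in `[a * n, R * n]`. -/
def late (a M R n : ℕ) : Set Sample :=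
  ⋃ y ∈ Fintype.piFinset fun _ : Buffer => Finset.range (n + 1),
    ⋃ k ∈ Finset.Icc (a * n) (R * n), {ω | (n : ℝ) / M ≤ norm1 (Q policy y k ω)}

/-- The number of the events whose union is `late` is of the order `n ^ 5`, and the moment bound
makes the probability of each of them of the order `n ^ (-7)`. -/
lemma prob_late_le {B c : ℝ} (hB : 0 ≤ B) (hc : 0 < c)
    (h : ∀ (x : State) (t r : ℝ), 0 ≤ t → 0 < r →
      prob params {ω | r ≤ norm1 (Q policy x t ω)} ≤
        ENNReal.ofReal (B * (t + Real.exp (6562 * norm1 x - c * t)) / r ^ 8))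
    {a M R n : ℕ} (hac : 26248 ≤ c * a) (hM : 0 < M) (hn : 0 < n) :
    prob params (late a M R n) ≤
      ENNReal.ofReal (16 * (R + 1) ^ 2 * B * M ^ 8 * (1 / (n : ℝ) ^ 2)) := by
  have hM' : (0 : ℝ) < M := by exact_mod_cast hM
  have hn' : (1 : ℝ) ≤ n := by exact_mod_cast hn
  have h1 : ∀ y ∈ Fintype.piFinset fun _ : Buffer => Finset.range (n + 1),
      ∀ k ∈ Finset.Icc (a * n) (R * n),
      prob params {ω | (n : ℝ) / M ≤ norm1 (Q policy y k ω)} ≤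
        ENNReal.ofReal (B * (R * n + 1) / (n / M) ^ 8) := by
    intro y hy k hk
    refine (h y k (n / M) k.cast_nonneg (by positivity)).trans (ENNReal.ofReal_le_ofReal ?_)
    rw [Finset.mem_Icc] at hk
    have hk1 : (k : ℝ) ≤ R * n := by exact_mod_cast hk.2
    have hk2 : (a : ℝ) * n ≤ k := by exact_mod_cast hk.1
    have hy1 : (norm1 y : ℝ) ≤ 4 * n := by
      have : ∀ i, y i ≤ n := fun i =>
        Nat.lt_succ_iff.1 (Finset.mem_range.1 (Fintype.mem_piFinset.1 hy i))
      have h2 : norm1 y ≤ 4 * n := by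
        rw [norm1_eq]; linarith [this .b1, this .b2, this .b3, this .b4]
      exact_mod_cast h2
    have hexp : Real.exp (6562 * norm1 y - c * k) ≤ 1 := by
      rw [Real.exp_le_one_iff]
      have h3 := mul_le_mul_of_nonneg_left hk2 hc.le
      have h4 := mul_le_mul_of_nonneg_right hac (by linarith : (0 : ℝ) ≤ n)
      linarith
    refine div_le_div_of_nonneg_right (mul_le_mul_of_nonneg_left ?_ hB) (by positivity)
    linarith
  have h2 : prob params (late a M R n) ≤
      ∑ y ∈ Fintype.piFinset fun _ : Buffer => Finset.range (n + 1),
        ∑ k ∈ Finset.Icc (a * n) (R * n), ENNReal.ofReal (B * (R * n + 1) / (n / M) ^ 8) :=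
    (measure_biUnion_finset_le _ _).trans (Finset.sum_le_sum fun y hy =>
      (measure_biUnion_finset_le _ _).trans (Finset.sum_le_sum fun k hk => h1 y hy k hk))
  refine h2.trans ?_
  have hcard : (Fintype.piFinset fun _ : Buffer => Finset.range (n + 1)).card = (n + 1) ^ 4 := by
    rw [Fintype.card_piFinset, Finset.prod_const, Finset.card_range, Finset.card_univ,
      show Fintype.card Buffer = 4 from rfl]
  rw [Finset.sum_const, Finset.sum_const, hcard, Nat.card_Icc, nsmul_eq_mul, nsmul_eq_mul,
    ← ENNReal.ofReal_natCast, ← ENNReal.ofReal_natCast, ← ENNReal.ofReal_mul (Nat.cast_nonneg _),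
    ← ENNReal.ofReal_mul (Nat.cast_nonneg _)]
  refine ENNReal.ofReal_le_ofReal ?_
  have h3 : ((R * n + 1 - a * n : ℕ) : ℝ) ≤ (R + 1) * n := by
    have : ((R * n + 1 - a * n : ℕ) : ℝ) ≤ (R * n + 1 : ℕ) := by exact_mod_cast Nat.sub_le _ _
    push_cast at this
    linarith
  have h4 : (((n + 1) ^ 4 : ℕ) : ℝ) ≤ 16 * n ^ 4 := by
    push_cast
    calc ((n : ℝ) + 1) ^ 4 ≤ (2 * n) ^ 4 := pow_le_pow_left₀ (by positivity) (by linarith) 4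
      _ = _ := by ring
  have h5 : B * (R * n + 1) / ((n : ℝ) / M) ^ 8 ≤ B * ((R + 1) * n) / ((n : ℝ) / M) ^ 8 :=
    div_le_div_of_nonneg_right (mul_le_mul_of_nonneg_left (by linarith) hB) (by positivity)
  calc _ ≤ 16 * (n : ℝ) ^ 4 * ((R + 1) * n * (B * ((R + 1) * n) / ((n : ℝ) / M) ^ 8)) :=
        mul_le_mul h4 (mul_le_mul h3 h5 (by positivity) (by positivity)) (by positivity)
          (by positivity)
    _ = _ := by field_simp

lemma tsum_prob_late_ne_top {a M R : ℕ} {C : ℝ}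
    (h : ∀ n : ℕ, 0 < n → prob params (late a M R n) ≤ ENNReal.ofReal (C * (1 / (n : ℝ) ^ 2)))
    (hC : 0 ≤ C) : ∑' n, prob params (late a M R (n + 1)) ≠ ∞ := by
  refine ne_top_of_le_ne_top ?_ (ENNReal.tsum_le_tsum fun n => h (n + 1) n.succ_pos)
  have hs : Summable fun n : ℕ => C * (1 / ((n + 1 : ℕ) : ℝ) ^ 2) :=
    ((summable_nat_add_iff 1).2 (Real.summable_one_div_nat_pow.2 one_lt_two)).mul_left C
  rw [← ENNReal.ofReal_tsum_of_nonneg (fun n => by positivity) hs]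
  exact ENNReal.ofReal_ne_top

/-- From some multiple of `n` on, almost surely none of the events `late` occurs for large `n`. -/
lemma exists_ae_not_late : ∃ a : ℕ, ∀ᵐ ω ∂(prob params), ∀ M R : ℕ, 0 < M →
    ∀ᶠ n in atTop, ω ∉ late a M R n := by
  obtain ⟨B, c, hB, hc, h⟩ := exists_prob_norm_le
  obtain ⟨a, ha⟩ := exists_nat_ge (26248 / c)
  have hac : 26248 ≤ c * a := by rwa [div_le_iff₀ hc, mul_comm] at ha
  refine ⟨a, ae_all_iff.2 fun M => ae_all_iff.2 fun R => ?_⟩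
  rcases M.eq_zero_or_pos with h0 | hM
  · exact ae_of_all _ fun ω h => absurd h h0.not_gt
  have hsum := tsum_prob_late_ne_top (R := R) (fun n hn => prob_late_le hB hc h hac hM hn)
    (by positivity)
  refine (ae_eventually_notMem hsum).mono fun ω hω _ => ?_
  obtain ⟨n₀, hn₀⟩ := eventually_atTop.1 hω
  refine eventually_atTop.2 ⟨n₀ + 1, fun n hn => ?_⟩
  have h1 := hn₀ (n - 1) (by omega)
  rwa [Nat.sub_add_cancel (by omega)] at h1

lemma sum_qScaled (φ : Policy) (κ : ℝ) (x : Buffer → ℝ) (ω : Sample) (t : ℝ) :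
    ∑ i, qScaled φ κ x ω t i = κ⁻¹ * norm1 (Q φ (fun j => ⌊κ * x j⌋₊) (κ * t) ω) := by
  simp only [qScaled, norm1, ← Finset.mul_sum, Nat.cast_sum]

lemma tendsto_sum_qScaled {ω : Sample} (hω : Regular ω) {a : ℕ}
    (h : ∀ M R : ℕ, 0 < M → ∀ᶠ n in atTop, ω ∉ late a M R n) {x : Buffer → ℝ}
    (hx0 : ∀ i, 0 ≤ x i) (hx1 : ∑ i, x i = 1) {t : ℝ} (ht : a + 1 ≤ t) :
    Tendsto (fun κ : ℝ => ∑ i, qScaled policy κ x ω t i) atTop (𝓝 0) := by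
  have ht0 : 0 < t := by linarith [(a.cast_nonneg : (0 : ℝ) ≤ a)]
  rw [Metric.tendsto_atTop']
  intro ε hε
  obtain ⟨M, hM⟩ := exists_nat_gt (6 / ε)
  have hM0 : (0 : ℝ) < M := (by positivity : 0 < 6 / ε).trans hM
  rw [div_lt_iff₀ hε] at hM
  have hk : Tendsto (fun κ : ℝ => ⌊κ * t⌋₊) atTop atTop :=
    tendsto_nat_floor_atTop.comp (tendsto_id.atTop_mul_const ht0)
  have hn : Tendsto (fun κ : ℝ => ⌈κ⌉₊) atTop atTop := tendsto_nat_ceil_atTop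
  have harr : ∀ i, ∀ᶠ κ : ℝ in atTop, (arrivals ω i (⌊κ * t⌋₊ + 1) : ℝ) - arrivals ω i ⌊κ * t⌋₊ ≤
      ε / (3 * t) * ⌊κ * t⌋₊ := by
    intro i
    have h1 := (tendsto_arrivals_succ_sub hω i).eventually_lt_const
      (show 0 < ε / (3 * t) by positivity)
    filter_upwards [hk.eventually h1, hk.eventually_gt_atTop 0] with κ h2 h3
    have h4 : (0 : ℝ) < ⌊κ * t⌋₊ := by exact_mod_cast h3
    rw [div_lt_iff₀ h4] at h2
    exact h2.le
  have hev := (((hn.eventually (h M ⌈t⌉₊ (by exact_mod_cast hM0))).and (harr .b1)).and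
    (harr .b3)).and (eventually_gt_atTop ((a : ℝ) + 1))
  obtain ⟨K, hK⟩ := eventually_atTop.1 hev
  refine ⟨K, fun κ hκ => ?_⟩
  obtain ⟨⟨⟨h1, h2⟩, h3⟩, h4⟩ := hK κ hκ.le
  have hκ0 : 0 < κ := by linarith [(a.cast_nonneg : (0 : ℝ) ≤ a)]
  have hκ1 : 1 < κ := by linarith [(a.cast_nonneg : (0 : ℝ) ≤ a)]
  set n := ⌈κ⌉₊ with hndef
  set k := ⌊κ * t⌋₊ with hkdef
  set y : State := fun j => ⌊κ * x j⌋₊ with hy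
  have hn1 : κ ≤ n := Nat.le_ceil κ
  have hn2 : (n : ℝ) < κ + 1 := Nat.ceil_lt_add_one hκ0.le
  have hk1 : (k : ℝ) ≤ κ * t := Nat.floor_le (by positivity)
  have hk2 : κ * t < k + 1 := Nat.lt_floor_add_one _
  -- the bound at the integer time before `κ * t`
  have hQk : (norm1 (Q policy y k ω) : ℝ) < n / M := by
    by_contra! hcon
    refine h1 ?_
    refine Set.mem_iUnion₂.2 ⟨y, ?_, Set.mem_iUnion₂.2 ⟨k, ?_, hcon⟩⟩
    · refine Fintype.mem_piFinset.2 fun i => Finset.mem_range.2 (Nat.lt_succ_of_le ?_)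
      have hxi : x i ≤ 1 := hx1 ▸ Finset.single_le_sum (fun j _ => hx0 j) (Finset.mem_univ i)
      exact Nat.floor_le_of_le ((mul_le_of_le_one_right hκ0.le hxi).trans hn1)
    · rw [Finset.mem_Icc]
      constructor
      · refine Nat.le_floor ?_
        push_cast
        have h5 : κ * (a + 1) ≤ κ * t := mul_le_mul_of_nonneg_left ht hκ0.le
        have h6 : (a : ℝ) * n ≤ a * (κ + 1) := mul_le_mul_of_nonneg_left hn2.le a.cast_nonneg
        linarith
      · have h5 : (k : ℝ) ≤ (⌈t⌉₊ * n : ℕ) := by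
          push_cast
          calc (k : ℝ) ≤ κ * t := hk1
            _ ≤ n * ⌈t⌉₊ := mul_le_mul hn1 (Nat.le_ceil t) ht0.le (Nat.cast_nonneg _)
            _ = _ := mul_comm _ _
        exact_mod_cast h5
  -- the arrivals since then
  have hQ := norm1_Q_le policy y hω (Nat.cast_nonneg k) hk1
  have hQ' : (norm1 (Q policy y (κ * t) ω) : ℝ) + arrivals ω .b1 k + arrivals ω .b3 k ≤
      norm1 (Q policy y k ω) + arrivals ω .b1 (κ * t) + arrivals ω .b3 (κ * t) := by
    exact_mod_cast hQ
  have hA : ∀ i, (arrivals ω i (κ * t) : ℝ) ≤ arrivals ω i (k + 1) := fun i => by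
    exact_mod_cast arrivals_mono hω i hk2.le
  have hfin : (norm1 (Q policy y (κ * t) ω) : ℝ) < κ * ε := by
    have h5 : ε / (3 * t) * k ≤ κ * ε / 3 := by
      calc ε / (3 * t) * k ≤ ε / (3 * t) * (κ * t) :=
            mul_le_mul_of_nonneg_left hk1 (by positivity)
        _ = _ := by field_simp
    have h6 : (n : ℝ) / M ≤ κ * ε / 3 := by
      rw [div_le_iff₀ hM0]
      nlinarith
    linarith [hA .b1, hA .b3]
  rw [sum_qScaled, Real.dist_eq, sub_zero, abs_of_nonneg (by positivity), inv_mul_lt_iff₀ hκ0]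
  exact hfin

/-- A fluid limit with `‖q(0)‖ = 1` starts on the unit sphere, so that the scaled processes of which
it is a limit vanish from some time on. -/
lemma fluidLimit_eq_zero {ω : Sample} (hω : Regular ω) {φ : Policy} {T₀ : ℝ} (hT₀ : 0 ≤ T₀)
    (h : ∀ x : Buffer → ℝ, (∀ i, 0 ≤ x i) → ∑ i, x i = 1 → ∀ t, T₀ ≤ t →
      Tendsto (fun κ : ℝ => ∑ i, qScaled φ κ x ω t i) atTop (𝓝 0))
    {x : Buffer → ℝ} (hx : ∀ i, 0 ≤ x i) {q z : ℝ → Buffer → ℝ} (hq : IsFluidLimit φ x ω q z)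
    (hq0 : ∑ i, |q 0 i| = 1) {t : ℝ} (ht : T₀ ≤ t) : q t = 0 := by
  obtain ⟨κ, hκ0, hκ, hlim⟩ := hq
  have hpt : ∀ s, 0 ≤ s → ∀ i, Tendsto (fun n => qScaled φ (κ n) x ω s i) atTop (𝓝 (q s i)) :=
    fun s hs i => ((tendsto_pi_nhds.1 ((hlim s).1.tendsto_at (Set.right_mem_Icc.2 hs))) i)
  have hnn : ∀ s, 0 ≤ s → ∀ i, 0 ≤ q s i := fun s hs i =>
    ge_of_tendsto' (hpt s hs i) fun n => by
      have := (hκ0 n).le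
      unfold qScaled; positivity
  have hsum : ∀ s, 0 ≤ s → Tendsto (fun n => ∑ i, qScaled φ (κ n) x ω s i) atTop
      (𝓝 (∑ i, q s i)) := fun s hs => tendsto_finsetSum _ fun i _ => hpt s hs i
  have hx1 : ∑ i, x i = 1 := by
    have h1 : ∑ i, q 0 i = 1 := by
      rw [← hq0]
      exact Finset.sum_congr rfl fun i _ => (abs_of_nonneg (hnn 0 le_rfl i)).symm
    rw [← h1]
    refine tendsto_nhds_unique ?_ (hsum 0 le_rfl)
    have h2 : ∀ n, ∑ i, qScaled φ (κ n) x ω 0 i = ∑ i, (⌊κ n * x i⌋₊ : ℝ) / κ n := fun n => by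
      rw [sum_qScaled, mul_zero, Q_zero _ hω, norm1_settle, norm1, Nat.cast_sum, Finset.mul_sum]
      exact Finset.sum_congr rfl fun i _ => by rw [div_eq_inv_mul]
    simp only [h2]
    refine tendsto_finsetSum _ fun i _ => ?_
    have h3 := (tendsto_nat_floor_mul_div_atTop (hx i)).comp hκ
    refine h3.congr fun n => ?_
    simp only [Function.comp_apply, mul_comm]
  have ht0 := hT₀.trans ht
  have h1 : ∑ i, q t i = 0 := tendsto_nhds_unique (hsum t ht0) ((h x hx hx1 t ht).comp hκ)
  funext i
  exact (Finset.sum_eq_zero_iff_of_nonneg fun i _ => hnn t ht0 i).1 h1 i (Finset.mem_univ i)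

end KSRS

end

theorem theorem2 :
    ∃ (N : KSRS.Params) (φ : KSRS.Policy), φ.NonIdling ∧
      KSRS.ExponentialPrimitives N (KSRS.prob N) ∧
      KSRS.FluidLimitStable N φ ∧ KSRS.ScaledPathsVanish N φ ∧
      ∃ π : PMF KSRS.State, KSRS.IsInvariant N φ π ∧
        (∀ π' : PMF KSRS.State, KSRS.IsInvariant N φ π' → π' = π) ∧
        KSRS.meanPsi π = ⊤ ∧ ¬ KSRS.HasExpTail π ∧ ¬ KSRS.ExpErgodic N φ := by
  open KSRS in
  obtain ⟨a, ha⟩ := exists_ae_not_late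
  obtain ⟨π, hs, hT⟩ := exists_invariant
  have hφ := policy_nonIdling
  have hπ : IsInvariant params policy π := isInvariant_of_stationary hφ hs hT
  have hπ0 : 0 < π 0 := by
    obtain ⟨x, hx⟩ := π.support_nonempty
    rw [hπ 1 zero_le_one 0]
    exact (ENNReal.mul_pos ((PMF.mem_support_iff _ _).1 hx) (trans_zero_pos x).ne').trans_le
      (ENNReal.le_tsum x)
  have hΨ := meanPsi_eq_top hs hT hπ0
  have hpath : ∀ᵐ ω ∂(prob params), Regular ω ∧ ∀ x : Buffer → ℝ, (∀ i, 0 ≤ x i) → ∑ i, x i = 1 →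
      ∀ t, (a : ℝ) + 1 ≤ t → Tendsto (fun κ : ℝ => ∑ i, qScaled policy κ x ω t i) atTop (𝓝 0) := by
    filter_upwards [ae_regular params, ha] with ω hω h
    exact ⟨hω, fun x hx0 hx1 t ht => tendsto_sum_qScaled hω h hx0 hx1 ht⟩
  have ha0 : (0 : ℝ) < a + 1 := by positivity
  refine ⟨params, policy, hφ, exponentialPrimitives params, ⟨a + 1, ha0, ?_⟩, ⟨a + 1, ha0, ?_⟩,
    π, hπ, fun π' hπ' => hπ.unique hφ trans_zero_pos hπ', hΨ, not_hasExpTail_of_meanPsi hΨ, ?_⟩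
  · filter_upwards [hpath] with ω hω x hx q z hq hq0 t ht
    exact fluidLimit_eq_zero hω.1 ha0.le hω.2 hx hq hq0 ht
  · filter_upwards [hpath] with ω hω
    exact hω.2
  · rintro ⟨π', hπ', θ, hθ, hconv⟩
    have h1 : π' = π := hπ.unique hφ trans_zero_pos hπ'
    exact not_hasExpTail_of_meanPsi hΨ (hasExpTail_of_exp_convergence hφ trans_zero_pos hπ hθ
      (h1 ▸ hconv 0 0))
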